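/- Let $\alpha>3$ be a quadratic unit with positive conjugate $\alpha_2$, i.e. $\alpha,\alpha_2$ are the two roots of $x^2-bx+1$ with $b\in\mathbb N$ (so $\alpha_2=1/\alpha$). Let $\|x\|$ be the distance from $x\in\mathbb R$ to the nearest integer and $\mathcal L(\alpha)=\{\limsup_{n\to\infty}\|\xi\alpha^n\| : \xi\in\mathbb R\}$. Define integers $p_n,q_n$ $(n\ge 0)$ by $$p_0=0,\ p_2=1,\ p_{2n+2}=bp_{2n}-p_{2n-2},\ p_{2n-1}=p_{2n-2}+p_{2n},$$ $$q_0=1,\ q_2=1+b,\ q_{2n+2}=bq_{2n}-q_{2n-2},\ q_{2n-1}=q_{2n-2}+q_{2n}\qquad(n\ge 1).$$ *Notation for words.* A finite word over $\{0,1\}$ is balanced if the numbers of $1$'s in any two factors of equal length differ by at most $1$. A property holds eventually locally for a right infinite word $y$ if there are $m_0$ and $q(m)\to\infty$ such that for each $m\ge m_0$ it holds for the factor of $y$ at the positions within distance $q(m)$ of $m$; $y\in\{0,1\}^{\mathbb N}$ is eventually balanced if it is eventually locally balanced. For coprime $0\le p\le q$ the lower and upper Christoffel words of slope $p/q$ are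 $(\lfloor p(i+1)/q\rfloor-\lfloor pi/q\rfloor)_{0\le i<q}$ and $(\lceil p(i+1)/q\rceil-\lceil pi/q\rceil)_{0\le i<q}$. Let $\gamma$ be the morphism $0\mapsto 0$, $1\mapsto 1\,\overline 1$, where $\overline 1=-1$. For a bounded integer word $s=s_1s_2\dots$ put $g(s)=\frac1{\alpha-\alpha_2}\sum_{i\ge1}s_i\alpha^{-i}$, and let $M=\frac1{\alpha-\alpha_2}\mathbb Z[\alpha]$. Then: 1. $(p_n/q_n)_{n\ge0}$ is strictly increasing and converges to $1/(1+\alpha)$. 2. Let $P_n/Q_n=[0;\underbrace{1+b,b,\dots,b}_{n}]_{neg}$ in lowest terms, where $[0;a_1,\dots,a_n]_{neg}=1/(a_1-1/(a_2-\cdots-1/a_n))$ (and $P_0/Q_0=0/1$). Then $P_n/Q_n\to 1/(1+\alpha)$, $p_{2n}/q_{2n}=P_n/Q_n$ for $n\ge 0$ and $p_{2n-1}/q_{2n-1}=(P_{n-1}+P_n)/(Q_{n-1}+Q_n)$ for $n\ge 1$. 3. $\mathcal L(\alpha)\cap[0,\tfrac1{1+\alpha}]=\{p_n/q_n: n\ge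 0\}\cup\{\tfrac1{1+\alpha}\}$, and $1/(1+\alpha)$ is the smallest limit point of $\mathcal L(\alpha)$. 4. For each $n\ge0$ the set $X_n=\{\xi\in\mathbb R:\limsup_{m\to\infty}\|\xi\alpha^m\|=p_n/q_n\}$ is contained in $\mathbb Q(\alpha)$, and $X_n$ is the set of all $\pm g(s_{k+1}s_{k+2}\dots)+x$ where $s=\gamma(\nu\nu\nu\dots)$ with a Christoffel word $\nu$ such that $\gamma(\nu)$ has length $n+1$, $0\le k\le n$, and $x\in M$. 5. The set $X_\infty=\{\xi\in\mathbb R:\limsup_{m\to\infty}\|\xi\alpha^m\|=1/(1+\alpha)\}$ is uncountable. It contains $\pm g(s_ks_{k+1}\dots)+x$ whenever $k\in\{1,2\}$, $x\in M$ and $s=\gamma(y)$ with an eventually balanced word $y\in\{0,1\}^{\mathbb N}$ that is not eventually periodic. Moreover $X_\infty$ is exactly the set of all $g(s)+x$ where $x\in M$ and $s$ is an integer word that is not eventually periodic and such that, eventually locally, $s$ is a factor of $\gamma(u)$ or of $-\gamma(u)$ for some balanced finite word $u$. -/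

import Mathlib

open Filter Topology

noncomputable section

/-! ### The spectrum -/

/-- Distance `‖x‖` from a real number to the nearest integer. -/
def nint (x : ℝ) : ℝ := |x - round x|

/-- `limsup_{n → ∞} ‖ξ αⁿ‖`. -/
def limsupDist (α ξ : ℝ) : ℝ := limsup (fun n : ℕ => nint (ξ * α ^ n)) atTop

/-- The Lagrange spectrum of the geometric progressions with ratio `α`. -/
def lagrangeSpectrum (α : ℝ) : Set ℝ := Set.range (limsupDist α)

/-- The set of all `ξ` whose limit superior is `t`. -/
def levelSet (α t : ℝ) : Set ℝ := {ξ : ℝ | limsupDist α ξ = t}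

/-! ### The sequences `p` and `q` and negative continued fractions -/

/-- The sequence `u, v, b v - u, …` with `e (n+2) = b e (n+1) - e n`. -/
def recSeq (b u v : ℤ) : ℕ → ℤ
  | 0 => u
  | 1 => v
  | n + 2 => b * recSeq b u v (n + 1) - recSeq b u v n

/-- The sequence with value `e m` at `2m` and `e m + e (m+1)` at `2m+1`. -/
def interleave (e : ℕ → ℤ) (n : ℕ) : ℤ :=
  if n % 2 = 0 then e (n / 2) else e (n / 2) + e (n / 2 + 1)

/-- `p₀ = 0, p₂ = 1, p_{2n+2} = b p_{2n} - p_{2n-2}, p_{2n-1} = p_{2n-2} + p_{2n}`. -/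
def pSeq (b : ℕ) : ℕ → ℤ := interleave (recSeq b 0 1)

/-- `q₀ = 1, q₂ = 1 + b, q_{2n+2} = b q_{2n} - q_{2n-2}, q_{2n-1} = q_{2n-2} + q_{2n}`. -/
def qSeq (b : ℕ) : ℕ → ℤ := interleave (recSeq b 1 (1 + b))

/-- `[0; a₁, …, aₙ]_neg = 1 / (a₁ - 1 / (a₂ - ⋯ - 1 / aₙ))`. -/
def negCF : List ℚ → ℚ
  | [] => 0
  | a :: l => 1 / (a - negCF l)

/-- The `n`-th convergent `[0; 1+b, b, …, b]_neg` (with `n` partial quotients). -/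
def negConv (b : ℕ) : ℕ → ℚ
  | 0 => negCF []
  | n + 1 => negCF ((1 + b : ℚ) :: List.replicate n (b : ℚ))

/-! ### Words. The letters `0` and `1` are `false` and `true`. -/

/-- Balanced finite words over `{0,1}`. -/
def BalancedWord (x : List Bool) : Prop :=
  ∀ u v : List Bool, u <:+: x → v <:+: x → u.length = v.length →
    u.count true ≤ v.count true + 1

/-- The factor `y_i y_{i+1} … y_j` of a right infinite word. -/
def window {A : Type} (y : ℕ → A) (i j : ℕ) : List A :=
  (List.range' i (j + 1 - i)).map y

/-- There are `m₀` and `q(m) → ∞` such that for every `m ≥ m₀` the factor of `y` on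
`[max(0, m - q(m)), m + q(m)]` satisfies `P` (the subtraction of naturals truncates at `0`). -/
def EventuallyLocally {A : Type} (P : List A → Prop) (y : ℕ → A) : Prop :=
  ∃ (m₀ : ℕ) (q : ℕ → ℕ), Tendsto q atTop atTop ∧
    ∀ m, m₀ ≤ m → P (window y (m - q m) (m + q m))

/-- Eventually balanced right infinite words. -/
def EventuallyBalanced (y : ℕ → Bool) : Prop := EventuallyLocally BalancedWord y

/-- Eventually periodic right infinite words. -/
def EventuallyPeriodic {A : Type} (y : ℕ → A) : Prop :=
  ∃ N T : ℕ, 0 < T ∧ ∀ n, N ≤ n → y (n + T) = y n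

/-- The lower Christoffel word of slope `p/q`. -/
def lowerChristoffel (p q : ℕ) : List Bool :=
  (List.range q).map fun i : ℕ =>
    decide (⌊(p * (i + 1) : ℚ) / q⌋ - ⌊(p * i : ℚ) / q⌋ = 1)

/-- The upper Christoffel word of slope `p/q`. -/
def upperChristoffel (p q : ℕ) : List Bool :=
  (List.range q).map fun i : ℕ =>
    decide (⌈(p * (i + 1) : ℚ) / q⌉ - ⌈(p * i : ℚ) / q⌉ = 1)

/-- Christoffel words (coprimality of `p ≤ q` forces `q ≥ 1`). -/
def IsChristoffel (ν : List Bool) : Prop :=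
  ∃ p q : ℕ, p ≤ q ∧ p.Coprime q ∧ (ν = lowerChristoffel p q ∨ ν = upperChristoffel p q)

/-- The periodic right infinite word `ν ν ν …` (for a non-empty `ν`). -/
def periodicWord (ν : List Bool) : ℕ → Bool := fun i => ν.getD (i % ν.length) false

/-! ### Coding and realization -/

/-- The morphism with `0 ↦ 0` and `1 ↦ 1, -1` on finite words. -/
def gam (x : List Bool) : List ℤ := x.flatMap fun c => if c then [1, -1] else [0]

/-- The same morphism on right infinite words: as no letter is erased, the image of the prefix
of length `n + 1` has a letter of index `n`. -/
def gamSeq (y : ℕ → Bool) (n : ℕ) : ℤ := (gam (window y 0 n)).getD n 0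

/-- `w` is a factor of the image of a balanced word, or of the negative of such an image. -/
def SignedCodedBalanced (w : List ℤ) : Prop :=
  ∃ x : List Bool, BalancedWord x ∧ (w <:+: gam x ∨ w <:+: (gam x).map fun a => -a)

/-- The weights of the realization map, for a quadratic number `α` with conjugate `α₂`. -/
def tau (α α₂ : ℝ) (i : ℤ) : ℝ :=
  if i ≤ 0 then α₂ ^ (-i) / (α - α₂) else α ^ (-i) / (α - α₂)

/-- The realization map on (bounded) bi-infinite integer words. -/
def realize (α α₂ : ℝ) (s : ℤ → ℤ) : ℝ := ∑' i : ℤ, (s i : ℝ) * tau α α₂ i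

/-- The bi-infinite word `0^∞ . s₀ s₁ s₂ …`: the letter `s₀` has index `1`. -/
def padZero (s : ℕ → ℤ) : ℤ → ℤ := fun i => if i ≤ 0 then 0 else s (i - 1).toNat

/-- The set `(1 / (α - α₂)) ℤ[α]`. -/
def baseSet (α α₂ : ℝ) : Set ℝ :=
  {x : ℝ | ∃ z ∈ Algebra.adjoin ℤ ({α} : Set ℝ), x = z / (α - α₂)}

/-- The set of all `± g(0^∞ . s_k s_{k+1} …) + x` where `s = γ(ν ν ν …)` with a Christoffel word
`ν` such that `γ(ν)` has length `n + 1`, where `0 ≤ k ≤ n`, and `x ∈ (1 / (α - α₂)) ℤ[α]`. -/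
def christoffelSet (α α₂ : ℝ) (n : ℕ) : Set ℝ :=
  {ξ : ℝ | ∃ ν : List Bool, IsChristoffel ν ∧ (gam ν).length = n + 1 ∧
    ∃ k ≤ n, ∃ x ∈ baseSet α α₂,
      ξ = realize α α₂ (padZero fun i => gamSeq (periodicWord ν) (k + i)) + x ∨
      ξ = -realize α α₂ (padZero fun i => gamSeq (periodicWord ν) (k + i)) + x}

/-- The set of all `± g(0^∞ . s_k s_{k+1} …) + x` where `s = γ(y)` with an eventually balanced
word `y` that is not eventually periodic, where `k` is the first or the second index, and
`x ∈ (1 / (α - α₂)) ℤ[α]`. -/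
def eventuallyBalancedSet (α α₂ : ℝ) : Set ℝ :=
  {ξ : ℝ | ∃ y : ℕ → Bool, EventuallyBalanced y ∧ ¬ EventuallyPeriodic y ∧
    ∃ k ≤ 1, ∃ x ∈ baseSet α α₂,
      ξ = realize α α₂ (padZero fun i => gamSeq y (k + i)) + x ∨
      ξ = -realize α α₂ (padZero fun i => gamSeq y (k + i)) + x}

/-- The set of all `g(0^∞ . s₀ s₁ …) + x` where `s` is an integer word that is not eventually
periodic and is eventually locally the image, up to sign, of a balanced word, and
`x ∈ (1 / (α - α₂)) ℤ[α]`. -/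
def signedEventuallyBalancedSet (α α₂ : ℝ) : Set ℝ :=
  {ξ : ℝ | ∃ s : ℕ → ℤ, EventuallyLocally SignedCodedBalanced s ∧ ¬ EventuallyPeriodic s ∧
    ∃ x ∈ baseSet α α₂, ξ = realize α α₂ (padZero s) + x}

end

/-! ### Geometrically weighted sums -/

/-! Write `β = α₂ = 1/α`. Let `u n` be the nearest integer to `ξ α ^ n` and put `s n = u (n+2) - b u
(n+1) + u n`, a bounded integer word. The errors `ξ α ^ n - u n` solve the recurrence with right
side `-s`, and the Green function of the recurrence gives `(α - β)(ξ α ^ n - u n) = Phi β s n + O(β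
^ n)`, up to a shift of the index of `s` by one; the initial values of `u` account for the summand
from `M`. As `(1 - β)/(α - β) = 1/(1 + α)`, the question is which words have `limsup |Phi| ≤ 1 - β`,
and such words eventually have letters in `{-1,0,1}`. By compactness the limsup is the supremum of
`|Phi|` over all positions of all limit words, the limits of translates (`limsupPhi_le_iff`).

A word `t` over `{-1,0,1}` satisfies `|Phi| ≤ 1 - β` everywhere iff it is the second difference of
the counting function `S` of a balanced bi-infinite binary word. In one direction, `t` has a binary
primitive `c`, and one summation by parts turns the bound into a lexicographic comparison of the
right and the reversed left context of each `01` and `10` in `c`. This is Markoff's property, which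
implies balance (`balancedSum_of_markoff`). In the other direction, two summations by parts give
`Phi = (1-β)² ∑ E i * β ^ (i-1)` over `i ≥ 1`, where `E i = S (n+i) - 2 S n + S (n-i)` compares two
adjacent windows and so lies in `{-1,0,1}`.

The same formula explains the discrete part. If the supremum is below `1 - β`, each position has
some `E i ≥ 0` with `i` bounded. This forces a rational slope `p/q` and then `S (n₀+m) = S n₀ +
⌊mp/q⌋` (`BalancedSum.exists_christoffel`). At `n₀` one has `E i = 0` for `q ∣ i` and `E i = -1`
otherwise, so the supremum is `gapVal β q`, which is `(α - β) p_{q-1}/q_{q-1}`. A fixed gap admits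
finitely many `q`, hence the word itself is eventually periodic. Conversely, eventual periodicity
keeps the limsup below `1 - β`, so the critical level consists of the aperiodic words.

The morphism `γ` appears because, after complementing `S` (a change of sign of `t`), the letters `1`
among the increments of `S` are isolated: cutting into blocks `0` and `10` decodes `t` into a
balanced word, and slope `p/q` becomes `p/(q-p)`. For uncountability, the slopes `θ ∈ [0,1)` yield
distinct `ξ` with value at most `1/(1+α)`, and those with a smaller value lie in the countable field
`ℚ(α)`. -/

/-- The two-sided sum `∑ t (n + i) β ^ |i|` of a bi-infinite word. -/
noncomputable def Phi (β : ℝ) (t : ℤ → ℤ) (n : ℤ) : ℝ :=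
  ∑' i : ℕ, ((t (n + i) + t (n - i) : ℤ) : ℝ) * β ^ i - t n

/-- Bounded bi-infinite words. -/
def BddWord (t : ℤ → ℤ) : Prop := ∃ B : ℤ, ∀ n, |t n| ≤ B

lemma summable_geom_of_bdd {β : ℝ} (h0 : 0 < β) (h1 : β < 1) {a : ℕ → ℝ} {B : ℝ}
    (ha : ∀ i, |a i| ≤ B) : Summable (fun i => a i * β ^ i) := by
  refine Summable.of_norm_bounded (g := fun i => B * β ^ i)
    ((summable_geometric_of_lt_one h0.le h1).mul_left B) fun i => ?_
  rw [Real.norm_eq_abs, abs_mul, abs_of_pos (pow_pos h0 i)]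
  exact mul_le_mul_of_nonneg_right (ha i) (pow_pos h0 i).le

lemma abs_tsum_geom_le {β : ℝ} (h0 : 0 < β) (h1 : β < 1) {a : ℕ → ℝ} {B : ℝ}
    (ha : ∀ i, |a i| ≤ B) : |∑' i, a i * β ^ i| ≤ B / (1 - β) := by
  have h := tsum_of_norm_bounded (f := fun i => a i * β ^ i)
    ((hasSum_geometric_of_lt_one h0.le h1).mul_left B) fun i => by
      rw [Real.norm_eq_abs, abs_mul, abs_of_pos (pow_pos h0 i)]
      exact mul_le_mul_of_nonneg_right (ha i) (pow_pos h0 i).le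
  simpa [div_eq_mul_inv] using h

/-- Summation by parts against a geometric sequence. -/
lemma tsum_geom_diff {β : ℝ} {a : ℕ → ℝ} (ha : Summable fun i => a i * β ^ i) :
    a 0 + ∑' i, (a (i + 1) - a i) * β ^ (i + 1) = (1 - β) * ∑' i, a i * β ^ i := by
  have h1 : Summable fun i => a (i + 1) * β ^ (i + 1) :=
    (summable_nat_add_iff (f := fun i => a i * β ^ i) 1).2 ha
  have h2 : Summable fun i => β * (a i * β ^ i) := ha.mul_left β
  have e : ∀ i, (a (i + 1) - a i) * β ^ (i + 1)
      = a (i + 1) * β ^ (i + 1) - β * (a i * β ^ i) := fun i => by ring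
  simp_rw [e]
  rw [h1.tsum_sub h2, tsum_mul_left]
  have := ha.tsum_eq_zero_add
  simp only [pow_zero, mul_one] at this
  linarith

/-- A sequence of digits whose leading digit dominates has a positive sum. -/
lemma tsum_geom_pos {β : ℝ} (h0 : 0 < β) (h1 : β < 1) {M : ℝ} (hM : M * β < 1 - β) {a : ℕ → ℝ}
    (d : ℕ) (hz : ∀ i < d, a i = 0) (hd : 1 ≤ a d) (ha : ∀ i, |a (d + 1 + i)| ≤ M) :
    0 < ∑' i, a i * β ^ i := by
  have hs : Summable fun i => a (d + 1 + i) * β ^ i := summable_geom_of_bdd h0 h1 ha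
  have hs' : Summable fun i => a i * β ^ i := by
    rw [← summable_nat_add_iff (d + 1)]
    refine (hs.mul_left (β ^ (d + 1))).congr fun i => ?_
    rw [add_comm i, pow_add]; ring
  rw [← hs'.sum_add_tsum_nat_add (d + 1), Finset.sum_range_succ,
    Finset.sum_eq_zero (fun i hi => by rw [hz i (Finset.mem_range.1 hi), zero_mul])]
  have e : ∑' i, a (i + (d + 1)) * β ^ (i + (d + 1))
      = β ^ (d + 1) * ∑' i, a (d + 1 + i) * β ^ i := by
    rw [← tsum_mul_left]
    exact tsum_congr fun i => by rw [add_comm i, pow_add]; ring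
  rw [e]
  have h2 := (abs_le.1 (abs_tsum_geom_le h0 h1 ha)).1
  have h3 : 0 < β ^ d := pow_pos h0 d
  have h4 : M / (1 - β) * β < 1 := by
    rw [div_mul_eq_mul_div, div_lt_one (by linarith)]; exact hM
  have h5 : -(M / (1 - β) * β) ≤ β * ∑' i, a (d + 1 + i) * β ^ i := by nlinarith
  rw [pow_succ]
  nlinarith [mul_le_mul_of_nonneg_left h5 h3.le, mul_le_mul_of_nonneg_left hd h3.le]

section Phi

variable {β : ℝ} (h0 : 0 < β) (h1 : β < 1) {t : ℤ → ℤ}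
include h0 h1

lemma BddWord.summable (ht : BddWord t) (n : ℤ) :
    Summable fun i : ℕ => ((t (n + i) + t (n - i) : ℤ) : ℝ) * β ^ i := by
  obtain ⟨B, hB⟩ := ht
  refine summable_geom_of_bdd h0 h1 (B := ((2 * B : ℤ) : ℝ)) fun i => ?_
  rw [← Int.cast_abs, Int.cast_le]
  have := abs_add_le (t (n + i)) (t (n - i))
  linarith [hB (n + i), hB (n - i)]

lemma Phi_eq_succ (ht : BddWord t) (n : ℤ) : Phi β t n =
    t n + ∑' i : ℕ, ((t (n + (i + 1)) + t (n - (i + 1)) : ℤ) : ℝ) * β ^ (i + 1) := by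
  rw [Phi, (ht.summable h0 h1 n).tsum_eq_zero_add]
  push_cast
  simp only [add_zero, sub_zero, pow_zero, mul_one]
  ring

/-- `Phi` in terms of a primitive of the word. -/
lemma Phi_eq_primitive (ht : BddWord t) {c : ℤ → ℤ} (hc : BddWord c)
    (htc : ∀ n, t n = c n - c (n - 1)) (n : ℤ) :
    Phi β t n = (1 - β) * ∑' i : ℕ, ((c (n + i) - c (n - 1 - i) : ℤ) : ℝ) * β ^ i := by
  obtain ⟨B, hB⟩ := hc
  rw [← tsum_geom_diff, Phi_eq_succ h0 h1 ht]
  · congr 1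
    · simp [htc]
    · refine tsum_congr fun i => ?_
      rw [htc, htc, ← Int.cast_sub]
      congr 2
      rw [show n + ((i : ℤ) + 1) - 1 = n + i by ring, show n - 1 - (i : ℤ) = n - (i + 1) by ring,
        show n - 1 - ((i + 1 : ℕ) : ℤ) = n - (i + 1) - 1 by push_cast; ring]
      push_cast; ring
  · refine summable_geom_of_bdd h0 h1 (B := ((2 * B : ℤ) : ℝ)) fun i => ?_
    rw [← Int.cast_abs, Int.cast_le]
    have := abs_sub (c (n + i)) (c (n - 1 - i))
    linarith [hB (n + i), hB (n - 1 - i)]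

/-- `Phi` in terms of a second primitive of the word. -/
lemma Phi_eq_second_primitive (ht : BddWord t) {S : ℤ → ℤ}
    (htS : ∀ n, t n = S (n + 1) - 2 * S n + S (n - 1)) (n : ℤ)
    (hS : ∀ i : ℕ, |S (n + i) - 2 * S n + S (n - i)| ≤ 1) :
    Phi β t n = (1 - β) ^ 2 *
      ∑' i : ℕ, ((S (n + (i + 1)) - 2 * S n + S (n - (i + 1)) : ℤ) : ℝ) * β ^ i := by
  set E : ℕ → ℝ := fun i => ((S (n + i) - 2 * S n + S (n - i) : ℤ) : ℝ) with hE
  have hEb : ∀ i, |E i| ≤ 1 := fun i => by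
    rw [hE]; simp only; rw [← Int.cast_abs]; exact_mod_cast hS i
  have hE1 : Summable fun i => E (i + 1) * β ^ i :=
    summable_geom_of_bdd h0 h1 fun i => hEb (i + 1)
  have hE2 : Summable fun i => (E (i + 1) - E i) * β ^ i := by
    refine summable_geom_of_bdd h0 h1 (B := 2) fun i => ?_
    have := abs_sub (E (i + 1)) (E i)
    linarith [hEb i, hEb (i + 1)]
  have e0 : E 0 = 0 := by simp [hE]; ring
  -- Two summations by parts. The second difference of `E` at `i + 1` is `t (n+i+1) + t (n-i-1)`,
  -- and `E 0 = 0` removes the boundary term.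
  have k1 := tsum_geom_diff hE1
  have k2 := tsum_geom_diff hE2
  have e1 : ∑' i : ℕ, ((S (n + (i + 1)) - 2 * S n + S (n - (i + 1)) : ℤ) : ℝ) * β ^ i
      = ∑' i, E (i + 1) * β ^ i := by
    refine tsum_congr fun i => ?_
    simp [hE]
  rw [e1, pow_two, mul_assoc, ← k1, Phi_eq_succ h0 h1 ht]
  have e2 : ∑' i, (E (i + 1) - E i) * β ^ i =
      E (0 + 1) + ∑' i, (E (i + 1 + 1) - E (i + 1)) * β ^ (i + 1) := by
    rw [hE2.tsum_eq_zero_add, e0]; simp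
  rw [← e2, ← k2, e0]
  congr 1
  · simp [hE, htS]
  · refine tsum_congr fun i => ?_
    congr 1
    simp only [hE, htS, ← Int.cast_sub]
    congr 1
    push_cast
    rw [show n + ((i : ℤ) + 1) + 1 = n + (i + 1 + 1) by ring,
      show n + ((i : ℤ) + 1) - 1 = n + i by ring,
      show n - ((i : ℤ) + 1) + 1 = n - i by ring,
      show n - ((i : ℤ) + 1) - 1 = n - (i + 1 + 1) by ring]
    ring

end Phi

/-! ### Balanced primitives and Markoff's property -/

/-- `S` counts the letters `1` of a balanced bi-infinite word. -/
def BalancedSum (S : ℤ → ℤ) : Prop :=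
  ∀ l i j : ℤ, 0 ≤ l → S (i + l) - S i - (S (j + l) - S j) ≤ 1

/-- One half of Markoff's property: around a factor `01`, the right context does not exceed the
reversed left context in the lexicographic order. -/
def MarkoffUp (c : ℤ → ℤ) : Prop :=
  ∀ (m : ℤ) (d : ℕ), 1 ≤ d → c m = 1 → c (m - 1) = 0 →
    (∀ i : ℕ, 1 ≤ i → i < d → c (m + i) = c (m - 1 - i)) → c (m + d) = 1 → c (m - 1 - d) = 0 →
    False

lemma exists_primitive (t : ℤ → ℤ) : ∃ C : ℤ → ℤ, ∀ n, C (n + 1) - C n = t n := by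
  -- One of the two intervals is always empty: this is the signed sum from `0` to `n`.
  refine ⟨fun n => ∑ k ∈ Finset.Ico 0 n, t k - ∑ k ∈ Finset.Ico n 0, t k, fun n => ?_⟩
  beta_reduce
  rcases le_or_gt 0 n with h | h
  · have e : Finset.Ico (0 : ℤ) (n + 1) = insert n (Finset.Ico 0 n) := by
      ext; simp; omega
    rw [e, Finset.sum_insert (by simp), Finset.Ico_eq_empty (a := n) (by omega),
      Finset.Ico_eq_empty (a := n + 1) (by omega)]
    simp
  · have e : Finset.Ico (n : ℤ) 0 = insert n (Finset.Ico (n + 1) 0) := by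
      ext; simp; omega
    simp only [e]
    rw [Finset.sum_insert (by simp), Finset.Ico_eq_empty (b := n) (by omega),
      Finset.Ico_eq_empty (b := n + 1) (by omega)]
    simp

/-- Two closest windows of minimal length violating balance contradict Markoff's property. -/
lemma MarkoffUp.no_minimal_pair {S c : ℤ → ℤ} (hc : ∀ n, S (n + 1) = S n + c n)
    (h01 : ∀ n, c n = 0 ∨ c n = 1) (hM : MarkoffUp c) {l i j : ℤ} (hl : 0 < l)
    (hbal : ∀ r, 0 ≤ r → r < l → ∀ i j, S (i + r) - S i - (S (j + r) - S j) ≤ 1)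
    (hij : i < j) (h2 : 2 ≤ S (j + l) - S j - (S (i + l) - S i))
    (hmin : ∀ i' j', |i' - j'| < j - i → S (i' + l) - S i' - (S (j' + l) - S j') ≤ 1) : False := by
  obtain ⟨A, hA⟩ : ∃ A, A = S (i + l) - S i := ⟨_, rfl⟩
  have hstep : ∀ k, S (k + 1 + l) - S (k + 1) = S (k + l) - S k + c (k + l) - c k := fun k => by
    rw [show k + 1 + l = k + l + 1 by ring, hc, hc]; ring
  -- A window strictly between is closer to `i` and to `j` than they are to each other, so by
  -- minimality it differs by at most one from both.
  have hmid : ∀ k, i < k → k < j → S (k + l) - S k = A + 1 := fun k h h' => by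
    have a := hmin k i (by rw [abs_lt]; omega)
    have b := hmin j k (by rw [abs_lt]; omega)
    omega
  have hij1 : i + 1 < j := by
    by_contra hh
    have : j = i + 1 := by omega
    have := hstep i
    have := h01 i
    have := h01 (i + l)
    subst j; omega
  have hi : c i = 0 ∧ c (i + l) = 1 := by
    have := hmid (i + 1) (by omega) hij1
    have := hstep i
    have := h01 i
    have := h01 (i + l)
    omega
  have hp : c (j - 1) = 0 ∧ c (j - 1 + l) = 1 := by
    have := hmid (j - 1) (by omega) (by omega)
    have := hstep (j - 1)
    rw [sub_add_cancel] at this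
    have := h01 (j - 1)
    have := h01 (j - 1 + l)
    omega
  have hj : S (j + l) - S j = A + 2 := by
    have := hmid (j - 1) (by omega) (by omega)
    have := hstep (j - 1)
    rw [sub_add_cancel] at this
    omega
  have hper : ∀ k, i < k → k < j - 1 → c (k + l) = c k := fun k h h' => by
    have := hmid k h (by omega)
    have := hmid (k + 1) (by omega) (by omega)
    have := hstep k
    omega
  -- Otherwise the windows at `i` and `j` overlap, and cancelling the overlap leaves an unbalanced
  -- pair of the smaller length `j - i`.
  have hlen : l ≤ j - i := by
    by_contra hh
    have := hbal (j - i) (by omega) (by omega) (i + l) i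
    rw [show i + l + (j - i) = j + l by ring, show i + (j - i) = j by ring] at this
    omega
  -- The excess is two, and neither a proper prefix nor the remaining suffix can contribute more
  -- than one, so each contributes exactly one.
  have hpre : ∀ r, 0 < r → r < l → S (j + r) - S j - (S (i + r) - S i) = 1 := fun r h h' => by
    have a := hbal r h.le h' j i
    have b := hbal (l - r) (by omega) (by omega) (j + r) (i + r)
    rw [show j + r + (l - r) = j + l by ring, show i + r + (l - r) = i + l by ring] at b
    omega
  have hl2 : 2 ≤ l := by
    by_contra hh
    have : l = 1 := by omega
    subst this
    have := hc i
    have := hc j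
    have := h01 i
    have := h01 j
    omega
  -- Comparing prefixes of one window with suffixes of the other squeezes the counts: the window at
  -- `i` is a palindrome.
  have hpal : ∀ r, 0 < r → r < l → S (i + r) - S i = S (i + l) - S (i + (l - r)) :=
    fun r h h' => by
    have a := hbal r h.le h' j (i + (l - r))
    have b := hbal r h.le h' (j + (l - r)) i
    rw [show i + (l - r) + r = i + l by ring] at a
    rw [show j + (l - r) + r = j + l by ring] at b
    have := hpre r h h'
    have := hpre (l - r) (by omega) (by omega)
    omega
  have hend : c (i + l - 1) = 0 := by
    have a := hpal 1 (by omega) (by omega)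
    have e := hc (i + l - 1)
    rw [hc i, show i + (l - 1) = i + l - 1 by ring] at a
    rw [sub_add_cancel] at e
    omega
  have hrev : ∀ d, 1 ≤ d → d ≤ l - 2 → c (i + l - 1 - d) = c (i + d) := fun d h h' => by
    have a := hpal d (by omega) (by omega)
    have b := hpal (d + 1) (by omega) (by omega)
    have e := hc (i + d)
    have e' := hc (i + l - 1 - d)
    rw [show i + (d + 1) = i + d + 1 by ring, show i + (l - (d + 1)) = i + l - 1 - d by ring] at b
    rw [show i + (l - d) = i + l - 1 - d + 1 by ring] at a
    omega
  -- the first place at which the contexts of `01` at `i + l - 1` are known to differ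
  have hex : ∃ d : ℕ, 1 ≤ d ∧ (c (i + l - 1 - d) ≠ c (i + l + d) ∨ (d : ℤ) = j - 1 - i) :=
    ⟨(j - 1 - i).toNat, by omega, Or.inr (by omega)⟩
  classical
  obtain ⟨d, hd, hdmin⟩ : ∃ d : ℕ, (1 ≤ d ∧ (c (i + l - 1 - d) ≠ c (i + l + d) ∨
      (d : ℤ) = j - 1 - i)) ∧ ∀ e : ℕ, e < d → 1 ≤ e →
        c (i + l - 1 - e) = c (i + l + e) ∧ (e : ℤ) ≠ j - 1 - i := by
    refine ⟨Nat.find hex, Nat.find_spec hex, fun e he h => ?_⟩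
    have := Nat.find_min hex he
    tauto
  obtain ⟨hd1, hd2⟩ := hd
  have hdle : (d : ℤ) ≤ j - 1 - i := by
    by_contra hh
    exact (hdmin (j - 1 - i).toNat (by omega) (by omega)).2 (by omega)
  have hagree : ∀ e : ℤ, 1 ≤ e → e < d → c (i + l - 1 - e) = c (i + e) := fun e h h' => by
    have := (hdmin e.toNat (by omega) (by omega)).1
    rw [Int.toNat_of_nonneg (by omega)] at this
    rw [this, show i + l + e = i + e + l by ring]
    exact hper _ (by omega) (by omega)
  have hnot : ¬ (c (i + l + d) = 1 ∧ c (i + l - 1 - d) = 0) := fun h =>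
    hM (i + l) d hd1 hi.2 hend (fun e h1 h2 => (hdmin e h2 h1).1.symm) h.1 h.2
  -- There is a factor `01` at `i + l - 1`. At the first disagreement of its contexts, or at `d = j
  -- - 1 - i` where the right letter is known to be `1`, Markoff's property excludes right `1` with
  -- left `0`; periodicity transfers the right letter to `i + d`.
  have hd3 : c (i + l - 1 - d) = 1 ∧ c (i + d) = 0 := by
    have a := h01 (i + l - 1 - d)
    have b := h01 (i + l + d)
    rcases eq_or_lt_of_le hdle with h | h
    · have e : c (i + l + d) = 1 := by rw [h, show i + l + (j - 1 - i) = j - 1 + l by ring, hp.2]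
      have e' : c (i + d) = 0 := by rw [h, show i + (j - 1 - i) = j - 1 by ring, hp.1]
      refine ⟨?_, e'⟩
      rcases a with a | a
      · exact absurd ⟨e, a⟩ hnot
      · exact a
    · have e := hper (i + d) (by omega) (by omega)
      rw [show i + d + l = i + l + d by ring] at e
      have : c (i + l - 1 - d) ≠ c (i + l + d) := by
        rcases hd2 with h' | h'
        · exact h'
        · omega
      omega
  -- Inside the palindromic window the contexts agree, and at `d = l - 1` the left letter is `c i =
  -- 0`.
  have hdl : l ≤ d := by
    by_contra hh
    rcases lt_or_ge (d : ℤ) (l - 1) with h | h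
    · have := hrev d (by omega) (by omega)
      omega
    · have : (d : ℤ) = l - 1 := by omega
      have h3 := hd3.1
      rw [this, show i + l - 1 - (l - 1) = i by ring] at h3
      omega
  -- The letters following position `i + l - 1 - d` mirror those preceding `i + d`.
  have hsum : ∀ r : ℕ, (r : ℤ) ≤ l - 1 →
      S (i + l - d + r) - S (i + l - d) = S (i + d) - S (i + d - r) := by
    intro r
    induction r with
    | zero => intro _; simp
    | succ r ih =>
      intro h
      push_cast at h ⊢
      have ih := ih (by omega)
      have e1 := hc (i + l - d + r)
      have e2 := hc (i + d - (r + 1))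
      have e3 := hagree (d - 1 - r) (by omega) (by omega)
      rw [show i + l - 1 - ((d : ℤ) - 1 - r) = i + l - d + r by ring,
        show i + ((d : ℤ) - 1 - r) = i + d - (r + 1) by ring] at e3
      rw [show i + (d : ℤ) - (r + 1) + 1 = i + d - r by ring] at e2
      rw [show i + l - (d : ℤ) + (r + 1) = i + l - d + r + 1 by ring]
      omega
  have s1 := hsum (l - 1).toNat (by omega)
  rw [Int.toNat_of_nonneg (by omega)] at s1
  have s2 := hmid (i + d - (l - 1)) (by omega) (by omega)
  have s3 := hc (i + d)
  have s4 := hc (i + l - 1 - d)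
  rw [show i + (d : ℤ) - (l - 1) + l = i + d + 1 by ring] at s2
  rw [show i + l - 1 - (d : ℤ) + 1 = i + l - d by ring] at s4
  -- The window ending with the letter `0` at `i + d` has count `A + 1`. Dropping that letter,
  -- reflecting, and prepending the letter `1` at `i + l - 1 - d` gives a window of count `A + 2`,
  -- at distance `d + 1 - l < j - i` from `i`.
  have s5 := hmin (i + l - 1 - d) i (by rw [abs_lt]; omega)
  rw [show i + l - 1 - (d : ℤ) + l = i + l - d + (l - 1) by ring] at s5
  omega

/-- Markoff's property implies balance. -/
theorem balancedSum_of_markoff {S c : ℤ → ℤ} (hc : ∀ n, S (n + 1) = S n + c n)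
    (h01 : ∀ n, c n = 0 ∨ c n = 1) (hM : MarkoffUp c) (hM' : MarkoffUp fun n => 1 - c n) :
    BalancedSum S := by
  suffices H : ∀ (l : ℕ) (i j : ℤ), S (i + l) - S i - (S (j + l) - S j) ≤ 1 by
    intro l i j hl
    obtain ⟨l, rfl⟩ := Int.eq_ofNat_of_zero_le hl
    exact H l i j
  intro l
  induction l using Nat.strong_induction_on with
  | _ l ih =>
  by_contra! hcon
  obtain ⟨j₀, i₀, hcon⟩ := hcon
  have hl : 0 < l := by
    rcases Nat.eq_zero_or_pos l with h | h
    · subst h; simp at hcon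
    · exact h
  classical
  have hex : ∃ k : ℕ, ∃ i j : ℤ, (i - j).natAbs = k ∧
      1 < S (j + l) - S j - (S (i + l) - S i) := ⟨_, i₀, j₀, rfl, hcon⟩
  obtain ⟨i, j, hk, h2⟩ := Nat.find_spec hex
  have hmin : ∀ i' j', |i' - j'| < |i - j| → S (i' + l) - S i' - (S (j' + l) - S j') ≤ 1 := by
    intro i' j' h
    by_contra! hh
    refine Nat.find_min hex (m := (j' - i').natAbs) ?_ ⟨j', i', rfl, hh⟩
    rw [← hk]
    rw [abs_sub_comm i'] at h
    zify; exact h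
  have hbal : ∀ r : ℤ, 0 ≤ r → r < l → ∀ i j, S (i + r) - S i - (S (j + r) - S j) ≤ 1 := by
    intro r hr hrl i j
    obtain ⟨r, rfl⟩ := Int.eq_ofNat_of_zero_le hr
    exact ih r (by omega) i j
  rcases lt_trichotomy i j with h | h | h
  · refine hM.no_minimal_pair hc h01 (l := l) (by omega) hbal h (by omega) fun i' j' h' => ?_
    exact hmin i' j' (by rwa [abs_sub_comm i, abs_of_pos (by omega : 0 < j - i)])
  · subst h; omega
  -- Complementing the letters exchanges the heavy and the light window, hence the order of `i` and
  -- `j`.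
  · refine hM'.no_minimal_pair (S := fun n => n - S n) (i := j) (j := i) (l := l)
      (fun n => by simp only [hc]; ring) (fun n => by have := h01 n; omega) (by omega)
      (fun r hr hrl a b => ?_) h (by omega) fun i' j' h' => ?_
    · have := hbal r hr hrl b a
      omega
    · have := hmin j' i' (by rwa [abs_sub_comm j', abs_of_pos (by omega : 0 < i - j)])
      omega

/-! ### Bi-infinite words with small sums are differences of balanced words -/

/-- The right-sided sum `∑ t (n + i) β ^ i`. -/
noncomputable def rightSum (β : ℝ) (t : ℤ → ℤ) (n : ℤ) : ℝ := ∑' i : ℕ, (t (n + i) : ℝ) * β ^ i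

/-- The left-sided sum `∑ t (n - i) β ^ i`. -/
noncomputable def leftSum (β : ℝ) (t : ℤ → ℤ) (n : ℤ) : ℝ := ∑' i : ℕ, (t (n - i) : ℝ) * β ^ i

lemma Phi_neg (β : ℝ) (t : ℤ → ℤ) (n : ℤ) : Phi β (fun n => -t n) n = -Phi β t n := by
  have e : ∀ i : ℕ, ((-t (n + i) + -t (n - i) : ℤ) : ℝ) * β ^ i
      = -(((t (n + i) + t (n - i) : ℤ) : ℝ) * β ^ i) := fun i => by push_cast; ring
  simp only [Phi, e, tsum_neg]
  push_cast; ring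

section

variable {β : ℝ} (h0 : 0 < β) (h1 : β < 1) {t : ℤ → ℤ} (ht : BddWord t)
include h0 h1 ht

lemma BddWord.summable_comp (f : ℕ → ℤ) : Summable fun i : ℕ => (t (f i) : ℝ) * β ^ i := by
  obtain ⟨B, hB⟩ := ht
  refine summable_geom_of_bdd h0 h1 (B := B) fun i => ?_
  rw [← Int.cast_abs, Int.cast_le]
  exact hB _

lemma rightSum_eq (n : ℤ) : rightSum β t n = t n + β * rightSum β t (n + 1) := by
  rw [rightSum, (ht.summable_comp h0 h1 fun i => n + i).tsum_eq_zero_add, rightSum, ← tsum_mul_left]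
  congr 1
  · simp
  · refine tsum_congr fun i => ?_
    rw [show n + ((i + 1 : ℕ) : ℤ) = n + 1 + i by push_cast; ring, pow_succ]; ring

lemma leftSum_eq (n : ℤ) : leftSum β t n = t n + β * leftSum β t (n - 1) := by
  rw [leftSum, (ht.summable_comp h0 h1 fun i => n - i).tsum_eq_zero_add, leftSum, ← tsum_mul_left]
  congr 1
  · simp
  · refine tsum_congr fun i => ?_
    rw [show n - ((i + 1 : ℕ) : ℤ) = n - 1 - i by push_cast; ring, pow_succ]; ring

lemma Phi_eq_right_add_left (n : ℤ) : Phi β t n = rightSum β t n + leftSum β t n - t n := by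
  rw [Phi, rightSum, leftSum, ← (ht.summable_comp h0 h1 fun i => n + i).tsum_add
    (ht.summable_comp h0 h1 fun i => n - i)]
  congr 1
  exact tsum_congr fun i => by push_cast; ring

end

section

variable {β : ℝ} (h0 : 0 < β) (h1 : β < 1 / 3) {t : ℤ → ℤ} (ht : ∀ n, |t n| ≤ 1)
include h0 h1 ht

/-- A letter `1` has a neighbour `-1`. -/
lemma exists_neg_neighbour (hP : ∀ n, Phi β t n ≤ 1 - β) {n : ℤ} (hn : t n = 1) :
    t (n + 1) = -1 ∨ t (n - 1) = -1 := by
  have hb : BddWord t := ⟨1, ht⟩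
  by_contra! hh
  have hl1 : β < 1 := by linarith
  have a1 := abs_le.1 (ht (n + 1))
  have a2 := abs_le.1 (ht (n - 1))
  have b1 : (0 : ℝ) ≤ t (n + 1) := by exact_mod_cast (by omega : 0 ≤ t (n + 1))
  have b2 : (0 : ℝ) ≤ t (n - 1) := by exact_mod_cast (by omega : 0 ≤ t (n - 1))
  have hc : ∀ m, |(t m : ℝ)| ≤ 1 := fun m => by rw [← Int.cast_abs]; exact_mod_cast ht m
  have r := (abs_le.1 (abs_tsum_geom_le h0 hl1 (a := fun i => (t (n + 1 + 1 + i) : ℝ))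
    fun i => hc _)).1
  have l := (abs_le.1 (abs_tsum_geom_le h0 hl1 (a := fun i => (t (n - 1 - 1 - i) : ℝ))
    fun i => hc _)).1
  change _ ≤ rightSum β t (n + 1 + 1) at r
  change _ ≤ leftSum β t (n - 1 - 1) at l
  have hp := hP n
  rw [Phi_eq_right_add_left h0 hl1 hb, rightSum_eq h0 hl1 hb, leftSum_eq h0 hl1 hb,
    rightSum_eq h0 hl1 hb (n + 1), leftSum_eq h0 hl1 hb (n - 1), hn] at hp
  push_cast at hp
  -- Without a neighbour `-1` the sum at `n` is at least `1 - 2β²/(1-β)`; this exceeds `1 - β`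
  -- exactly because `β < 1/3`.
  have k : 2 * (1 / (1 - β)) * β < 1 := by
    rw [mul_one_div, div_mul_eq_mul_div, div_lt_one (by linarith)]; linarith
  have r' := mul_le_mul_of_nonneg_left r (mul_pos h0 h0).le
  have l' := mul_le_mul_of_nonneg_left l (mul_pos h0 h0).le
  nlinarith [mul_nonneg h0.le b1, mul_nonneg h0.le b2, mul_lt_mul_of_pos_left k h0]

/-- After a letter `1`, the next non-zero letter is not `1`. -/
lemma no_repeated_sign (hP : ∀ n, |Phi β t n| ≤ 1 - β) {n m : ℤ} (hnm : n < m) (hn : t n = 1)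
    (hm : t m = 1) (hz : ∀ k, n < k → k < m → t k = 0) : False := by
  have hb : BddWord t := ⟨1, ht⟩
  have hl1 : β < 1 := by linarith
  have hprev : t (n - 1) = -1 := by
    rcases exists_neg_neighbour h0 h1 ht (fun n => (abs_le.1 (hP n)).2) hn with h | h
    · rcases (show n + 1 ≤ m by omega).eq_or_lt with e | e
      · rw [e] at h; omega
      · have := hz (n + 1) (by omega) e; omega
    · exact h
  have p1 := (abs_le.1 (hP n)).2
  have p2 := (abs_le.1 (hP (n - 1))).1
  rw [Phi_eq_right_add_left h0 hl1 hb, rightSum_eq h0 hl1 hb, leftSum_eq h0 hl1 hb,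
    leftSum_eq h0 hl1 hb (n - 1), hn, hprev] at p1
  rw [Phi_eq_right_add_left h0 hl1 hb, rightSum_eq h0 hl1 hb, leftSum_eq h0 hl1 hb,
    show n - 1 + 1 = n by ring, rightSum_eq h0 hl1 hb n, hn, hprev] at p2
  push_cast at p1 p2
  have hpos : 0 < rightSum β t (n + 1) := by
    refine tsum_geom_pos h0 hl1 (M := 1) (by linarith) (m - n - 1).toNat (fun i hi => ?_) ?_
      fun i => ?_
    · rw [hz _ (by omega) (by omega), Int.cast_zero]
    · rw [show n + 1 + ((m - n - 1).toNat : ℤ) = m by omega, hm, Int.cast_one]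
    · rw [← Int.cast_abs]; exact_mod_cast ht _
  -- Let `R`, `L` be the one-sided sums starting outside the pair `-1, 1` at `n - 1, n`. The bounds
  -- at `n` and at `n - 1` say `R + βL ≤ 0` and `βR + L ≥ 0`, so `(1 - β²)R ≤ 0`; but the first
  -- non-zero letter on the right is `1`, so `R > 0`.
  have q1 : rightSum β t (n + 1) + β * leftSum β t (n - 1 - 1) ≤ 0 := by
    by_contra! hh
    nlinarith [mul_pos h0 hh]
  have q2 : 0 ≤ β * rightSum β t (n + 1) + leftSum β t (n - 1 - 1) := by
    by_contra! hh
    nlinarith [mul_pos_of_neg_of_neg hh (by linarith : -β < 0)]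
  nlinarith [mul_nonneg h0.le q2, mul_pos hpos (by nlinarith : 0 < 1 - β * β)]

/-- Non-zero letters alternate in sign. A shortest factor of sum two would begin and end with `1`
and vanish in between, contrary to `no_repeated_sign`. -/
lemma abs_primitive_sub_le_one (hP : ∀ n, |Phi β t n| ≤ 1 - β) {C : ℤ → ℤ}
    (hC : ∀ n, C (n + 1) - C n = t n) (k : ℕ) : ∀ n : ℤ, |C (n + k) - C n| ≤ 1 := by
  suffices H : ∀ (t C : ℤ → ℤ), (∀ n, |t n| ≤ 1) → (∀ n, |Phi β t n| ≤ 1 - β) →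
      (∀ n, C (n + 1) - C n = t n) → ∀ k : ℕ, (∀ l < k, ∀ n : ℤ, |C (n + l) - C n| ≤ 1) →
      ∀ n : ℤ, C (n + k) - C n ≤ 1 by
    induction k using Nat.strong_induction_on with
    | _ k ih =>
    intro n
    have a := H t C ht hP hC k ih n
    have b := H (fun n => -t n) (fun n => -C n) (fun n => by rw [abs_neg]; exact ht n)
      (fun n => by rw [Phi_neg, abs_neg]; exact hP n) (fun n => by rw [← hC]; ring) k
      (fun l hl n => by rw [neg_sub_neg, abs_sub_comm]; exact ih l hl n) n
    rw [abs_le]; omega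
  intro t C ht hP hC k ih n
  by_contra! hh
  have hk : 2 ≤ k := by
    by_contra hk
    rcases (by omega : k = 0 ∨ k = 1) with rfl | rfl
    · simp at hh
    · have := hC n
      have := abs_le.1 (ht n)
      push_cast at hh; omega
  have hle : ∀ m, n < m → m < n + k → C m = C n + 1 ∧ C (n + k) = C n + 2 := fun m h h' => by
    have a := abs_le.1 (ih (m - n).toNat (by omega) n)
    have b := abs_le.1 (ih (n + k - m).toNat (by omega) m)
    rw [show n + ((m - n).toNat : ℤ) = m by omega] at a
    rw [show m + ((n + k - m).toNat : ℤ) = n + k by omega] at b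
    omega
  have c1 := hC n
  have c2 := hC (n + k - 1)
  rw [sub_add_cancel] at c2
  have d1 := hle (n + 1) (by omega) (by omega)
  have d2 := hle (n + k - 1) (by omega) (by omega)
  refine no_repeated_sign h0 h1 ht hP (n := n) (m := n + k - 1) (by omega) (by omega) (by omega)
    fun m h h' => ?_
  have := hC m
  have := hle m h (by omega)
  have := hle (m + 1) (by omega) (by omega)
  omega

lemma exists_binary_primitive (hP : ∀ n, |Phi β t n| ≤ 1 - β) :
    ∃ c : ℤ → ℤ, (∀ n, c n = 0 ∨ c n = 1) ∧ ∀ n, t n = c n - c (n - 1) := by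
  obtain ⟨C, hC⟩ := exists_primitive t
  have hd : ∀ m n, |C m - C n| ≤ 1 := fun m n => by
    rcases le_total m n with h | h
    · have := abs_primitive_sub_le_one h0 h1 ht hP hC (n - m).toNat m
      rw [show m + ((n - m).toNat : ℤ) = n by omega] at this
      rwa [abs_sub_comm]
    · have := abs_primitive_sub_le_one h0 h1 ht hP hC (m - n).toNat n
      rwa [show n + ((m - n).toNat : ℤ) = m by omega] at this
  -- The primitive takes at most two values, which are consecutive; the cases decide whether `C 0`
  -- is the upper one. The argument `n + 1` converts forward into backward differences.
  by_cases hx : ∃ k, C k = C 0 - 1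
  · obtain ⟨k, hk⟩ := hx
    refine ⟨fun n => C (n + 1) - C k, fun n => ?_, fun n => ?_⟩
    · have := abs_le.1 (hd (n + 1) k)
      have := abs_le.1 (hd (n + 1) 0)
      beta_reduce; omega
    · have := hC n
      beta_reduce; rw [sub_add_cancel]; omega
  · push Not at hx
    refine ⟨fun n => C (n + 1) - C 0, fun n => ?_, fun n => ?_⟩
    · have := hx (n + 1)
      have := abs_le.1 (hd (n + 1) 0)
      beta_reduce; omega
    · have := hC n
      beta_reduce; rw [sub_add_cancel]; omega

-- At a factor `01` the sum is `(1-β)(1 + ∑_{i≥1} (c (m+i) - c (m-1-i)) β^i)`, so the inner sum must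
-- be at most `0`. Its sign is that of its first non-zero coefficient, since that term outweighs all
-- later ones.
omit ht in
lemma markoffUp_of_Phi_le {c : ℤ → ℤ} (h01 : ∀ n, c n = 0 ∨ c n = 1)
    (hP : ∀ n, Phi β (fun n => c n - c (n - 1)) n ≤ 1 - β) : MarkoffUp c := by
  intro m d hd hm hm1 hag hmd hmd1
  have hl1 : β < 1 := by linarith
  have hcb : BddWord c := ⟨1, fun n => by rcases h01 n with h | h <;> simp [h]⟩
  have htb : BddWord (fun n => c n - c (n - 1)) :=
    ⟨1, fun n => by beta_reduce; rw [abs_le]; have := h01 n; have := h01 (n - 1); omega⟩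
  have hb : ∀ i : ℕ, |((c (m + i) - c (m - 1 - i) : ℤ) : ℝ)| ≤ 1 := fun i => by
    rw [← Int.cast_abs]
    have : |c (m + i) - c (m - 1 - i)| ≤ 1 := by
      rw [abs_le]; have := h01 (m + i); have := h01 (m - 1 - i); omega
    exact_mod_cast this
  have hp := hP m
  rw [Phi_eq_primitive h0 hl1 htb hcb (fun _ => rfl),
    (summable_geom_of_bdd h0 hl1 hb).tsum_eq_zero_add] at hp
  have hpos : 0 < ∑' i : ℕ, ((c (m + ((i + 1 : ℕ) : ℤ)) - c (m - 1 - ((i + 1 : ℕ) : ℤ)) : ℤ) : ℝ)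
      * β ^ i := by
    refine tsum_geom_pos h0 hl1 (M := 1) (by linarith) (d - 1) (fun i hi => ?_) ?_ fun i => hb _
    · rw [hag (i + 1) (by omega) (by omega)]; simp
    · rw [Nat.sub_add_cancel hd, hmd, hmd1]; simp
  have e : ∑' i : ℕ, ((c (m + ((i + 1 : ℕ) : ℤ)) - c (m - 1 - ((i + 1 : ℕ) : ℤ)) : ℤ) : ℝ)
      * β ^ (i + 1) = β * ∑' i : ℕ, ((c (m + ((i + 1 : ℕ) : ℤ)) -
        c (m - 1 - ((i + 1 : ℕ) : ℤ)) : ℤ) : ℝ) * β ^ i := by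
    rw [← tsum_mul_left]; exact tsum_congr fun i => by rw [pow_succ]; ring
  rw [e] at hp
  simp only [Nat.cast_zero, add_zero, sub_zero, hm, hm1, pow_zero, Int.cast_one, mul_one] at hp
  nlinarith [mul_pos (mul_pos h0 hpos) (by linarith : 0 < 1 - β)]

/-- A bi-infinite word over `{-1,0,1}` with small sums is the second difference of the counting
function of a balanced word. -/
theorem exists_balancedSum_of_Phi_le (hP : ∀ n, |Phi β t n| ≤ 1 - β) :
    ∃ S : ℤ → ℤ, BalancedSum S ∧ (∀ n, S (n + 1) - S n = 0 ∨ S (n + 1) - S n = 1) ∧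
      ∀ n, t n = S (n + 1) - 2 * S n + S (n - 1) := by
  obtain ⟨c, h01, hc⟩ := exists_binary_primitive h0 h1 ht hP
  obtain ⟨S, hS⟩ := exists_primitive c
  have e : t = fun n => c n - c (n - 1) := funext hc
  refine ⟨S, balancedSum_of_markoff (c := c) (fun n => by rw [← hS]; ring) h01
    (markoffUp_of_Phi_le h0 h1 h01 fun n => ?_)
    (markoffUp_of_Phi_le h0 h1 (fun n => ?_) fun n => ?_),
    fun n => by rw [hS]; exact h01 n, fun n => ?_⟩
  · rw [← e]; exact (abs_le.1 (hP n)).2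
  · have := h01 n; omega
  · have : (fun n => 1 - c n - (1 - c (n - 1))) = fun n => -t n := by
      funext n; rw [hc]; ring
    rw [this, Phi_neg]
    linarith [(abs_le.1 (hP n)).1]
  · rw [hc, ← hS, ← hS (n - 1), sub_add_cancel]; ring

end

/-- This second difference compares the counts of the two windows of length `i` adjacent at `n`. -/
lemma BalancedSum.abs_second_diff_le {S : ℤ → ℤ} (hS : BalancedSum S) (n : ℤ) (i : ℕ) :
    |S (n + i) - 2 * S n + S (n - i)| ≤ 1 := by
  have a := hS i n (n - i) (by omega)
  have b := hS i (n - i) n (by omega)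
  rw [sub_add_cancel] at a b
  rw [abs_le]; omega

/-! ### Sums of second differences of balanced words -/

/-- The maximal sum for the second difference of a Christoffel word of length `q`. -/
noncomputable def gapVal (β : ℝ) (q : ℕ) : ℝ :=
  (1 - β) * (1 - (1 - β) * β ^ (q - 1) / (1 - β ^ q))

section

variable {β : ℝ} (h0 : 0 < β) (h1 : β < 1)
include h0 h1

/-- `gapVal` is the value of the twice-summed formula when every coefficient is `1` except for zeros
at the multiples of `q`; the missing terms sum to `β^(q-1)/(1-β^q)`. -/
lemma one_sub_sq_mul_tsum_not_dvd {q : ℕ} (hq : 1 ≤ q) :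
    (1 - β) ^ 2 * ∑' i : ℕ, (if q ∣ i + 1 then (0 : ℝ) else 1) * β ^ i = gapVal β q := by
  set h : ℕ → ℝ := fun i => if q ∣ i + 1 then 1 else 0 with hh
  have hb : ∀ i, |h i| ≤ 1 := fun i => by simp only [hh]; split_ifs <;> simp
  have hs := summable_geom_of_bdd h0 h1 hb
  have hX : ∑' i, h i * β ^ i = β ^ (q - 1) / (1 - β ^ q) := by
    have hqlt : β ^ q < 1 := pow_lt_one₀ h0.le h1 (by omega)
    rw [eq_div_iff (by linarith)]
    have e := hs.sum_add_tsum_nat_add q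
    have e1 : ∑' i, h (i + q) * β ^ (i + q) = β ^ q * ∑' i, h i * β ^ i := by
      rw [← tsum_mul_left]
      refine tsum_congr fun i => ?_
      have : h (i + q) = h i := by
        simp only [hh, show i + q + 1 = i + 1 + q by ring, Nat.dvd_add_self_right]
      rw [this, pow_add]; ring
    have e2 : ∑ i ∈ Finset.range q, h i * β ^ i = β ^ (q - 1) := by
      rw [Finset.sum_eq_single (q - 1)]
      · simp [hh, Nat.sub_add_cancel hq]
      · intro i hi hne
        have : ¬ q ∣ i + 1 := fun hd => by
          have := Nat.le_of_dvd (by omega) hd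
          have := Finset.mem_range.1 hi
          omega
        simp [hh, this]
      · intro hn; simp at hn; omega
    rw [e1, e2] at e
    linarith
  have e : ∀ i : ℕ, (if q ∣ i + 1 then (0 : ℝ) else 1) * β ^ i = β ^ i - h i * β ^ i := fun i => by
    simp only [hh]; split_ifs <;> simp
  simp_rw [e]
  rw [(summable_geometric_of_lt_one h0.le h1).tsum_sub hs, hX, tsum_geometric_of_lt_one h0.le h1,
    gapVal]
  have : 1 - β ≠ 0 := by linarith
  field_simp

lemma gapVal_lt {q : ℕ} (hq : 1 ≤ q) : gapVal β q < 1 - β := by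
  have hqlt : β ^ q < 1 := pow_lt_one₀ h0.le h1 (by omega)
  have : 0 < (1 - β) * β ^ (q - 1) / (1 - β ^ q) :=
    div_pos (mul_pos (by linarith) (pow_pos h0 _)) (by linarith)
  rw [gapVal]
  nlinarith

/-- A fixed distance `δ` from the critical value bounds the possible periods `q`. -/
lemma le_pow_of_gapVal_le {q : ℕ} (hq : 1 ≤ q) {δ : ℝ} (h : gapVal β q ≤ 1 - β - δ) :
    δ ≤ β ^ (q - 1) := by
  have hqle : β ^ q ≤ β := by
    simpa using pow_le_pow_of_le_one h0.le h1.le hq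
  have hp : 0 < β ^ (q - 1) := pow_pos h0 _
  have : (1 - β) * ((1 - β) * β ^ (q - 1) / (1 - β ^ q)) ≤ β ^ (q - 1) := by
    rw [← mul_div_assoc, div_le_iff₀ (by linarith)]
    have : (1 - β) * (1 - β) ≤ 1 - β ^ q := by nlinarith
    nlinarith
  rw [gapVal] at h
  linarith

variable {S t : ℤ → ℤ} (hS : BalancedSum S) (htS : ∀ n, t n = S (n + 1) - 2 * S n + S (n - 1))
include hS htS

omit h0 h1 in
lemma BalancedSum.bddWord : BddWord t := ⟨1, fun n => by
  have := hS.abs_second_diff_le n 1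
  rw [htS]; simpa using this⟩

lemma BalancedSum.Phi_eq (n : ℤ) : Phi β t n = (1 - β) ^ 2 *
      ∑' i : ℕ, ((S (n + (i + 1)) - 2 * S n + S (n - (i + 1)) : ℤ) : ℝ) * β ^ i :=
  Phi_eq_second_primitive h0 h1 (hS.bddWord htS) htS n (hS.abs_second_diff_le n)

omit h0 h1 htS t in
lemma BalancedSum.abs_cast_le (n : ℤ) (i : ℕ) :
    |((S (n + (i + 1)) - 2 * S n + S (n - (i + 1)) : ℤ) : ℝ)| ≤ 1 := by
  have := hS.abs_second_diff_le n (i + 1)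
  push_cast at this
  rw [← Int.cast_abs]; exact_mod_cast this

/-- All coefficients in the second-primitive formula are at most `1` in absolute value, and `(1-β)²
· 1/(1-β) = 1-β`. This is the converse of `exists_balancedSum_of_Phi_le`. -/
lemma BalancedSum.abs_Phi_le (n : ℤ) : |Phi β t n| ≤ 1 - β := by
  rw [hS.Phi_eq h0 h1 htS, abs_mul, abs_of_nonneg (sq_nonneg _)]
  have := abs_tsum_geom_le h0 h1 (hS.abs_cast_le n)
  refine (mul_le_mul_of_nonneg_left this (sq_nonneg _)).trans_eq ?_
  have : 1 - β ≠ 0 := by linarith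
  field_simp

/-- If the second differences at multiples of `q` vanish, then the sums are bounded away from the
maximum. -/
lemma BalancedSum.abs_Phi_le_gapVal {q : ℕ} (hq : 1 ≤ q) (n : ℤ)
    (hz : ∀ i : ℕ, q ∣ i → S (n + i) - 2 * S n + S (n - i) = 0) : |Phi β t n| ≤ gapVal β q := by
  rw [hS.Phi_eq h0 h1 htS, abs_mul, abs_of_nonneg (sq_nonneg _),
    ← one_sub_sq_mul_tsum_not_dvd h0 h1 hq]
  refine mul_le_mul_of_nonneg_left ?_ (sq_nonneg _)
  have hs : Summable fun i : ℕ => (if q ∣ i + 1 then (0 : ℝ) else 1) * β ^ i :=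
    summable_geom_of_bdd h0 h1 (B := 1) fun i => by split_ifs <;> simp
  rw [← Real.norm_eq_abs]
  refine tsum_of_norm_bounded hs.hasSum fun i => ?_
  rw [Real.norm_eq_abs, abs_mul, abs_of_pos (pow_pos h0 i)]
  refine mul_le_mul_of_nonneg_right ?_ (pow_pos h0 i).le
  split_ifs with h
  · have := hz (i + 1) h
    push_cast at this
    rw [this]; simp
  · exact hS.abs_cast_le n i

/-- A gap below the maximum forces a non-negative second difference of bounded length. -/
lemma BalancedSum.exists_nonneg {δ : ℝ} (hδ : 0 < δ) (hP : ∀ n, |Phi β t n| ≤ 1 - β - δ) :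
    ∃ K : ℕ, ∀ n, ∃ i : ℕ, 1 ≤ i ∧ i ≤ K ∧ 0 ≤ S (n + i) - 2 * S n + S (n - i) := by
  -- If the first `K` second differences were all negative, the sum would be at most `-(1-β)(1 -
  -- 2β^K)`, which is below `-(1-β) + δ` once `β^K < δ/2`.
  obtain ⟨K, hK⟩ := exists_pow_lt_of_lt_one (half_pos hδ) h1
  refine ⟨K, fun n => ?_⟩
  by_contra! hh
  have p := (abs_le.1 (hP n)).1
  rw [hS.Phi_eq h0 h1 htS] at p
  set e : ℕ → ℝ := fun i => ((S (n + (i + 1)) - 2 * S n + S (n - (i + 1)) : ℤ) : ℝ) with he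
  have heb : ∀ i, |e i| ≤ 1 := hS.abs_cast_le n
  have hs := summable_geom_of_bdd h0 h1 heb
  rw [← hs.sum_add_tsum_nat_add K] at p
  have a1 : ∑ i ∈ Finset.range K, e i * β ^ i ≤ -((1 - β ^ K) / (1 - β)) := by
    have : ∑ i ∈ Finset.range K, e i * β ^ i ≤ ∑ i ∈ Finset.range K, -(β ^ i) := by
      refine Finset.sum_le_sum fun i hi => ?_
      have h := hh (i + 1) (by omega) (Finset.mem_range.1 hi)
      push_cast at h
      have h' : e i ≤ -1 := by
        have : S (n + (i + 1)) - 2 * S n + S (n - (i + 1)) ≤ -1 := by omega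
        simp only [he]; exact_mod_cast this
      nlinarith [pow_pos h0 i]
    refine this.trans_eq ?_
    rw [Finset.sum_neg_distrib, geom_sum_eq h1.ne, ← neg_div_neg_eq]; simp
  have a2 : ∑' i, e (i + K) * β ^ (i + K) ≤ β ^ K * (1 / (1 - β)) := by
    have : ∑' i, e (i + K) * β ^ (i + K) = β ^ K * ∑' i, e (i + K) * β ^ i := by
      rw [← tsum_mul_left]; exact tsum_congr fun i => by rw [pow_add]; ring
    rw [this]
    exact mul_le_mul_of_nonneg_left (abs_le.1 (abs_tsum_geom_le h0 h1 fun i => heb (i + K))).2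
      (pow_pos h0 K).le
  have a3 : ∑ i ∈ Finset.range K, e i * β ^ i + ∑' i, e (i + K) * β ^ (i + K)
      ≤ -((1 - 2 * β ^ K) / (1 - β)) := by
    refine (add_le_add a1 a2).trans_eq ?_
    have : 1 - β ≠ 0 := by linarith
    field_simp
    ring
  have a4 := mul_le_mul_of_nonneg_left a3 (sq_nonneg (1 - β))
  have a5 : (1 - β) ^ 2 * -((1 - 2 * β ^ K) / (1 - β)) = -((1 - β) * (1 - 2 * β ^ K)) := by
    have : 1 - β ≠ 0 := by linarith
    field_simp
  have a6 : 0 < β ^ K := pow_pos h0 K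
  nlinarith

end

/-! ### Slopes of balanced words -/

/-- Both sides bound the count on `[0, lm)`, cut once into `m` windows of length `l` and once into
`l` windows of length `m`. -/
lemma BalancedSum.mul_le_mul {S : ℤ → ℤ} (hS : BalancedSum S) (l m : ℕ) (i j : ℤ) :
    m * (S (i + l) - S i - 1) ≤ l * (S (j + m) - S j + 1) := by
  have lo : ∀ k : ℕ, k * (S (i + l) - S i - 1) ≤ S (k * l) - S 0 := fun k => by
    induction k with
    | zero => simp
    | succ k ih =>
      have := hS l i (k * l) (by omega)
      push_cast
      rw [show ((k : ℤ) + 1) * l = k * l + l by ring]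
      linarith
  have hi : ∀ k : ℕ, S (k * m) - S 0 ≤ k * (S (j + m) - S j + 1) := fun k => by
    induction k with
    | zero => simp
    | succ k ih =>
      have := hS m (k * m) j (by omega)
      push_cast
      rw [show ((k : ℤ) + 1) * m = k * m + m by ring]
      linarith
  have a := lo m
  have b := hi l
  rw [mul_comm (l : ℤ) m] at b
  linarith

/-- The slope is the supremum of the lower estimates `(count - 1)/length`; by `mul_le_mul` each
upper estimate `(count + 1)/length` bounds them all. -/
lemma BalancedSum.exists_slope {S : ℤ → ℤ} (hS : BalancedSum S) :
    ∃ θ : ℝ, ∀ m n : ℤ, |(S m - m * θ : ℝ) - (S n - n * θ)| ≤ 1 := by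
  set A : Set ℝ := {x | ∃ (l : ℕ) (i : ℤ), 1 ≤ l ∧ x = ((S (i + l) - S i - 1 : ℤ) : ℝ) / l} with hA
  have hub : ∀ (m : ℕ) (j : ℤ), 1 ≤ m → ((S (j + m) - S j + 1 : ℤ) : ℝ) / m ∈ upperBounds A := by
    rintro m j hm _ ⟨l, i, hl, rfl⟩
    rw [div_le_div_iff₀ (by exact_mod_cast hl) (by exact_mod_cast hm)]
    have := hS.mul_le_mul l m i j
    have : (((S (i + l) - S i - 1) * m : ℤ) : ℝ) ≤ (((S (j + m) - S j + 1) * l : ℤ) : ℝ) := by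
      exact_mod_cast (by linarith)
    push_cast at this ⊢
    exact this
  have hne : A.Nonempty := ⟨_, 1, 0, le_rfl, rfl⟩
  have hbd : BddAbove A := ⟨_, hub 1 0 le_rfl⟩
  have key : ∀ (l : ℕ) (n : ℤ),
      |(S (n + l) - (n + l : ℤ) * sSup A : ℝ) - (S n - n * sSup A)| ≤ 1 := by
    intro l n
    rcases Nat.eq_zero_or_pos l with rfl | hl
    · simp
    · have hl' : (0 : ℝ) < l := by exact_mod_cast hl
      have a : ((S (n + l) - S n - 1 : ℤ) : ℝ) / l ≤ sSup A := le_csSup hbd ⟨l, n, hl, rfl⟩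
      have b : sSup A ≤ ((S (n + l) - S n + 1 : ℤ) : ℝ) / l := csSup_le hne (hub l n hl)
      rw [div_le_iff₀ hl'] at a
      rw [le_div_iff₀ hl'] at b
      push_cast at a b ⊢
      rw [abs_le]
      constructor <;> linarith
  refine ⟨sSup A, fun m n => ?_⟩
  rcases le_total n m with h | h
  · have := key (m - n).toNat n
    rwa [show n + ((m - n).toNat : ℤ) = m by omega] at this
  · have := key (n - m).toNat m
    rw [show m + ((n - m).toNat : ℤ) = n by omega] at this
    rwa [abs_sub_comm]

lemma exists_le_abs_mul_sub {θ : ℝ} (h : ∀ i : ℕ, 1 ≤ i → ∀ z : ℤ, (i : ℝ) * θ ≠ z) (K : ℕ) :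
    ∃ ε > 0, ∀ i : ℕ, 1 ≤ i → i ≤ K → ∀ z : ℤ, ε ≤ |(i : ℝ) * θ - z| := by
  induction K with
  | zero => exact ⟨1, one_pos, fun i h1 h2 => by omega⟩
  | succ K ih =>
    obtain ⟨ε, hε, H⟩ := ih
    refine ⟨min ε |((K + 1 : ℕ) : ℝ) * θ - round (((K + 1 : ℕ) : ℝ) * θ)|,
      lt_min hε (abs_pos.2 (sub_ne_zero.2 (h _ (by omega) _))), fun i h1 h2 z => ?_⟩
    rcases Nat.lt_or_ge i (K + 1) with hi | hi
    · exact (min_le_left _ _).trans (H i h1 (by omega) z)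
    · obtain rfl : i = K + 1 := by omega
      exact (min_le_right _ _).trans (round_le _ z)

/-- A balanced word whose second differences are recurrently non-negative has a rational slope. -/
lemma BalancedSum.exists_rat_slope {S : ℤ → ℤ} (hS : BalancedSum S) {K : ℕ}
    (hK : ∀ n, ∃ i : ℕ, 1 ≤ i ∧ i ≤ K ∧ 0 ≤ S (n + i) - 2 * S n + S (n - i)) :
    ∃ r : ℚ, ∀ m n : ℤ, |(S m - m * r : ℝ) - (S n - n * r)| ≤ 1 := by
  obtain ⟨θ, hθ⟩ := hS.exists_slope
  suffices H : ∃ i : ℕ, 1 ≤ i ∧ ∃ z : ℤ, (i : ℝ) * θ = z by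
    obtain ⟨i, hi, z, hz⟩ := H
    have hi' : (i : ℝ) ≠ 0 := by positivity
    refine ⟨(z : ℚ) / i, ?_⟩
    have : (((z : ℚ) / i : ℚ) : ℝ) = θ := by
      push_cast; rw [← hz]; field_simp
    rw [this]; exact hθ
  by_contra! hh
  obtain ⟨ε, hε, hεK⟩ := exists_le_abs_mul_sub hh K
  set f : ℤ → ℝ := fun n => S n - n * θ with hf
  have hbd : BddAbove (Set.range f) := ⟨f 0 + 1, by
    rintro _ ⟨n, rfl⟩; linarith [(abs_le.1 (hθ n 0)).2]⟩
  -- At a nearly maximal `f n`, a non-negative second difference forces `f (n + i)` to be close to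
  -- `f n`. Their difference is `iθ` minus an integer, and `ε` bounds that away from zero for `i ≤
  -- K`.
  obtain ⟨_, ⟨n, rfl⟩, hn⟩ := exists_lt_of_lt_csSup (Set.range_nonempty f)
    (show sSup (Set.range f) - min ε (1 / 2) < sSup (Set.range f) by
      linarith [lt_min hε (by norm_num : (0 : ℝ) < 1 / 2)])
  have hle : ∀ m, f m ≤ sSup (Set.range f) := fun m => le_csSup hbd ⟨m, rfl⟩
  obtain ⟨i, hi1, hiK, hi⟩ := hK n
  have e : ((S (n + i) - 2 * S n + S (n - i) : ℤ) : ℝ) = f (n + i) + f (n - i) - 2 * f n := by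
    simp only [hf]; push_cast; ring
  have hi' : (0 : ℝ) ≤ f (n + i) + f (n - i) - 2 * f n := by rw [← e]; exact_mod_cast hi
  have := hεK i hi1 hiK (S (n + i) - S n)
  have e2 : (i : ℝ) * θ - ((S (n + i) - S n : ℤ) : ℝ) = f n - f (n + i) := by
    simp only [hf]; push_cast; ring
  rw [e2] at this
  have k1 := min_le_left ε (1 / 2)
  have k2 := hle (n + i)
  have k3 := hle (n - i)
  rcases abs_cases (f n - f (n + i)) with ⟨h, _⟩ | ⟨h, _⟩ <;> rw [h] at this <;> linarith

/-- If `A` is ever lost, then `hmono` forbids regaining it anywhere, while `hrec` demands a later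
point with `A`. -/
lemma forall_nonneg_of_recurrent {A : ℤ → Prop} (hA0 : A 0)
    (hmono : ∀ k k', A k → ¬ A (k + 1) → ¬ A k' → A (k' + 1) → False)
    (hrec : ∀ k, A k → ∃ i : ℕ, 1 ≤ i ∧ A (k + i)) (k : ℕ) : A k := by
  by_contra hk
  obtain ⟨m, hm, hm'⟩ : ∃ m : ℤ, A m ∧ ¬ A (m + 1) := by
    by_contra! hh
    refine hk ?_
    clear hk
    induction k with
    | zero => exact hA0
    | succ k ih => push_cast; exact hh _ ih
  obtain ⟨i, hi, hAi⟩ := hrec m hm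
  have : ∀ j : ℕ, ¬ A (m + 1 + j) := fun j => by
    induction j with
    | zero => simpa using hm'
    | succ j ih =>
      intro h
      exact hmono m (m + 1 + j) hm hm' ih (by push_cast at h; rwa [← add_assoc] at h)
  refine this (i - 1) ?_
  rwa [show m + 1 + ((i - 1 : ℕ) : ℤ) = m + i by omega]

lemma forall_of_recurrent {A : ℤ → Prop} (hA0 : A 0)
    (hmono : ∀ k k', A k → ¬ A (k + 1) → ¬ A k' → A (k' + 1) → False)
    (hrec : ∀ k, A k → ∃ i : ℕ, 1 ≤ i ∧ A (k + i) ∧ A (k - i)) (k : ℤ) : A k := by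
  obtain ⟨k, rfl | rfl⟩ := Int.eq_nat_or_neg k
  · exact forall_nonneg_of_recurrent hA0 hmono
      (fun k hk => (hrec k hk).imp fun i hi => ⟨hi.1, hi.2.1⟩) k
  · refine forall_nonneg_of_recurrent (A := fun k => A (-k)) (by simpa using hA0)
      (fun k k' h h1 h2 h3 => ?_) (fun k hk => (hrec _ hk).imp fun i hi => ⟨hi.1, ?_⟩) k
    · refine hmono (-(k' + 1)) (-(k + 1)) h3 ?_ h1 ?_ <;> simpa
    · have := hi.2.2
      rwa [neg_add]

/-- A balanced word whose second differences are recurrently non-negative is periodic. -/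
theorem BalancedSum.exists_christoffel {S : ℤ → ℤ} (hS : BalancedSum S)
    (hstep : ∀ n, S (n + 1) - S n = 0 ∨ S (n + 1) - S n = 1) {K : ℕ}
    (hK : ∀ n, ∃ i : ℕ, 1 ≤ i ∧ i ≤ K ∧ 0 ≤ S (n + i) - 2 * S n + S (n - i)) :
    ∃ p q : ℕ, 1 ≤ q ∧ p ≤ q ∧ p.Coprime q ∧ ∃ n₀ : ℤ, ∀ m : ℤ, S (n₀ + m) = S n₀ + m * p / q := by
  obtain ⟨r, hr⟩ := hS.exists_rat_slope hK
  have hgrow : ∀ l : ℕ, 0 ≤ S l - S 0 ∧ S l - S 0 ≤ l := fun l => by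
    induction l with
    | zero => simp
    | succ l ih => have := hstep l; push_cast; omega
  have hr0 : 0 ≤ r := by
    by_contra! hh
    have hh' : (r : ℝ) < 0 := by exact_mod_cast hh
    obtain ⟨l, hl⟩ := exists_nat_gt (1 / -(r : ℝ))
    rw [div_lt_iff₀ (by linarith)] at hl
    have a := (abs_le.1 (hr l 0)).2
    have b : (0 : ℝ) ≤ S l - S 0 := by exact_mod_cast (hgrow l).1
    push_cast at a
    linarith
  have hr1 : r ≤ 1 := by
    by_contra! hh
    have hh' : (1 : ℝ) < r := by exact_mod_cast hh
    obtain ⟨l, hl⟩ := exists_nat_gt (1 / ((r : ℝ) - 1))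
    rw [div_lt_iff₀ (by linarith)] at hl
    have a := (abs_le.1 (hr l 0)).1
    have b : (S l - S 0 : ℝ) ≤ l := by exact_mod_cast (hgrow l).2
    push_cast at a
    linarith
  obtain ⟨p, hp⟩ := Int.eq_ofNat_of_zero_le (Rat.num_nonneg.2 hr0)
  obtain ⟨q, hq⟩ : ∃ q, q = r.den := ⟨_, rfl⟩
  have hq1 : 1 ≤ q := hq ▸ r.pos
  have hq1' : (0 : ℤ) < q := by exact_mod_cast hq1
  have hcop : p.Coprime q := by
    have := r.reduced; rw [hp] at this; rw [hq]; simpa using this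
  have hrq : (r : ℝ) * q = p := by
    have := Rat.mul_den_eq_num r
    rw [hp, ← hq] at this
    exact_mod_cast congrArg (Rat.cast (K := ℝ)) this
  have hpq : p ≤ q := by
    have : (r : ℝ) ≤ 1 := by exact_mod_cast hr1
    have h : (p : ℝ) ≤ q := by
      rw [← hrq]; exact mul_le_of_le_one_left (by positivity) this
    exact_mod_cast h
  -- `F` is `q` times the deviation from the line of slope `p/q`: integer valued, of oscillation at
  -- most `q`, so it attains a maximum. At a maximum, a non-negative second difference forces both
  -- outer points to be maxima too.
  set F : ℤ → ℤ := fun n => q * S n - p * n with hF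
  have hFb : ∀ m n, F m - F n ≤ q := fun m n => by
    have a := (abs_le.1 (hr m n)).2
    have : ((F m - F n : ℤ) : ℝ) ≤ q := by
      simp only [hF]; push_cast
      rw [← hrq]
      have := mul_le_mul_of_nonneg_left a (Nat.cast_nonneg (α := ℝ) q)
      linarith
    exact_mod_cast this
  obtain ⟨_, ⟨n₀, rfl⟩, hmax⟩ := Int.exists_greatest_of_bdd (P := fun z => ∃ n, F n = z)
    ⟨F 0 + q, by rintro _ ⟨n, rfl⟩; linarith [hFb n 0]⟩ ⟨_, 0, rfl⟩
  have hmax : ∀ n, F n ≤ F n₀ := fun n => hmax _ ⟨n, rfl⟩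
  have hrec : ∀ n, F n = F n₀ → ∃ i : ℕ, 1 ≤ i ∧ F (n + i) = F n₀ ∧ F (n - i) = F n₀ := by
    intro n hn
    obtain ⟨i, hi, _, hE⟩ := hK n
    have e : F (n + i) + F (n - i) - 2 * F n = q * (S (n + i) - 2 * S n + S (n - i)) := by
      simp only [hF]; ring
    have : 0 ≤ F (n + i) + F (n - i) - 2 * F n := e ▸ mul_nonneg hq1'.le hE
    have := hmax (n + i)
    have := hmax (n - i)
    exact ⟨i, hi, by omega, by omega⟩
  have hdvd : ∀ n m : ℤ, (q : ℤ) ∣ F (n + m) - F n → (q : ℤ) ∣ m := fun n m h => by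
    have : (q : ℤ) ∣ p * m := by
      have e : (p : ℤ) * m = q * (S (n + m) - S n) - (F (n + m) - F n) := by simp only [hF]; ring
      rw [e]; exact dvd_sub (dvd_mul_right _ _) h
    exact (Int.isCoprime_iff_gcd_eq_one.2 (by simpa using hcop.symm)).dvd_of_dvd_mul_left this
  have hAall : ∀ k : ℤ, F (n₀ + k * q) = F n₀ := by
    have hval : ∀ k : ℤ, F (n₀ + k * q) ≠ F n₀ → F (n₀ + k * q) = F n₀ - q := fun k hne => by
      obtain ⟨z, hz⟩ : (q : ℤ) ∣ F n₀ - F (n₀ + k * q) :=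
        ⟨S n₀ - S (n₀ + k * q) + p * k, by simp only [hF]; ring⟩
      have a := hFb n₀ (n₀ + k * q)
      have b := hmax (n₀ + k * q)
      have z0 : 0 ≤ z := by by_contra! hh; nlinarith
      have z1 : z ≤ 1 := by by_contra! hh; nlinarith
      rcases (by omega : z = 0 ∨ z = 1) with rfl | rfl
      · exact absurd (by linarith) hne
      · linarith
    -- Along `n₀ + qℤ` the values are `F n₀` or `F n₀ - q`. A descent is a window of length `q` with
    -- `p - 1` ones, an ascent one with `p + 1`; balance forbids having both.
    have hS' : ∀ k : ℤ, q * (S (n₀ + k * q + q) - S (n₀ + k * q)) =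
        F (n₀ + (k + 1) * q) - F (n₀ + k * q) + p * q := fun k => by
      rw [show n₀ + (k + 1) * (q : ℤ) = n₀ + k * q + q by ring]
      simp only [hF]; ring
    refine forall_of_recurrent (by simp) (fun k k' a b c d => ?_) fun k hk => ?_
    · have e1 := hS' k
      have e2 := hS' k'
      rw [a, hval _ b] at e1
      rw [d, hval _ c] at e2
      have := hS q (n₀ + k' * q) (n₀ + k * q) hq1'.le
      nlinarith
    · obtain ⟨i, hi, h2, h3⟩ := hrec _ hk
      obtain ⟨z, hz⟩ := hdvd (n₀ + k * q) i (by rw [h2, hk, sub_self]; exact dvd_zero _)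
      have hz0 : 0 < z := by
        by_contra! hh
        have : (1 : ℤ) ≤ i := by exact_mod_cast hi
        nlinarith
      refine ⟨z.toNat, by omega, ?_, ?_⟩
      · rw [Int.toNat_of_nonneg hz0.le, ← h2, hz]; congr 1; ring
      · rw [Int.toNat_of_nonneg hz0.le, ← h3, hz]; congr 1; ring
  refine ⟨p, q, hq1, hpq, hcop, n₀, fun m => ?_⟩
  have a := hmax (n₀ + m)
  -- Equality would give `q ∣ m`, where `F` is maximal. With `0 ≤ F n₀ - F (n₀ + m) < q` the count
  -- is the floor of `mp/q`.
  have b : F n₀ - F (n₀ + m) < q := by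
    refine lt_of_le_of_ne (hFb _ _) fun h => ?_
    obtain ⟨z, rfl⟩ := hdvd n₀ m ⟨-1, by linarith⟩
    have := hAall z
    rw [mul_comm] at h
    omega
  have c : m * p / q = S (n₀ + m) - S n₀ := by
    rw [Int.ediv_eq_iff_of_pos hq1']
    simp only [hF] at a b
    constructor <;> linarith
  rw [c]; ring

/-! ### Periodic words -/

/-- The second difference of `n ↦ ⌊(n p + a) / q⌋`. -/
def mechWord (p q : ℕ) (a : ℤ) (n : ℤ) : ℤ :=
  ((n + 1) * p + a) / q - 2 * ((n * p + a) / q) + ((n - 1) * p + a) / q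

lemma Int.ediv_add_ediv_le {q : ℤ} (hq : 0 < q) (x y : ℤ) :
    x / q + y / q ≤ (x + y) / q ∧ (x + y) / q ≤ x / q + y / q + 1 := by
  have hx := Int.mul_ediv_add_emod x q
  have hy := Int.mul_ediv_add_emod y q
  have := Int.emod_nonneg x hq.ne'
  have := Int.emod_nonneg y hq.ne'
  have := Int.emod_lt_of_pos x hq
  have := Int.emod_lt_of_pos y hq
  constructor
  · rw [Int.le_ediv_iff_mul_le hq]; nlinarith
  · rw [← Int.lt_add_one_iff, Int.ediv_lt_iff_lt_mul hq]; nlinarith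

lemma balancedSum_ediv (p a : ℤ) {q : ℤ} (hq : 0 < q) :
    BalancedSum fun m => (m * p + a) / q := by
  intro l i j _
  have h1 := Int.ediv_add_ediv_le hq (i * p + a) (l * p)
  have h2 := Int.ediv_add_ediv_le hq (j * p + a) (l * p)
  beta_reduce
  rw [show (i + l) * p + a = i * p + a + l * p by ring,
    show (j + l) * p + a = j * p + a + l * p by ring]
  omega

lemma mechWord_add_period {p q : ℕ} (hq : 1 ≤ q) (a n : ℤ) (k : ℤ) :
    mechWord p q a (n + k * q) = mechWord p q a n := by
  have hq' : (q : ℤ) ≠ 0 := by exact_mod_cast (by omega : q ≠ 0)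
  simp only [mechWord]
  rw [show (n + k * q + 1) * (p : ℤ) + a = (n + 1) * p + a + k * p * q by ring,
    show (n + k * q) * (p : ℤ) + a = n * p + a + k * p * q by ring,
    show (n + k * q - 1) * (p : ℤ) + a = (n - 1) * p + a + k * p * q by ring]
  simp only [Int.add_mul_ediv_right _ _ hq']
  ring

section

variable {β : ℝ} (h0 : 0 < β) (h1 : β < 1) {p q : ℕ} (hq : 1 ≤ q) (a : ℤ)

include hq in
lemma bddWord_mechWord : BddWord (mechWord p q a) :=
  (balancedSum_ediv p a (by omega : (0 : ℤ) < q)).bddWord fun _ => rfl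

include hq in
lemma ediv_second_diff_eq_zero (n : ℤ) (i : ℕ) (h : q ∣ i) :
    ((n + i) * p + a) / q - 2 * ((n * p + a) / q) + ((n - i) * p + a) / q = 0 := by
  obtain ⟨k, rfl⟩ := h
  have hq' : (q : ℤ) ≠ 0 := by exact_mod_cast (by omega : q ≠ 0)
  push_cast
  rw [show (n + q * k) * (p : ℤ) + a = n * p + a + k * p * q by ring,
    show (n - q * k) * (p : ℤ) + a = n * p + a + -(k * p) * q by ring]
  simp only [Int.add_mul_ediv_right _ _ hq']
  ring

include h0 h1 hq

lemma abs_Phi_mechWord_le (n : ℤ) : |Phi β (mechWord p q a) n| ≤ gapVal β q :=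
  (balancedSum_ediv p a (by omega : (0 : ℤ) < q)).abs_Phi_le_gapVal h0 h1 (fun _ => rfl) hq n
    (ediv_second_diff_eq_zero hq a n)

/-- Where the numerator is divisible by `q`, the second differences are `⌊x⌋ + ⌊-x⌋` with `x =
ip/q`: zero if `q ∣ i` and `-1` otherwise, so the general bound is attained. -/
lemma Phi_mechWord_eq (hpq : p.Coprime q) {n : ℤ} (hn : (q : ℤ) ∣ n * p + a) :
    Phi β (mechWord p q a) n = -gapVal β q := by
  have hq0 : (0 : ℤ) < q := by omega
  rw [(balancedSum_ediv p a hq0).Phi_eq h0 h1 (t := mechWord p q a) (fun _ => rfl),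
    ← one_sub_sq_mul_tsum_not_dvd h0 h1 hq, ← mul_neg, ← tsum_neg]
  congr 2
  funext i
  rw [← neg_mul]
  congr 1
  split_ifs with h
  · have := ediv_second_diff_eq_zero (p := p) hq a n (i + 1) h
    push_cast at this
    rw [neg_zero, Int.cast_eq_zero]
    exact this
  · obtain ⟨z, hz⟩ := hn
    have e1 : (n + (i + 1)) * (p : ℤ) + a = (i + 1) * p + z * q := by linarith
    have e2 : (n - (i + 1)) * (p : ℤ) + a = -((i + 1) * p) + z * q := by linarith
    rw [e1, e2, hz, mul_comm (q : ℤ) z]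
    have hm : ¬ (q : ℤ) ∣ (i + 1) * p := fun hd => h <| by
      have hc : IsCoprime (q : ℤ) p := Nat.isCoprime_iff_coprime.2 hpq.symm
      exact_mod_cast hc.dvd_of_dvd_mul_right hd
    have e3 : -(((i : ℤ) + 1) * p) / q = -(((i + 1) * p) / q) - 1 := by
      rw [Int.ediv_eq_iff_of_pos hq0]
      have a1 := Int.mul_ediv_add_emod (((i : ℤ) + 1) * p) q
      have a2 := Int.emod_lt_of_pos (((i : ℤ) + 1) * p) hq0
      have a3 : 0 < (((i : ℤ) + 1) * p) % q := by
        refine lt_of_le_of_ne (Int.emod_nonneg _ hq0.ne') fun h => hm ?_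
        exact Int.dvd_of_emod_eq_zero h.symm
      constructor <;> nlinarith
    rw [Int.add_mul_ediv_right _ _ hq0.ne', Int.add_mul_ediv_right _ _ hq0.ne',
      Int.mul_ediv_cancel _ hq0.ne', e3]
    push_cast; ring

end

/-! ### Limit words -/

/-- `t` is a limit of the translates `w (n + ·)` along an ultrafilter of positions tending to
infinity. -/
def IsLimitAlong (U : Ultrafilter ℤ) (w t : ℤ → ℤ) : Prop :=
  (U : Filter ℤ) ≤ atTop ∧ ∀ i, ∀ᶠ n in (U : Filter ℤ), w (n + i) = t i

/-- Limit words of `w` at `+∞`. -/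
def IsLimitWord (w t : ℤ → ℤ) : Prop := ∃ U, IsLimitAlong U w t

/-- Compactness: an ultrafilter selects one letter of the finite alphabet at each offset, with no
extraction of subsequences. -/
lemma exists_isLimitAlong {w : ℤ → ℤ} (hw : BddWord w) (f : Filter ℤ) [NeBot f] (hf : f ≤ atTop) :
    ∃ (U : Ultrafilter ℤ) (t : ℤ → ℤ), (U : Filter ℤ) ≤ f ∧ IsLimitAlong U w t := by
  obtain ⟨B, hB⟩ := hw
  have hU : (Ultrafilter.of f : Filter ℤ) ≤ f := Ultrafilter.of_le f
  have : ∀ i, ∃ z, ∀ᶠ n in (Ultrafilter.of f : Filter ℤ), w (n + i) = z := fun i => by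
    have h : (⋃ z ∈ Set.Icc (-B) B, {n | w (n + i) = z}) ∈ Ultrafilter.of f := by
      have e : (⋃ z ∈ Set.Icc (-B) B, {n | w (n + i) = z}) = Set.univ := by
        ext n
        simp [abs_le.1 (hB (n + i))]
      rw [e]; exact Filter.univ_mem
    rw [Ultrafilter.finite_biUnion_mem_iff (Set.finite_Icc _ _)] at h
    obtain ⟨z, _, hz⟩ := h
    exact ⟨z, hz⟩
  choose t ht using this
  exact ⟨Ultrafilter.of f, t, hU, hU.trans hf, ht⟩

lemma exists_isLimitAlong_of_frequently {w : ℤ → ℤ} (hw : BddWord w) {P : ℤ → Prop}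
    (hP : ∃ᶠ n in atTop, P n) :
    ∃ (U : Ultrafilter ℤ) (t : ℤ → ℤ), IsLimitAlong U w t ∧ ∀ᶠ n in (U : Filter ℤ), P n := by
  have : NeBot (atTop ⊓ 𝓟 {n | P n}) := frequently_mem_iff_neBot.1 hP
  obtain ⟨U, t, hU, h⟩ := exists_isLimitAlong hw (atTop ⊓ 𝓟 {n | P n}) inf_le_left
  exact ⟨U, t, h, hU (mem_inf_of_right (mem_principal_self _))⟩

lemma IsLimitAlong.bounded {U w t} (h : IsLimitAlong U w t) {B : ℤ}
    (hB : ∀ᶠ n in atTop, |w n| ≤ B) (i : ℤ) : |t i| ≤ B := by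
  have h1 : ∀ᶠ n in (U : Filter ℤ), |w (n + i)| ≤ B :=
    h.1 ((tendsto_atTop_add_const_right atTop i tendsto_id).eventually hB)
  obtain ⟨n, h2, h3⟩ := (h1.and (h.2 i)).exists
  rwa [← h3]

lemma IsLimitAlong.bddWord {U w t} (h : IsLimitAlong U w t) (hw : BddWord w) : BddWord t :=
  hw.imp fun _ hB => h.bounded (Eventually.of_forall hB)

section

variable {β : ℝ} (h0 : 0 < β) (h1 : β < 1)
include h0 h1

lemma IsLimitAlong.tendsto_Phi {U w t} (h : IsLimitAlong U w t) (hw : BddWord w) (j : ℤ) :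
    Tendsto (fun n => Phi β w (n + j)) U (𝓝 (Phi β t j)) := by
  obtain ⟨B, hB⟩ := hw
  refine Tendsto.sub ?_ ?_
  · refine tendsto_tsum_of_dominated_convergence (bound := fun i => ((2 * B : ℤ) : ℝ) * β ^ i)
      ((summable_geometric_of_lt_one h0.le h1).mul_left _) (fun i => ?_)
      (Eventually.of_forall fun n i => ?_)
    · refine tendsto_const_nhds.congr' ?_
      filter_upwards [h.2 (j + i), h.2 (j - i)] with n e1 e2
      rw [← e1, ← e2]
      congr 4 <;> ring
    · rw [Real.norm_eq_abs, abs_mul, abs_of_pos (pow_pos h0 i)]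
      refine mul_le_mul_of_nonneg_right ?_ (pow_pos h0 i).le
      rw [← Int.cast_abs, Int.cast_le]
      have := abs_add_le (w (n + j + i)) (w (n + j - i))
      linarith [hB (n + j + i), hB (n + j - i)]
  · refine tendsto_const_nhds.congr' ?_
    filter_upwards [h.2 j] with n e
    rw [e]

lemma BddWord.exists_abs_Phi_le {w : ℤ → ℤ} (hw : BddWord w) : ∃ M, ∀ n, |Phi β w n| ≤ M := by
  obtain ⟨B, hB⟩ := hw
  refine ⟨((2 * B : ℤ) : ℝ) / (1 - β) + B, fun n => ?_⟩
  refine (abs_sub _ _).trans (add_le_add (abs_tsum_geom_le h0 h1 fun i => ?_) ?_)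
  · rw [← Int.cast_abs, Int.cast_le]
    have := abs_add_le (w (n + i)) (w (n - i))
    linarith [hB (n + i), hB (n - i)]
  · rw [← Int.cast_abs, Int.cast_le]; exact hB n

end

/-- The limit superior of the absolute values of the two-sided sums. -/
noncomputable def limsupPhi (β : ℝ) (w : ℤ → ℤ) : ℝ := limsup (fun n : ℕ => |Phi β w n|) atTop

section

variable {β : ℝ} (h0 : 0 < β) (h1 : β < 1) {w : ℤ → ℤ} (hw : BddWord w)
include h0 h1 hw

lemma isBounded_abs_Phi : IsBoundedUnder (· ≤ ·) atTop fun n : ℕ => |Phi β w n| := by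
  obtain ⟨M, hM⟩ := hw.exists_abs_Phi_le h0 h1
  exact isBoundedUnder_of ⟨M, fun n => hM n⟩

omit h0 h1 hw in
lemma isCobounded_abs_Phi : IsCoboundedUnder (· ≤ ·) atTop fun n : ℕ => |Phi β w n| :=
  isCoboundedUnder_le_of_le atTop (x := 0) fun _ => abs_nonneg _

lemma eventually_abs_Phi_lt {c : ℝ} (hc : limsupPhi β w < c) :
    ∀ᶠ n : ℤ in atTop, |Phi β w n| < c := by
  have := eventually_lt_of_limsup_lt hc (isBounded_abs_Phi h0 h1 hw)
  rw [← Nat.map_cast_int_atTop, eventually_map]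
  exact this

/-- `Phi` is continuous under limits of translates, and centring a limit at positions where `|Phi|`
is large turns a large limsup into a large value of a limit word. -/
lemma limsupPhi_le_iff {c : ℝ} :
    limsupPhi β w ≤ c ↔ ∀ t, IsLimitWord w t → ∀ j, |Phi β t j| ≤ c := by
  constructor
  · rintro h t ⟨U, hU⟩ j
    refine le_of_forall_gt fun c' hc' => ?_
    obtain ⟨c'', h1', h2'⟩ := exists_between hc'
    refine lt_of_le_of_lt ?_ h2'
    refine le_of_tendsto (hU.tendsto_Phi h0 h1 hw j).abs ?_
    have := eventually_abs_Phi_lt h0 h1 hw (h.trans_lt h1')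
    have h3 : ∀ᶠ n in (U : Filter ℤ), |Phi β w (n + j)| < c'' :=
      hU.1 ((tendsto_atTop_add_const_right atTop j tendsto_id).eventually this)
    exact h3.mono fun n hn => hn.le
  · intro h
    by_contra! hh
    obtain ⟨c', h1', h2'⟩ := exists_between hh
    have hf : ∃ᶠ n : ℤ in atTop, c' < |Phi β w n| := by
      rw [← Nat.map_cast_int_atTop, frequently_map]
      exact frequently_lt_of_lt_limsup isCobounded_abs_Phi h2'
    obtain ⟨U, t, hU, hP⟩ := exists_isLimitAlong_of_frequently hw hf
    have := ge_of_tendsto (hU.tendsto_Phi h0 h1 hw 0).abs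
      (hP.mono fun n hn => by rw [add_zero]; exact hn.le)
    linarith [h t ⟨U, hU⟩ 0]

omit h0 h1 hw in
lemma isLimitWord_congr {w' : ℤ → ℤ} (h : ∀ᶠ n in atTop, w n = w' n) (t : ℤ → ℤ) :
    IsLimitWord w t ↔ IsLimitWord w' t := by
  refine exists_congr fun U => and_congr_right fun hU => forall_congr' fun i => ?_
  refine eventually_congr ?_
  have h3 : ∀ᶠ n in (U : Filter ℤ), w (n + i) = w' (n + i) :=
    hU ((tendsto_atTop_add_const_right atTop i tendsto_id).eventually h)
  exact h3.mono fun n hn => by rw [hn]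

lemma limsupPhi_congr {w' : ℤ → ℤ} (hw' : BddWord w') (h : ∀ᶠ n in atTop, w n = w' n) :
    limsupPhi β w = limsupPhi β w' :=
  eq_of_forall_ge_iff fun c => by
    rw [limsupPhi_le_iff h0 h1 hw, limsupPhi_le_iff h0 h1 hw']
    simp only [isLimitWord_congr h]

-- A limit word centred at recurring failures of the period would violate the hypothesis at the
-- origin.
omit h0 h1 in
lemma eventually_periodic_of_limitWord {T : ℤ} (h : ∀ t, IsLimitWord w t → t T = t 0) :
    ∀ᶠ n in atTop, w (n + T) = w n := by
  by_contra hh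
  obtain ⟨U, t, hU, hP⟩ := exists_isLimitAlong_of_frequently hw (not_eventually.1 hh)
  obtain ⟨n, hn, h1, h2⟩ := (hP.and ((hU.2 T).and (hU.2 0))).exists
  rw [add_zero] at h2
  exact hn (by rw [h1, h2, h t ⟨U, hU⟩])

-- Take the limit along the multiples of the period: far out, all these translates agree with the
-- word itself.
omit h0 h1 in
lemma exists_limitWord_of_periodic {T : ℕ} (hT : 0 < T) (h : ∀ᶠ n in atTop, w (n + T) = w n) :
    ∃ t, IsLimitWord w t ∧ ∀ᶠ n in atTop, w n = t n := by
  have hT' : (0 : ℤ) < T := by exact_mod_cast hT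
  have hmul : Tendsto (fun k : ℕ => (k : ℤ) * T) atTop atTop :=
    tendsto_natCast_atTop_atTop.atTop_mul_const' hT'
  obtain ⟨U, t, hU, hUt⟩ := exists_isLimitAlong hw (map (fun k : ℕ => (k : ℤ) * T) atTop) hmul
  refine ⟨t, ⟨U, hUt⟩, ?_⟩
  obtain ⟨N, hN⟩ := eventually_atTop.1 h
  filter_upwards [eventually_ge_atTop N] with i hi
  have hper : ∀ k : ℕ, w (k * T + i) = w i := fun k => by
    induction k with
    | zero => simp
    | succ k ih =>
      rw [← ih, ← hN (k * T + i) (by nlinarith)]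
      congr 1; push_cast; ring
  have hr : ∀ᶠ n in (U : Filter ℤ), w (n + i) = w i :=
    hU (eventually_map.2 (Eventually.of_forall hper))
  obtain ⟨n, e1, e2⟩ := (hr.and (hUt.2 i)).exists
  rw [← e1, e2]

end

section

variable {β : ℝ} (h0 : 0 < β) (h1 : β < 1) {p q : ℕ} (hq : 1 ≤ q) (hpq : p.Coprime q) (a : ℤ)
include h0 h1 hq hpq

omit h0 h1 hq in
lemma exists_dvd_mul_add : ∃ n : ℤ, (q : ℤ) ∣ n * p + a := by
  obtain ⟨u, v, huv⟩ := Nat.isCoprime_iff_coprime.2 hpq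
  exact ⟨-(a * u), a * v, by linear_combination (-a) * huv⟩

lemma limsupPhi_mechWord : limsupPhi β (mechWord p q a) = gapVal β q := by
  have hq0 : (0 : ℤ) < q := by omega
  have hb := bddWord_mechWord (p := p) hq a
  refine le_antisymm (limsup_le_of_le isCobounded_abs_Phi
    (Eventually.of_forall fun n => abs_Phi_mechWord_le h0 h1 hq a n)) ?_
  refine le_limsup_of_frequently_le ?_ (isBounded_abs_Phi h0 h1 hb)
  obtain ⟨n, hn⟩ := exists_dvd_mul_add hpq a
  have : ∃ᶠ m : ℤ in atTop, gapVal β q ≤ |Phi β (mechWord p q a) m| := by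
    refine frequently_atTop.2 fun N => ⟨n + |N - n| * q, ?_, ?_⟩
    · have := le_abs_self (N - n)
      nlinarith [abs_nonneg (N - n)]
    · rw [Phi_mechWord_eq h0 h1 hq a hpq, abs_neg]
      · exact le_abs_self _
      · rw [show (n + |N - n| * q) * (p : ℤ) + a = n * p + a + |N - n| * p * q by ring]
        exact dvd_add hn (dvd_mul_left _ _)
  rw [← Nat.map_cast_int_atTop, frequently_map] at this
  exact this

end

/-! ### Classification of words with small limit superior -/

section

variable {β : ℝ} (h0 : 0 < β) (h1 : β < 1 / 3) {w : ℤ → ℤ} (hw : BddWord w)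
  (hw1 : ∀ᶠ n in atTop, |w n| ≤ 1)
include h0 h1 hw hw1

lemma exists_balancedSum_of_isLimitWord (h : limsupPhi β w ≤ 1 - β) {t : ℤ → ℤ}
    (ht : IsLimitWord w t) :
    ∃ S : ℤ → ℤ, BalancedSum S ∧ (∀ n, S (n + 1) - S n = 0 ∨ S (n + 1) - S n = 1) ∧
      ∀ n, t n = S (n + 1) - 2 * S n + S (n - 1) := by
  refine exists_balancedSum_of_Phi_le h0 h1 ?_ ((limsupPhi_le_iff h0 (by linarith) hw).1 h t ht)
  obtain ⟨U, hU⟩ := ht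
  exact hU.bounded hw1

/-- Words with limit superior below the critical value are eventually periodic. -/
theorem exists_mechWord_of_limsupPhi_lt (h : limsupPhi β w < 1 - β) :
    ∃ (p q : ℕ) (a : ℤ), 1 ≤ q ∧ p ≤ q ∧ p.Coprime q ∧ ∀ᶠ n in atTop, w n = mechWord p q a n := by
  have hl1 : β < 1 := by linarith
  obtain ⟨δ, hδ⟩ : ∃ δ, δ = 1 - β - limsupPhi β w := ⟨_, rfl⟩
  have hδ0 : 0 < δ := by linarith
  have hlim : ∀ t, IsLimitWord w t → ∃ (p q : ℕ) (a : ℤ), 1 ≤ q ∧ p ≤ q ∧ p.Coprime q ∧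
      t = mechWord p q a ∧ δ ≤ β ^ (q - 1) := by
    intro t ht
    obtain ⟨S, hS, hstep, htS⟩ := exists_balancedSum_of_isLimitWord h0 h1 hw hw1 h.le ht
    have hP : ∀ n, |Phi β t n| ≤ 1 - β - δ :=
      (limsupPhi_le_iff h0 hl1 hw).1 (by linarith) t ht
    obtain ⟨K, hK⟩ := hS.exists_nonneg h0 hl1 htS hδ0 hP
    obtain ⟨p, q, hq, hpq, hcop, n₀, hn₀⟩ := hS.exists_christoffel hstep hK
    have et : t = mechWord p q (-(n₀ * p)) := by
      funext n
      have e : ∀ m : ℤ, S m = S n₀ + (m * p + -(n₀ * p)) / q := fun m => by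
        have := hn₀ (m - n₀)
        rw [show n₀ + (m - n₀) = m by ring, show (m - n₀) * (p : ℤ) = m * p + -(n₀ * p) by ring]
          at this
        exact this
      rw [htS, e (n + 1), e n, e (n - 1), mechWord]; ring
    refine ⟨p, q, _, hq, hpq, hcop, et, ?_⟩
    obtain ⟨n, hn⟩ := exists_dvd_mul_add hcop (-(n₀ * p))
    refine le_pow_of_gapVal_le h0 hl1 hq ?_
    have := hP n
    rw [et, Phi_mechWord_eq h0 hl1 hq _ hcop hn, abs_neg] at this
    exact (le_abs_self _).trans this
  -- All limit words have periods at most `Q`, hence the common period `Q!`, which the word itself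
  -- then inherits far out.
  obtain ⟨Q, hQ⟩ := exists_pow_lt_of_lt_one hδ0 hl1
  have hper : ∀ᶠ n in atTop, w (n + (Q.factorial : ℕ)) = w n := by
    refine eventually_periodic_of_limitWord hw fun t ht => ?_
    obtain ⟨p, q, a, hq, -, -, rfl, hle⟩ := hlim t ht
    have hqQ : q ≤ Q := by
      by_contra! hh
      have := pow_le_pow_of_le_one h0.le hl1.le (by omega : Q ≤ q - 1)
      linarith
    obtain ⟨k, hk⟩ := Nat.dvd_factorial hq hqQ
    rw [hk]
    have := mechWord_add_period (p := p) hq a 0 k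
    rw [← this]; congr 1; push_cast; ring
  obtain ⟨t, ht, hwt⟩ := exists_limitWord_of_periodic hw Q.factorial_pos hper
  obtain ⟨p, q, a, hq, hpq, hcop, rfl, -⟩ := hlim t ht
  exact ⟨p, q, a, hq, hpq, hcop, hwt⟩

end

/-! ### Factors of infinite words -/

lemma map_range'_infix {A : Type} (f : ℕ → A) {a n i l : ℕ} (h1 : a ≤ i) (h2 : i + l ≤ a + n) :
    (List.range' i l).map f <:+: (List.range' a n).map f := by
  refine ⟨(List.range' a (i - a)).map f, (List.range' (i + l) (a + n - (i + l))).map f, ?_⟩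
  rw [← List.map_append, ← List.map_append]
  congr 1
  have e1 : List.range' a (i - a) ++ List.range' i l = List.range' a (i - a + l) := by
    have := List.range'_append_1 (s := a) (m := i - a) (n := l)
    rwa [show a + (i - a) = i by omega] at this
  rw [e1]
  have := List.range'_append_1 (s := a) (m := i - a + l) (n := a + n - (i + l))
  rw [show a + (i - a + l) = i + l by omega] at this
  rw [this]; congr 1; omega

lemma exists_of_infix_map_range' {A : Type} (f : ℕ → A) {a n : ℕ} {u : List A}
    (h : u <:+: (List.range' a n).map f) :
    ∃ i, i + u.length ≤ n ∧ u = (List.range' (a + i) u.length).map f := by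
  obtain ⟨s, t, hst⟩ := h
  have hlen := congrArg List.length hst
  simp only [List.length_append, List.length_map, List.length_range'] at hlen
  refine ⟨s.length, by omega, ?_⟩
  have e : u = (((List.range' a n).map f).drop s.length).take u.length := by
    rw [← hst]; simp
  conv_lhs => rw [e]
  rw [← List.map_drop, ← List.map_take, List.drop_range', mul_one]
  congr 1
  have := List.range'_append_1 (s := a + s.length) (m := u.length) (n := n - s.length - u.length)
  rw [show u.length + (n - s.length - u.length) = n - s.length by omega] at this
  rw [← this, List.take_append_of_le_length (by simp), List.take_of_length_le (by simp)]

lemma window_eq {A : Type} (y : ℕ → A) (i j : ℕ) :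
    window y i j = (List.range' i (j + 1 - i)).map y := rfl

lemma eventuallyLocally_iff {A : Type} {P : List A → Prop} (hP : ∀ u v, u <:+: v → P v → P u)
    (y : ℕ → A) :
    EventuallyLocally P y ↔ ∀ K : ℕ, ∀ᶠ m in atTop, P (window y (m - K) (m + K)) := by
  constructor
  · rintro ⟨m₀, q, hq, h⟩ K
    filter_upwards [hq.eventually_ge_atTop K, eventually_ge_atTop m₀] with m hm hm0
    refine hP _ _ ?_ (h m hm0)
    rw [window_eq, window_eq]
    exact map_range'_infix y (by omega) (by omega)
  · intro h
    classical
    set Q : ℕ → ℕ → Prop := fun m K => ∀ m' ≥ m, P (window y (m' - K) (m' + K)) with hQ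
    have hQe : ∀ K, ∃ M, ∀ m ≥ M, Q m K := fun K => by
      obtain ⟨M, hM⟩ := eventually_atTop.1 (h K)
      exact ⟨M, fun m hm m' hm' => hM m' (by omega)⟩
    obtain ⟨M₀, hM₀⟩ := hQe 0
    -- Diagonal choice: the largest radius up to `m` that works at every later position.
    refine ⟨M₀, fun m => Nat.findGreatest (Q m) m, ?_, fun m hm => ?_⟩
    · refine tendsto_atTop.2 fun K => ?_
      obtain ⟨M, hM⟩ := hQe K
      filter_upwards [eventually_ge_atTop (max M K)] with m hm
      exact Nat.le_findGreatest (le_of_max_le_right hm) (hM m (le_of_max_le_left hm))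
    · exact Nat.findGreatest_spec (P := Q m) (Nat.zero_le m) (hM₀ m hm) m le_rfl

lemma BalancedWord.infix {u v : List Bool} (h : u <:+: v) (hv : BalancedWord v) :
    BalancedWord u :=
  fun a b ha hb hl => hv a b (ha.trans h) (hb.trans h) hl

lemma SignedCodedBalanced.infix {u v : List ℤ} (h : u <:+: v) (hv : SignedCodedBalanced v) :
    SignedCodedBalanced u := by
  obtain ⟨x, hx, h1 | h1⟩ := hv
  · exact ⟨x, hx, Or.inl (h.trans h1)⟩
  · exact ⟨x, hx, Or.inr (h.trans h1)⟩

/-! ### The coding -/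

/-- The number of letters `1` among the first `i` letters. -/
def onesCount (y : ℕ → Bool) : ℕ → ℕ
  | 0 => 0
  | i + 1 => onesCount y i + (y i).toNat

/-- The position at which the image of the `i`-th letter starts. -/
def blockPos (y : ℕ → Bool) (i : ℕ) : ℕ := i + onesCount y i

lemma blockPos_succ (y : ℕ → Bool) (i : ℕ) :
    blockPos y (i + 1) = blockPos y i + 1 + (y i).toNat := by
  simp only [blockPos, onesCount]; ring

lemma onesCount_mono (y : ℕ → Bool) : Monotone (onesCount y) :=
  monotone_nat_of_le_succ fun _ => Nat.le_add_right _ _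

lemma blockPos_strictMono (y : ℕ → Bool) : StrictMono (blockPos y) :=
  strictMono_nat_of_lt_succ fun i => by rw [blockPos_succ]; omega

lemma count_map_range' (y : ℕ → Bool) (i l : ℕ) :
    onesCount y i + ((List.range' i l).map y).count true = onesCount y (i + l) := by
  induction l with
  | zero => simp
  | succ l ih =>
    rw [List.range'_1_concat, List.map_append, List.count_append, ← add_assoc, ih, ← add_assoc,
      onesCount]
    cases h : y (i + l) <;> simp [h]

lemma balancedWord_map_range'_iff (y : ℕ → Bool) (a n : ℕ) :
    BalancedWord ((List.range' a n).map y) ↔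
      ∀ i j l, a ≤ i → a ≤ j → i + l ≤ a + n → j + l ≤ a + n →
        onesCount y (i + l) + onesCount y j ≤ onesCount y (j + l) + onesCount y i + 1 := by
  constructor
  · intro h i j l hi hj hil hjl
    have := h _ _ (map_range'_infix y hi hil) (map_range'_infix y hj hjl) (by simp)
    have e1 := count_map_range' y i l
    have e2 := count_map_range' y j l
    omega
  · intro h u v hu hv hl
    obtain ⟨i, hi, hu⟩ := exists_of_infix_map_range' y hu
    obtain ⟨j, hj, hv⟩ := exists_of_infix_map_range' y hv
    have := h (a + i) (a + j) u.length (by omega) (by omega) (by omega) (by omega)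
    have e1 := count_map_range' y (a + i) u.length
    have e2 := count_map_range' y (a + j) u.length
    rw [← hu] at e1
    rw [hl, ← hv] at e2
    rw [hl] at e1 this
    omega

lemma gam_append (u v : List Bool) : gam (u ++ v) = gam u ++ gam v := by simp [gam]

lemma gam_map_range'_succ (y : ℕ → Bool) (a n : ℕ) :
    gam ((List.range' a (n + 1)).map y) =
      gam ((List.range' a n).map y) ++ (if y (a + n) then [1, -1] else [0]) := by
  rw [List.range'_1_concat, List.map_append, gam_append]
  simp [gam]

lemma length_gam_map_range' (y : ℕ → Bool) (a n : ℕ) :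
    (gam ((List.range' a n).map y)).length + blockPos y a = blockPos y (a + n) := by
  induction n with
  | zero => simp [gam]
  | succ n ih =>
    rw [gam_map_range'_succ, List.length_append, ← add_assoc, blockPos_succ]
    cases h : y (a + n) <;> simp <;> omega

lemma gamSeq_eq_getD (y : ℕ → Bool) {n i : ℕ} (h : n < blockPos y i) :
    gamSeq y n = (gam ((List.range' 0 i).map y)).getD n 0 := by
  have hlen : ∀ j, (gam ((List.range' 0 j).map y)).length = blockPos y j := fun j => by
    have := length_gam_map_range' y 0 j
    simpa [blockPos, onesCount] using this
  have key : ∀ i d, n < blockPos y i → (gam ((List.range' 0 (i + d)).map y)).getD n 0 =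
      (gam ((List.range' 0 i).map y)).getD n 0 := fun i d hi => by
    induction d with
    | zero => rfl
    | succ d ih =>
      rw [← add_assoc, gam_map_range'_succ, List.getD_append, ih]
      rw [hlen]
      exact hi.trans_le ((blockPos_strictMono y).monotone (by omega))
  have e : gamSeq y n = (gam ((List.range' 0 (n + 1)).map y)).getD n 0 := rfl
  rw [e, ← key (n + 1) i (by rw [blockPos]; omega), ← key i (n + 1) h, add_comm]

lemma gamSeq_blockPos (y : ℕ → Bool) (i : ℕ) :
    gamSeq y (blockPos y i) = if y i then 1 else 0 := by
  rw [gamSeq_eq_getD y (blockPos_strictMono y (Nat.lt_succ_self i)), gam_map_range'_succ]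
  have := length_gam_map_range' y 0 i
  rw [List.getD_append_right _ _ _ _ (by simp [blockPos, onesCount] at this ⊢; omega)]
  simp only [zero_add, blockPos, onesCount] at this ⊢
  rw [← this]
  cases h : y i <;> simp

lemma gamSeq_blockPos_succ (y : ℕ → Bool) {i : ℕ} (hi : y i = true) :
    gamSeq y (blockPos y i + 1) = -1 := by
  have hlt : blockPos y i + 1 < blockPos y (i + 1) := by rw [blockPos_succ, hi]; simp
  rw [gamSeq_eq_getD y hlt, gam_map_range'_succ]
  have := length_gam_map_range' y 0 i
  rw [List.getD_append_right _ _ _ _ (by simp [blockPos, onesCount] at this ⊢; omega)]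
  simp only [zero_add, blockPos, onesCount] at this ⊢
  rw [← this]
  simp [hi]

lemma exists_blockPos (y : ℕ → Bool) (n : ℕ) :
    ∃ i, n = blockPos y i ∨ (y i = true ∧ n = blockPos y i + 1) := by
  induction n with
  | zero => exact ⟨0, Or.inl rfl⟩
  | succ n ih =>
    obtain ⟨i, rfl | ⟨hi, rfl⟩⟩ := ih
    · by_cases h : y i = true
      · exact ⟨i, Or.inr ⟨h, rfl⟩⟩
      · exact ⟨i + 1, Or.inl (by rw [blockPos_succ]; simp [h])⟩
    · exact ⟨i + 1, Or.inl (by rw [blockPos_succ, hi]; simp)⟩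

lemma gam_map_range' (y : ℕ → Bool) (a n : ℕ) : gam ((List.range' a n).map y) =
    (List.range' (blockPos y a) (blockPos y (a + n) - blockPos y a)).map (gamSeq y) := by
  induction n with
  | zero => simp [gam]
  | succ n ih =>
    have hm := (blockPos_strictMono y).monotone (Nat.le_add_right a n)
    rw [gam_map_range'_succ, ih, ← add_assoc, blockPos_succ]
    cases h : y (a + n)
    · rw [show blockPos y (a + n) + 1 + false.toNat - blockPos y a
        = blockPos y (a + n) - blockPos y a + 1 by simp; omega, List.range'_1_concat,
        List.map_append, Nat.add_sub_cancel' hm]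
      simp [gamSeq_blockPos, h]
    · rw [show blockPos y (a + n) + 1 + true.toNat - blockPos y a
        = blockPos y (a + n) - blockPos y a + 1 + 1 by simp; omega, List.range'_1_concat,
        List.range'_1_concat, List.map_append, List.map_append, ← add_assoc,
        Nat.add_sub_cancel' hm]
      simp [gamSeq_blockPos, h, gamSeq_blockPos_succ]

/-- A second primitive of the coded word. -/
def codeSum (y : ℕ → Bool) : ℕ → ℤ
  | 0 => 0
  | 1 => 0
  | n + 2 => 2 * codeSum y (n + 1) - codeSum y n + gamSeq y n

/-- The increments of `codeSum y` spell the image of `y` under `0 ↦ 0`, `1 ↦ 01`; each block starts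
with a zero increment. -/
lemma codeSum_blockPos (y : ℕ → Bool) (i : ℕ) :
    codeSum y (blockPos y i) = onesCount y i ∧ codeSum y (blockPos y i + 1) = onesCount y i := by
  induction i with
  | zero => exact ⟨rfl, rfl⟩
  | succ i ih =>
    have g := gamSeq_blockPos y i
    rw [blockPos_succ, onesCount]
    cases h : y i
    · simp only [h, Bool.toNat_false, add_zero] at g ⊢
      refine ⟨ih.2, ?_⟩
      rw [codeSum, ih.1, ih.2, g]; simp; ring
    · have g' := gamSeq_blockPos_succ y h
      simp only [h, Bool.toNat_true] at g ⊢
      have e : codeSum y (blockPos y i + 1 + 1) = onesCount y i + 1 := by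
        rw [codeSum, ih.1, ih.2, g]; simp; ring
      refine ⟨by rw [e]; simp, ?_⟩
      rw [codeSum, e, ih.2, g']; push_cast; ring

lemma gamSeq_eq_codeSum (y : ℕ → Bool) (n : ℕ) :
    gamSeq y n = codeSum y (n + 2) - 2 * codeSum y (n + 1) + codeSum y n := by
  rw [codeSum]; ring

lemma codeSum_eq {y : ℕ → Bool} {h : ℕ → ℤ} (h1 : ∀ i, h (blockPos y i) = onesCount y i)
    (h2 : ∀ i, h (blockPos y i + 1) = onesCount y i) (n : ℕ) : codeSum y n = h n := by
  obtain ⟨i, rfl | ⟨_, rfl⟩⟩ := exists_blockPos y n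
  · rw [(codeSum_blockPos y i).1, h1]
  · rw [(codeSum_blockPos y i).2, h2]

/-- The coding preserves balance. -/
lemma codeSum_balanced {y : ℕ → Bool} {N : ℕ} (hy : BalancedWord ((List.range' 0 N).map y))
    {a b l : ℕ} (ha : a + l ≤ blockPos y N) (hb : b + l ≤ blockPos y N) :
    codeSum y (a + l) - codeSum y a - (codeSum y (b + l) - codeSum y b) ≤ 1 := by
  rw [balancedWord_map_range'_iff] at hy
  -- Here `z = n - codeSum y n` is the number of blocks begun before position `n`. The second
  -- alternative is a position inside a block of `1`, whose increment is not yet counted.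
  have key : ∀ n ≤ blockPos y N, ∃ z : ℕ, (n : ℤ) = z + codeSum y n ∧ z ≤ N ∧
      ((onesCount y z : ℤ) = codeSum y n ∨
        (1 ≤ z ∧ (onesCount y (z - 1) : ℤ) = codeSum y n ∧
          (onesCount y z : ℤ) = codeSum y n + 1)) := by
    intro n hn
    obtain ⟨i, rfl | ⟨hi, rfl⟩⟩ := exists_blockPos y n
    · refine ⟨i, ?_, (blockPos_strictMono y).le_iff_le.1 hn, Or.inl (codeSum_blockPos y i).1.symm⟩
      rw [(codeSum_blockPos y i).1, blockPos]; push_cast; ring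
    · refine ⟨i + 1, ?_, (blockPos_strictMono y).lt_iff_lt.1 hn, Or.inr ⟨by omega, ?_, ?_⟩⟩
      · rw [(codeSum_blockPos y i).2, blockPos]; push_cast; ring
      · rw [(codeSum_blockPos y i).2]; rfl
      · rw [(codeSum_blockPos y i).2, onesCount, hi]; simp
  by_contra! hcon
  obtain ⟨z1, e1, n1, c1⟩ := key a (by omega)
  obtain ⟨z2, e2, n2, c2⟩ := key (a + l) ha
  obtain ⟨z3, e3, n3, c3⟩ := key b (by omega)
  obtain ⟨z4, e4, n4, c4⟩ := key (b + l) hb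
  push_cast at e2 e4
  obtain ⟨u, hu, hu', hu''⟩ : ∃ u : ℕ, (onesCount y u : ℤ) = codeSum y a ∧ (z1 : ℤ) - 1 ≤ u ∧
      u ≤ N := by
    rcases c1 with c1 | ⟨_, c1, _⟩
    · exact ⟨z1, c1, by omega, n1⟩
    · exact ⟨z1 - 1, c1, by omega, by omega⟩
  obtain ⟨v, hv, hv', hv''⟩ : ∃ v : ℕ, (onesCount y v : ℤ) = codeSum y (b + l) ∧
      (z4 : ℤ) - 1 ≤ v ∧ v ≤ N := by
    rcases c4 with c4 | ⟨_, c4, _⟩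
    · exact ⟨z4, c4, by omega, n4⟩
    · exact ⟨z4 - 1, c4, by omega, by omega⟩
  have hmono : codeSum y b ≤ codeSum y (b + l) + 1 := by
    have : onesCount y z3 ≤ onesCount y z4 ∨ z4 < z3 := by
      rcases le_or_gt z3 z4 with h | h
      · exact Or.inl (onesCount_mono y h)
      · exact Or.inr h
    omega
  have huz : u < z2 := by
    by_contra! hh
    have := onesCount_mono y hh
    omega
  -- A window with two more ones in the same length meets two fewer blocks. So even after extension
  -- by the possibly cut first block its factor of `y` fits, in length, inside the complete part of
  -- the other one, and balance of `y` is violated.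
  have hB := hy u z3 (z2 - u) (by omega) (by omega) (by omega) (by omega)
  have hM := onesCount_mono y (show z3 + (z2 - u) ≤ v by omega)
  rw [show u + (z2 - u) = z2 by omega] at hB
  omega

/-- The letter `-1` marks exactly the second positions of blocks, so a period of the coded word
carries block starts to block starts and descends to `y`. -/
lemma eventuallyPeriodic_of_gamSeq {y : ℕ → Bool} (h : EventuallyPeriodic (gamSeq y)) :
    EventuallyPeriodic y := by
  obtain ⟨N, T, hT, h⟩ := h
  have hge : ∀ i, i ≤ blockPos y i := fun i => Nat.le_add_right _ _
  have hdet : ∀ i n, n = blockPos y i + T → N ≤ i → ∃ j, n = blockPos y j := fun i n hn hi => by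
    obtain ⟨j, hj | ⟨hj, hj'⟩⟩ := exists_blockPos y n
    · exact ⟨j, hj⟩
    · exfalso
      have a := gamSeq_blockPos_succ y hj
      rw [← hj', hn, h _ (hi.trans (hge i)), gamSeq_blockPos] at a
      split_ifs at a
  obtain ⟨j, hj⟩ := hdet N _ rfl le_rfl
  have hNj : N < j := (blockPos_strictMono y).lt_iff_lt.1 (by omega)
  have key : ∀ i, N ≤ i → blockPos y (i + (j - N)) = blockPos y i + T → y (i + (j - N)) = y i := by
    intro i hi e
    have a := gamSeq_blockPos y (i + (j - N))
    rw [e, h _ (hi.trans (hge i)), gamSeq_blockPos] at a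
    cases h1 : y (i + (j - N)) <;> cases h2 : y i <;> simp [h1, h2] at a ⊢
  have hpos : ∀ d, blockPos y (N + d + (j - N)) = blockPos y (N + d) + T := fun d => by
    induction d with
    | zero => rw [add_zero, hj]; congr 1; omega
    | succ d ih =>
      have := key (N + d) (by omega) ih
      rw [show N + (d + 1) + (j - N) = N + d + (j - N) + 1 by ring, ← add_assoc, blockPos_succ,
        blockPos_succ, this, ih]
      ring
  refine ⟨N, j - N, by omega, fun i hi => key i hi ?_⟩
  have := hpos (i - N)
  rwa [show N + (i - N) = i by omega] at this

/-! ### Local properties and limit words -/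

/-- The factor of a bi-infinite word at the positions `-K, …, K`. -/
def centralFactor (t : ℤ → ℤ) (K : ℕ) : List ℤ :=
  (List.range' 0 (2 * K + 1)).map fun j : ℕ => t (j - K)

lemma map_natCast_add_one_atTop : map (fun m : ℕ => (m : ℤ) + 1) atTop = atTop := by
  rw [← Function.comp_def (fun n : ℤ => n + 1) (fun m : ℕ => (m : ℤ)), ← Filter.map_map,
    Nat.map_cast_int_atTop, map_add_atTop_eq]

lemma padZero_succ (s : ℕ → ℤ) (n : ℕ) : padZero s (n + 1) = s n := by
  rw [padZero, if_neg (by omega)]; congr 1; omega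

lemma window_eq_centralFactor (s : ℕ → ℤ) {m K : ℕ} (h : K ≤ m) :
    window s (m - K) (m + K) = centralFactor (fun i => padZero s (m + 1 + i)) K := by
  rw [window_eq, centralFactor]
  refine List.ext_getElem (by simp; omega) fun j h1 h2 => ?_
  simp only [List.getElem_map, List.getElem_range']
  rw [show (m : ℤ) + 1 + ((0 + 1 * j : ℕ) - K) = ((m - K + 1 * j : ℕ) : ℤ) + 1 by omega,
    padZero_succ]

lemma centralFactor_congr {t t' : ℤ → ℤ} {K : ℕ} (h : ∀ i : ℤ, |i| ≤ K → t i = t' i) :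
    centralFactor t K = centralFactor t' K := by
  refine List.map_congr_left fun j hj => h _ ?_
  rw [List.mem_range'_1] at hj
  rw [abs_le]; omega

lemma IsLimitAlong.eventually_eq {U w t} (h : IsLimitAlong U w t) (K : ℕ) :
    ∀ᶠ n in (U : Filter ℤ), ∀ i : ℤ, |i| ≤ K → w (n + i) = t i := by
  have : ∀ᶠ n in (U : Filter ℤ), ∀ i ∈ Finset.Icc (-(K : ℤ)) K, w (n + i) = t i :=
    (Filter.eventually_all_finset _).2 fun i _ => h.2 i
  filter_upwards [this] with n hn i hi
  exact hn i (Finset.mem_Icc.2 (abs_le.1 hi))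

/-- Every fixed radius involves finitely many letters, so a factor-closed local property can be
tested on limit words. -/
lemma eventuallyLocally_iff_limitWord {s : ℕ → ℤ} (hs : BddWord (padZero s)) {P : List ℤ → Prop}
    (hP : ∀ u v, u <:+: v → P v → P u) :
    EventuallyLocally P s ↔ ∀ t, IsLimitWord (padZero s) t → ∀ K, P (centralFactor t K) := by
  rw [eventuallyLocally_iff hP]
  have hconv : ∀ K : ℕ, (∀ᶠ m : ℕ in atTop, P (window s (m - K) (m + K))) ↔
      ∀ᶠ n : ℤ in atTop, P (centralFactor (fun i => padZero s (n + i)) K) := fun K => by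
    rw [← map_natCast_add_one_atTop, eventually_map]
    refine eventually_congr ?_
    filter_upwards [eventually_ge_atTop K] with m hm
    rw [window_eq_centralFactor s hm]
  simp only [hconv]
  constructor
  · rintro h t ⟨U, hU⟩ K
    have hK : ∀ᶠ n in (U : Filter ℤ), P (centralFactor (fun i => padZero s (n + i)) K) :=
      hU.1 (h K)
    obtain ⟨n, h1, h2⟩ := (hK.and (hU.eventually_eq K)).exists
    rwa [← centralFactor_congr h2]
  · intro h K
    by_contra hh
    obtain ⟨U, t, hU, hP'⟩ := exists_isLimitAlong_of_frequently hs (not_eventually.1 hh)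
    obtain ⟨n, h1, h2⟩ := (hP'.and (hU.eventually_eq K)).exists
    refine h1 ?_
    rw [centralFactor_congr h2]
    exact h t ⟨U, hU⟩ K

/-! ### Coded balanced factors have small sums -/

/-- Vanishing second differences make `D` affine on `[-i, i]`. -/
lemma add_neg_eq_two_mul {D : ℤ → ℤ} {i : ℕ}
    (h : ∀ k : ℤ, |k| < i → D (k + 1) - 2 * D k + D (k - 1) = 0) : D i + D (-i) = 2 * D 0 := by
  have key : ∀ j : ℕ, j < i → D j + D (-j) = 2 * D 0 ∧ D (j + 1) + D (-(j + 1)) = 2 * D 0 := by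
    intro j
    induction j with
    | zero =>
      intro hj
      have := h 0 (by simpa using hj)
      simp at this ⊢
      constructor <;> linarith
    | succ j ih =>
      intro hj
      have a := ih (by omega)
      have b := h (j + 1) (by rw [abs_lt]; omega)
      have c := h (-(j + 1)) (by rw [abs_lt]; omega)
      rw [show -((j : ℤ) + 1) + 1 = -j by ring] at c
      rw [show (j : ℤ) + 1 - 1 = j by ring] at b
      push_cast
      rw [show -((j : ℤ) + 1 + 1) = -(j + 1) - 1 by ring]
      exact ⟨a.2, by linarith [a.1, a.2]⟩
  rcases Nat.eq_zero_or_pos i with rfl | hi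
  · simp; ring
  · have := (key (i - 1) (by omega)).2
    rwa [show ((i - 1 : ℕ) : ℤ) + 1 = i by omega] at this

lemma exists_second_primitive (t : ℤ → ℤ) :
    ∃ S : ℤ → ℤ, ∀ n, t n = S (n + 1) - 2 * S n + S (n - 1) := by
  obtain ⟨C, hC⟩ := exists_primitive t
  obtain ⟨S, hS⟩ := exists_primitive C
  refine ⟨fun n => S (n + 1), fun n => ?_⟩
  have a := hC n
  have b := hS (n + 1)
  have c := hS n
  beta_reduce
  rw [sub_add_cancel]
  linarith

lemma eq_map_range' (x : List Bool) :
    x = (List.range' 0 x.length).map fun i => x.getD i false := by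
  refine List.ext_getElem (by simp) fun j h1 h2 => ?_
  simp [h1]

lemma blockPos_zero (y : ℕ → Bool) : blockPos y 0 = 0 := rfl

/-- Coded balanced words are signed factors of coded infinite words. -/
lemma SignedCodedBalanced.exists_eq {n : ℕ} {f : ℕ → ℤ}
    (h : SignedCodedBalanced ((List.range' 0 n).map f)) :
    ∃ (σ : ℤ) (y : ℕ → Bool) (N o : ℕ), (σ = 1 ∨ σ = -1) ∧
      BalancedWord ((List.range' 0 N).map y) ∧ o + n ≤ blockPos y N ∧
      ∀ j < n, f j = σ * gamSeq y (o + j) := by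
  obtain ⟨x, hx, h⟩ := h
  set y : ℕ → Bool := fun i => x.getD i false
  rw [eq_map_range' x] at hx h
  rw [gam_map_range', blockPos_zero, zero_add, Nat.sub_zero, List.map_map] at h
  rcases h with h | h
  · obtain ⟨o, h1, h2⟩ := exists_of_infix_map_range' _ h
    simp only [List.length_map, List.length_range'] at h1 h2
    refine ⟨1, y, x.length, o, Or.inl rfl, hx, h1, fun j hj => ?_⟩
    have := congrArg (fun l => l[j]?) h2
    simpa [hj, y] using this
  · obtain ⟨o, h1, h2⟩ := exists_of_infix_map_range' _ h
    simp only [List.length_map, List.length_range'] at h1 h2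
    refine ⟨-1, y, x.length, o, Or.inr rfl, hx, h1, fun j hj => ?_⟩
    have := congrArg (fun l => l[j]?) h2
    simpa [hj, y] using this

/-- On the factor, `S` and a signed translate of `codeSum` have equal second differences and so
differ by an affine function, which the symmetric difference does not see; `codeSum_balanced` bounds
the rest. -/
lemma SignedCodedBalanced.abs_second_diff_le {t S : ℤ → ℤ}
    (htS : ∀ n, t n = S (n + 1) - 2 * S n + S (n - 1)) {i : ℕ}
    (h : SignedCodedBalanced (centralFactor t i)) : |S i - 2 * S 0 + S (-i)| ≤ 1 := by
  obtain ⟨σ, y, N, o, hσ, hy, ho, hf⟩ := h.exists_eq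
  have hD := add_neg_eq_two_mul (D := fun k => S k - σ * codeSum y (o + 1 + i + k).toNat) (i := i)
    fun k hk => by
      rw [abs_lt] at hk
      have a := hf (k + i).toNat (by omega)
      rw [show (((k + i).toNat : ℕ) : ℤ) - i = k by omega, htS, gamSeq_eq_codeSum] at a
      rw [show (o + 1 + i + (k + 1) : ℤ).toNat = o + (k + i).toNat + 2 by omega,
        show (o + 1 + i + k : ℤ).toNat = o + (k + i).toNat + 1 by omega,
        show (o + 1 + i + (k - 1) : ℤ).toNat = o + (k + i).toNat by omega]
      linear_combination a
  beta_reduce at hD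
  rw [show (o + 1 + i + (i : ℤ)).toNat = o + 1 + i + i by omega,
    show (o + 1 + i + 0 : ℤ).toNat = o + 1 + i by omega,
    show (o + 1 + i + -(i : ℤ)).toNat = o + 1 by omega] at hD
  have b1 := codeSum_balanced hy (a := o + 1 + i) (b := o + 1) (l := i) (by omega) (by omega)
  have b2 := codeSum_balanced hy (a := o + 1) (b := o + 1 + i) (l := i) (by omega) (by omega)
  rw [abs_le]
  rcases hσ with rfl | rfl <;> omega

section

variable {β : ℝ} (h0 : 0 < β) (h1 : β < 1)
include h0 h1

/-- The balanced word and the sign may vary with the radius; one second primitive of `t` serves all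
radii, as only its symmetric differences at `0` enter. -/
lemma abs_Phi_zero_le_of_centralFactor {t : ℤ → ℤ} (ht : BddWord t)
    (h : ∀ K, SignedCodedBalanced (centralFactor t K)) : |Phi β t 0| ≤ 1 - β := by
  obtain ⟨S, htS⟩ := exists_second_primitive t
  have hb := fun i => (h i).abs_second_diff_le htS
  rw [Phi_eq_second_primitive h0 h1 ht htS 0 fun i => by simpa using hb i, abs_mul,
    abs_of_nonneg (sq_nonneg _)]
  have := abs_tsum_geom_le h0 h1 (B := 1)
    (a := fun i : ℕ => ((S (0 + ((i : ℤ) + 1)) - 2 * S 0 + S (0 - ((i : ℤ) + 1)) : ℤ) : ℝ))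
    fun i => by
      have := hb (i + 1)
      push_cast at this
      rw [← Int.cast_abs]
      simp only [zero_add, zero_sub] at this ⊢
      exact_mod_cast this
  refine (mul_le_mul_of_nonneg_left this (sq_nonneg _)).trans_eq ?_
  have : 1 - β ≠ 0 := by linarith
  field_simp

lemma limsupPhi_le_of_eventuallyLocally {s : ℕ → ℤ} (hs : BddWord (padZero s))
    (h : EventuallyLocally SignedCodedBalanced s) : limsupPhi β (padZero s) ≤ 1 - β := by
  have hloc := (eventuallyLocally_iff_limitWord hs fun _ _ => SignedCodedBalanced.infix).1 h
  by_contra! hh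
  obtain ⟨c', h1', h2'⟩ := exists_between hh
  have hf : ∃ᶠ n : ℤ in atTop, c' < |Phi β (padZero s) n| := by
    rw [← Nat.map_cast_int_atTop, frequently_map]
    exact frequently_lt_of_lt_limsup isCobounded_abs_Phi h2'
  obtain ⟨U, t, hU, hP⟩ := exists_isLimitAlong_of_frequently hs hf
  have a := ge_of_tendsto (hU.tendsto_Phi h0 h1 hs 0).abs
    (hP.mono fun n hn => by rw [add_zero]; exact hn.le)
  have b := abs_Phi_zero_le_of_centralFactor h0 h1 (hU.bddWord hs) (hloc t ⟨U, hU⟩)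
  linarith

end

lemma eventually_abs_le_of_eventuallyLocally {s : ℕ → ℤ}
    (h : EventuallyLocally SignedCodedBalanced s) : ∀ᶠ n in atTop, |s n| ≤ 1 := by
  rw [eventuallyLocally_iff fun _ _ => SignedCodedBalanced.infix] at h
  filter_upwards [h 0] with m hm
  obtain ⟨x, -, hx⟩ := hm
  have hmem : s m ∈ window s (m - 0) (m + 0) := by simp [window]
  have hg : ∀ z ∈ gam x, |z| ≤ 1 := fun z hz => by
    simp only [gam, List.mem_flatMap] at hz
    obtain ⟨c, -, hc⟩ := hz
    cases c <;> simp at hc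
    · simp [hc]
    · rcases hc with rfl | rfl <;> simp
  rcases hx with hx | hx
  · exact hg _ (hx.subset hmem)
  · obtain ⟨z, hz, e⟩ := List.mem_map.1 (hx.subset hmem)
    rw [← e, abs_neg]; exact hg z hz

lemma bddWord_padZero {s : ℕ → ℤ} {B : ℤ} (h : ∀ᶠ n in atTop, |s n| ≤ B) :
    BddWord (padZero s) := by
  obtain ⟨N, hN⟩ := eventually_atTop.1 h
  refine ⟨|B| + ∑ k ∈ Finset.range N, |s k|, fun n => ?_⟩
  have hpos : 0 ≤ ∑ k ∈ Finset.range N, |s k| := Finset.sum_nonneg fun _ _ => abs_nonneg _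
  rw [padZero]
  split_ifs with hn
  · simpa using add_nonneg (abs_nonneg B) hpos
  · rcases le_or_gt N (n - 1).toNat with hk | hk
    · have := hN _ hk
      linarith [le_abs_self B]
    · have := Finset.single_le_sum (f := fun k => |s k|) (fun _ _ => abs_nonneg _)
        (Finset.mem_range.2 hk)
      linarith [abs_nonneg B]

lemma eventually_padZero_iff {s : ℕ → ℤ} {Q : ℤ → ℤ → Prop} :
    (∀ᶠ n : ℤ in atTop, Q n (padZero s n)) ↔ ∀ᶠ n : ℕ in atTop, Q (n + 1) (s n) := by
  rw [← map_natCast_add_one_atTop, eventually_map]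
  simp only [padZero_succ]

/-! ### Decoding balanced bi-infinite words -/

/-- The positions at which the blocks `0` and `10` start, reading rightwards from `a`. -/
def decodePos (S : ℤ → ℤ) (a : ℤ) : ℕ → ℤ
  | 0 => a
  | i + 1 => decodePos S a i + 1 + (S (decodePos S a i + 1) - S (decodePos S a i))

/-- The word obtained by decoding from position `a`. -/
def decodeWord (S : ℤ → ℤ) (a : ℤ) (i : ℕ) : Bool :=
  decide (S (decodePos S a i + 1) - S (decodePos S a i) = 1)

section

variable {S : ℤ → ℤ} (hstep : ∀ n, S (n + 1) - S n = 0 ∨ S (n + 1) - S n = 1)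
  (hno : ∀ n, ¬ (S (n + 1) - S n = 1 ∧ S (n + 1 + 1) - S (n + 1) = 1)) {a : ℤ}
  (ha : S a - S (a - 1) = 0)
include hstep

lemma toNat_decodeWord (a : ℤ) (i : ℕ) :
    ((decodeWord S a i).toNat : ℤ) = S (decodePos S a i + 1) - S (decodePos S a i) := by
  rcases hstep (decodePos S a i) with h | h <;> simp [decodeWord, h]

include hno ha

lemma decodePos_spec (i : ℕ) : decodePos S a i = a + blockPos (decodeWord S a) i ∧
    S (decodePos S a i) = S a + onesCount (decodeWord S a) i ∧
    S (decodePos S a i) - S (decodePos S a i - 1) = 0 := by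
  induction i with
  | zero => simp [decodePos, blockPos, onesCount, ha]
  | succ i ih =>
    obtain ⟨e1, e2, e3⟩ := ih
    have hw := toNat_decodeWord hstep a i
    have hd : decodePos S a (i + 1) =
      decodePos S a i + 1 + (S (decodePos S a i + 1) - S (decodePos S a i)) := rfl
    rw [blockPos_succ, onesCount]
    push_cast
    rcases hstep (decodePos S a i) with h | h
    · rw [h, add_zero] at hd
      rw [hd, hw, add_sub_cancel_right]
      refine ⟨by omega, by omega, by omega⟩
    · rw [h] at hd
      have h' := hstep (decodePos S a i + 1)
      have h'' := hno (decodePos S a i)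
      rw [hd, hw, add_sub_cancel_right]
      refine ⟨by omega, by omega, by omega⟩

/-- The increments from `a` on are a product of blocks `0` and `10`, each preceded by a zero
increment. Hence the second differences are `0` on the first kind and `1, -1` on the second. -/
lemma gamSeq_decodeWord (n : ℕ) :
    gamSeq (decodeWord S a) n = S (a + n + 1) - 2 * S (a + n) + S (a + n - 1) := by
  obtain ⟨i, rfl | ⟨hi, rfl⟩⟩ := exists_blockPos (decodeWord S a) n
  · obtain ⟨e1, -, e3⟩ := decodePos_spec hstep hno ha i
    rw [gamSeq_blockPos, ← e1]
    have hw := toNat_decodeWord hstep a i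
    cases h : decodeWord S a i <;> simp [h] at hw ⊢ <;> omega
  · obtain ⟨e1, -, e3⟩ := decodePos_spec hstep hno ha i
    have hw := toNat_decodeWord hstep a i
    rw [hi, Bool.toNat_true] at hw
    rw [gamSeq_blockPos_succ _ hi]
    push_cast
    rw [← add_assoc, ← e1, add_sub_cancel_right]
    have h' := hstep (decodePos S a i + 1)
    have h'' := hno (decodePos S a i)
    omega

lemma balancedWord_decodeWord (hS : BalancedSum S) (N : ℕ) :
    BalancedWord ((List.range' 0 N).map (decodeWord S a)) := by
  rw [balancedWord_map_range'_iff]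
  intro i j l _ _ _ _
  by_contra! hcon
  obtain ⟨i1, i2, -⟩ := decodePos_spec hstep hno ha i
  obtain ⟨j1, j2, j3⟩ := decodePos_spec hstep hno ha j
  obtain ⟨k1, k2, k3⟩ := decodePos_spec hstep hno ha (i + l)
  obtain ⟨m1, m2, -⟩ := decodePos_spec hstep hno ha (j + l)
  set y := decodeWord S a
  rw [blockPos] at i1 j1 k1 m1
  push_cast at i1 j1 k1 m1
  have hm := onesCount_mono y (Nat.le_add_right i l)
  have hm' := onesCount_mono y (Nat.le_add_right j l)
  -- Compare windows one letter longer than the light image. At `j` the added letter is the zero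
  -- before the block, while at `i` the heavy image is at least two letters longer and ends in a
  -- zero, so truncating it to this length still leaves an excess of two.
  have hb := hS (decodePos S a (j + l) - decodePos S a j + 1) (decodePos S a i)
    (decodePos S a j - 1) (by omega)
  rw [show decodePos S a j - 1 + (decodePos S a (j + l) - decodePos S a j + 1)
    = decodePos S a (j + l) by ring] at hb
  have hlip : ∀ (k : ℕ) (x : ℤ), S (x + k) ≤ S x + k := fun k x => by
    induction k with
    | zero => simp
    | succ k ih =>
      have := hstep (x + k)
      push_cast
      rw [← add_assoc]; omega
  have hl := hlip (decodePos S a (i + l) - 1 - (decodePos S a i +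
    (decodePos S a (j + l) - decodePos S a j + 1))).toNat
    (decodePos S a i + (decodePos S a (j + l) - decodePos S a j + 1))
  rw [Int.toNat_of_nonneg (by omega), add_sub_cancel] at hl
  omega

end

lemma signedCodedBalanced_centralFactor_of_isolated {S : ℤ → ℤ} (hS : BalancedSum S)
    (hstep : ∀ n, S (n + 1) - S n = 0 ∨ S (n + 1) - S n = 1)
    (hno : ∀ n, ¬ (S (n + 1) - S n = 1 ∧ S (n + 1 + 1) - S (n + 1) = 1)) (K : ℕ) :
    ∃ x, BalancedWord x ∧
      centralFactor (fun n => S (n + 1) - 2 * S n + S (n - 1)) K <:+: gam x := by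
  -- Ones are isolated, so one of the two increments before `-K` is zero and decoding can start
  -- there.
  obtain ⟨e, he, ha⟩ : ∃ e : ℕ, e ≤ 1 ∧ S (-K - e) - S (-K - e - 1) = 0 := by
    have h1 := hstep (-K - 1)
    have h2 := hstep (-K - 1 - 1)
    have h3 := hno (-K - 1 - 1)
    rw [sub_add_cancel] at h1 h2
    rw [sub_add_cancel, sub_add_cancel] at h3
    by_cases h : S (-(K : ℤ)) - S (-K - 1) = 0
    · exact ⟨0, by omega, by simpa using h⟩
    · exact ⟨1, le_rfl, by push_cast; omega⟩
  obtain ⟨y, hy⟩ : ∃ y, y = decodeWord S (-K - e) := ⟨_, rfl⟩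
  refine ⟨_, balancedWord_decodeWord hstep hno ha hS (2 * K + 2), ?_⟩
  have hN : 2 * K + 2 ≤ blockPos y (2 * K + 2) := Nat.le_add_right _ _
  rw [← hy, gam_map_range', blockPos_zero, zero_add, Nat.sub_zero]
  have e1 : centralFactor (fun n => S (n + 1) - 2 * S n + S (n - 1)) K =
      (List.range' e (2 * K + 1)).map (gamSeq y) := by
    rw [centralFactor]
    refine List.ext_getElem (by simp) fun j h1 h2 => ?_
    simp only [List.getElem_map, List.getElem_range']
    rw [hy, gamSeq_decodeWord hstep hno ha]
    push_cast
    rw [show -(K : ℤ) - e + (e + 1 * j) = 0 + 1 * j - K by ring]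
  rw [e1]
  exact map_range'_infix _ (by omega) (by omega)

/-- If `11` occurs among the increments, balance excludes `00`; then the complement `n - S n` has
isolated ones, and its second difference has the opposite sign. -/
lemma signedCodedBalanced_centralFactor {S t : ℤ → ℤ} (hS : BalancedSum S)
    (hstep : ∀ n, S (n + 1) - S n = 0 ∨ S (n + 1) - S n = 1)
    (htS : ∀ n, t n = S (n + 1) - 2 * S n + S (n - 1)) (K : ℕ) :
    SignedCodedBalanced (centralFactor t K) := by
  by_cases hno : ∀ n, ¬ (S (n + 1) - S n = 1 ∧ S (n + 1 + 1) - S (n + 1) = 1)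
  · obtain ⟨x, hx, h⟩ := signedCodedBalanced_centralFactor_of_isolated hS hstep hno K
    exact ⟨x, hx, Or.inl (by rw [funext htS]; exact h)⟩
  · push Not at hno
    obtain ⟨m, hm1, hm2⟩ := hno
    obtain ⟨x, hx, h⟩ := signedCodedBalanced_centralFactor_of_isolated (S := fun n => n - S n)
      (fun l i j hl => by have := hS l j i hl; beta_reduce; omega)
      (fun n => by have := hstep n; omega)
      (fun n => by
        rintro ⟨h1, h2⟩
        have := hS 2 m n (by norm_num)
        rw [show m + 2 = m + 1 + 1 by ring, show n + 2 = n + 1 + 1 by ring] at this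
        omega) K
    refine ⟨x, hx, Or.inr ?_⟩
    have e : centralFactor t K = (centralFactor (fun n => (n + 1 - S (n + 1)) - 2 * (n - S n) +
        (n - 1 - S (n - 1))) K).map fun a => -a := by
      rw [centralFactor, centralFactor, List.map_map]
      refine List.map_congr_left fun j _ => ?_
      simp only [htS, Function.comp]; ring
    rw [e]
    exact h.map _

/-- A word over `{-1,0,1}` with limit superior at most the critical value is eventually locally
the image of a balanced word. -/
theorem eventuallyLocally_of_limsupPhi_le {β : ℝ} (h0 : 0 < β) (h1 : β < 1 / 3) {s : ℕ → ℤ}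
    (hs : ∀ᶠ n in atTop, |s n| ≤ 1) (h : limsupPhi β (padZero s) ≤ 1 - β) :
    EventuallyLocally SignedCodedBalanced s := by
  have hb := bddWord_padZero hs
  rw [eventuallyLocally_iff_limitWord hb fun _ _ => SignedCodedBalanced.infix]
  intro t ht K
  obtain ⟨S, hS, hstep, htS⟩ := exists_balancedSum_of_isLimitWord h0 h1 hb
    (eventually_padZero_iff (Q := fun _ z => |z| ≤ 1).2 hs) h ht
  exact signedCodedBalanced_centralFactor hS hstep htS K

/-! ### Eventually balanced words -/

lemma eventuallyLocally_gamSeq {y : ℕ → Bool} (hy : EventuallyBalanced y) (k : ℕ) (σ : ℤ)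
    (hσ : σ = 1 ∨ σ = -1) :
    EventuallyLocally SignedCodedBalanced fun i => σ * gamSeq y (k + i) := by
  rw [eventuallyLocally_iff fun _ _ => SignedCodedBalanced.infix]
  rw [EventuallyBalanced, eventuallyLocally_iff fun _ _ => BalancedWord.infix] at hy
  intro K
  obtain ⟨M, hM⟩ := eventually_atTop.1 (hy K)
  -- Blocks have length at most two, so position `2M + 1` lies in a block of index at least `M`.
  -- Coding never shortens distances, so the same radius `K` suffices in `y`.
  filter_upwards [eventually_ge_atTop (2 * M + 1)] with m hm
  obtain ⟨i, hi⟩ := exists_blockPos y (k + m)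
  have hle : ∀ j, onesCount y j ≤ j := fun j => by
    induction j with
    | zero => simp [onesCount]
    | succ j ih => rw [onesCount]; have := Bool.toNat_le (y j); omega
  have hiM : M ≤ i := by
    have := hle i
    rcases hi with hi | ⟨_, hi⟩ <;> rw [blockPos] at hi <;> omega
  have hlip : ∀ d j, blockPos y j + d ≤ blockPos y (j + d) := fun d j => by
    have := onesCount_mono y (Nat.le_add_right j d)
    rw [blockPos, blockPos]; omega
  have hlo : blockPos y (i - K) ≤ k + (m - K) := by
    rcases le_or_gt K i with h | h
    · have := hlip K (i - K)
      rw [Nat.sub_add_cancel h] at this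
      rcases hi with hi | ⟨_, hi⟩ <;> omega
    · rw [Nat.sub_eq_zero_of_le h.le, blockPos_zero]; omega
  have hhi : k + (m + K) + 1 ≤ blockPos y (i + K + 1) := by
    rcases hi with hi | ⟨hy1, hi⟩
    · have := hlip (K + 1) i
      rw [show i + (K + 1) = i + K + 1 by ring] at this; omega
    · have := hlip K (i + 1)
      rw [blockPos_succ, hy1, Bool.toNat_true, show i + 1 + K = i + K + 1 by ring] at this
      omega
  refine ⟨_, hM i hiM, ?_⟩
  rw [window_eq, window_eq, gam_map_range', show i - K + (i + K + 1 - (i - K)) = i + K + 1 by omega,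
    List.map_map]
  have e : (List.range' (m - K) (m + K + 1 - (m - K))).map (fun i => σ * gamSeq y (k + i)) =
      (List.range' (k + (m - K)) (m + K + 1 - (m - K))).map (fun i => σ * gamSeq y i) := by
    refine List.ext_getElem (by simp) fun j h1 h2 => ?_
    simp only [List.getElem_map, List.getElem_range']
    rw [add_assoc]
  rw [e]
  rcases hσ with rfl | rfl
  · left
    simp only [one_mul]
    exact map_range'_infix _ hlo (by omega)
  · right
    simp only [neg_mul, one_mul]
    exact map_range'_infix (fun i => -gamSeq y i) hlo (by omega)

lemma not_eventuallyPeriodic_gamSeq {y : ℕ → Bool} (hy : ¬ EventuallyPeriodic y) (k : ℕ) (σ : ℤ)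
    (hσ : σ = 1 ∨ σ = -1) : ¬ EventuallyPeriodic fun i => σ * gamSeq y (k + i) := by
  rintro ⟨N, T, hT, h⟩
  refine hy (eventuallyPeriodic_of_gamSeq ⟨N + k, T, hT, fun n hn => ?_⟩)
  have := h (n - k) (by omega)
  beta_reduce at this
  rw [show k + (n - k + T) = n + T by omega, show k + (n - k) = n by omega] at this
  rcases hσ with rfl | rfl <;> linarith

/-! ### Christoffel words -/

lemma periodicWord_map_range {r : ℕ} {f : ℕ → Bool} (hr : 1 ≤ r) (hf : ∀ i, f (i + r) = f i) :
    periodicWord ((List.range r).map f) = f := by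
  funext i
  have hlt := Nat.mod_lt i hr
  rw [periodicWord]
  simp only [List.length_map, List.length_range]
  rw [List.getD_eq_getElem _ _ (by simpa using hlt)]
  simp only [List.getElem_map, List.getElem_range]
  exact Function.Periodic.map_mod_nat hf i

/-- The letters of the word of differences of `i ↦ ⌊(i p + e) / r⌋`. -/
def mechLetter (p r : ℕ) (e : ℤ) (i : ℕ) : Bool :=
  decide (((i + 1) * p + e) / r - (i * p + e) / r = 1)

lemma onesCount_mechLetter {p r : ℕ} {e : ℤ} (hpr : p ≤ r) (he : 0 ≤ e) (her : e < r) (i : ℕ) :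
    (onesCount (mechLetter p r e) i : ℤ) = (i * p + e) / r := by
  have hr0 : (0 : ℤ) < r := by omega
  induction i with
  | zero => simp [onesCount, Int.ediv_eq_zero_of_lt he her]
  | succ i ih =>
    rw [onesCount, Nat.cast_add, ih, mechLetter, Nat.cast_add, Nat.cast_one]
    have h1 : ((i : ℤ) * p + e) / r ≤ ((i + 1) * p + e) / r :=
      Int.ediv_le_ediv hr0 (by nlinarith)
    have h2 : (((i : ℤ) + 1) * p + e) / r ≤ ((i : ℤ) * p + e) / r + 1 := by
      rw [← Int.add_mul_ediv_right _ _ hr0.ne']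
      refine Int.ediv_le_ediv hr0 ?_
      have : (p : ℤ) ≤ r := by exact_mod_cast hpr
      linarith
    rcases (by omega : (((i : ℤ) + 1) * p + e) / r = ((i : ℤ) * p + e) / r ∨
      (((i : ℤ) + 1) * p + e) / r = ((i : ℤ) * p + e) / r + 1) with h | h <;> rw [h] <;> simp

lemma mechLetter_add {p r : ℕ} (hr : 1 ≤ r) (e : ℤ) (i : ℕ) :
    mechLetter p r e (i + r) = mechLetter p r e i := by
  have hr0 : (r : ℤ) ≠ 0 := by omega
  rw [mechLetter, mechLetter]
  push_cast
  rw [show ((i : ℤ) + r + 1) * p + e = (i + 1) * p + e + p * r by ring,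
    show ((i : ℤ) + r) * p + e = i * p + e + p * r by ring, Int.add_mul_ediv_right _ _ hr0,
    Int.add_mul_ediv_right _ _ hr0, add_sub_add_right_eq_sub]

/-- Coding changes slope `p/r` into `p/(p+r)`: for `k = ⌊(ip+e)/r⌋`, the inequalities `kr ≤ ip+e <
kr+r` give `⌊(np+e)/(p+r)⌋ = k` at both `n = i+k` and `n = i+k+1`. -/
lemma gamSeq_mechLetter {p r : ℕ} {e : ℤ} (hpr : p ≤ r) (he : 0 ≤ e) (her : e < r) (n : ℕ) :
    gamSeq (mechLetter p r e) n = mechWord p (p + r) e (n + 1) := by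
  have hr0 : (0 : ℤ) < r := by omega
  have hq0 : (0 : ℤ) < (p + r : ℕ) := by omega
  have hbd : ∀ i : ℕ, (onesCount (mechLetter p r e) i : ℤ) * r ≤ i * p + e ∧
      (i : ℤ) * p + e < onesCount (mechLetter p r e) i * r + r := fun i =>
    (Int.ediv_eq_iff_of_pos hr0).1 (onesCount_mechLetter hpr he her i).symm
  have hH : ∀ m : ℕ, codeSum (mechLetter p r e) m = ((m : ℤ) * p + e) / (p + r : ℕ) := by
    refine codeSum_eq (h := fun m : ℕ => ((m : ℤ) * p + e) / (p + r : ℕ)) (fun i => ?_) fun i => ?_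
    · rw [Int.ediv_eq_iff_of_pos hq0, blockPos]
      push_cast
      obtain ⟨h1, h2⟩ := hbd i
      constructor <;> linarith
    · rw [Int.ediv_eq_iff_of_pos hq0, blockPos]
      push_cast
      obtain ⟨h1, h2⟩ := hbd i
      constructor <;> linarith
  rw [gamSeq_eq_codeSum, hH, hH, hH, mechWord]
  push_cast
  rw [show (n : ℤ) + 1 + 1 = n + 2 by ring, show (n : ℤ) + 1 - 1 = n by ring]

lemma length_gam_mechLetter {p r : ℕ} {e : ℤ} (hr : 1 ≤ r) (hpr : p ≤ r) (he : 0 ≤ e)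
    (her : e < r) : (gam ((List.range r).map (mechLetter p r e))).length = p + r := by
  have h := length_gam_map_range' (mechLetter p r e) 0 r
  rw [← List.range_eq_range', blockPos_zero, zero_add, add_zero] at h
  rw [h, blockPos]
  have hr0 : (r : ℤ) ≠ 0 := by omega
  have := onesCount_mechLetter (p := p) hpr he her r
  rw [mul_comm, Int.add_comm, Int.add_mul_ediv_right _ _ hr0, Int.ediv_eq_zero_of_lt he her] at this
  omega

lemma lowerChristoffel_eq (p r : ℕ) :
    lowerChristoffel p r = (List.range r).map (mechLetter p r 0) := by
  refine List.map_congr_left fun i _ => ?_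
  have hfl : ∀ j : ℕ, ⌊(p * j : ℚ) / r⌋ = ((j : ℤ) * p + 0) / r := fun j => by
    have := Rat.floor_intCast_div_natCast ((j : ℤ) * p) r
    push_cast at this
    rw [mul_comm (p : ℚ), this, add_zero]
  have e1 := hfl i
  have e2 := hfl (i + 1)
  push_cast at e1 e2
  rw [e1, e2, mechLetter]

lemma upperChristoffel_eq {p r : ℕ} (hr : 1 ≤ r) :
    upperChristoffel p r = (List.range r).map (mechLetter p r (r - 1)) := by
  have hr0 : (0 : ℤ) < r := by omega
  refine List.map_congr_left fun i _ => ?_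
  have hfl : ∀ j : ℕ, ⌈(p * j : ℚ) / r⌉ = ((j : ℤ) * p + (r - 1)) / r := fun j => by
    have := Rat.ceil_intCast_div_natCast ((j : ℤ) * p) r
    push_cast at this
    rw [mul_comm (p : ℚ), this]
    symm
    rw [Int.ediv_eq_iff_of_pos hr0]
    have h := (Int.ediv_eq_iff_of_pos hr0).1 (rfl : -((j : ℤ) * p) / r = _)
    constructor <;> linarith [h.1, h.2]
  have e1 := hfl i
  have e2 := hfl (i + 1)
  push_cast at e1 e2
  rw [e1, e2, mechLetter]

/-- The coding of the periodic words of Christoffel words. -/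
lemma IsChristoffel.exists_mechWord {ν : List Bool} (h : IsChristoffel ν) :
    ∃ (p q : ℕ) (e : ℤ), 1 ≤ q ∧ p.Coprime q ∧ (gam ν).length = q ∧
      ∀ n : ℕ, gamSeq (periodicWord ν) n = mechWord p q e (n + 1) := by
  obtain ⟨p, r, hpr, hcop, h⟩ := h
  have hr : 1 ≤ r := by
    rcases Nat.eq_zero_or_pos r with rfl | h
    · obtain rfl : p = 0 := by omega
      simp at hcop
    · exact h
  have key : ∀ e : ℤ, 0 ≤ e → e < r → ν = (List.range r).map (mechLetter p r e) →
      ∃ (p q : ℕ) (e : ℤ), 1 ≤ q ∧ p.Coprime q ∧ (gam ν).length = q ∧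
      ∀ n : ℕ, gamSeq (periodicWord ν) n = mechWord p q e (n + 1) := by
    rintro e he her rfl
    refine ⟨p, p + r, e, by omega, by simpa using hcop, length_gam_mechLetter hr hpr he her,
      fun n => ?_⟩
    rw [periodicWord_map_range hr (mechLetter_add hr e), gamSeq_mechLetter hpr he her]
  rcases h with h | h
  · exact key 0 le_rfl (by omega) (h.trans (lowerChristoffel_eq p r))
  · exact key (r - 1) (by omega) (by omega) (h.trans (upperChristoffel_eq hr))

/-- Up to sign, the words `mechWord` are codings of Christoffel words. -/
lemma exists_christoffel_of_mechWord {p q : ℕ} (hq : 1 ≤ q) (hpq : p ≤ q) (hcop : p.Coprime q)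
    (a : ℤ) : ∃ (ν : List Bool) (σ : ℤ) (k : ℕ), IsChristoffel ν ∧ (gam ν).length = q ∧ k < q ∧
      (σ = 1 ∨ σ = -1) ∧
      ∀ n : ℕ, mechWord p q a (n + 1) = σ * gamSeq (periodicWord ν) (k + n) := by
  have hq0 : (0 : ℤ) < q := by omega
  -- a position at which the numerator is divisible by `q`
  obtain ⟨m, hm⟩ := exists_dvd_mul_add hcop a
  obtain ⟨z, hz⟩ := hm
  have hsh : ∀ n : ℤ, mechWord p q a (n + m) = mechWord p q 0 n := fun n => by
    simp only [mechWord]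
    rw [show (n + m + 1) * (p : ℤ) + a = (n + 1) * p + 0 + z * q by linarith,
      show (n + m) * (p : ℤ) + a = n * p + 0 + z * q by linarith,
      show (n + m - 1) * (p : ℤ) + a = (n - 1) * p + 0 + z * q by linarith]
    simp only [Int.add_mul_ediv_right _ _ hq0.ne']
    ring
  have hk0 := Int.emod_nonneg (-m) hq0.ne'
  have hk1 := Int.emod_lt_of_pos (-m) hq0
  have hkm : (-m) % q = -m - q * (-m / q) := Int.emod_def _ _
  obtain ⟨k, hk⟩ := Int.eq_ofNat_of_zero_le hk0
  have hshift : ∀ n : ℤ, mechWord p q a n = mechWord p q 0 (k + n) := fun n => by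
    have := mechWord_add_period (p := p) hq 0 (k + n) (-m / q)
    rw [← this, ← hsh]
    congr 1
    rw [hk] at hkm
    rw [hkm]; ring
  -- Up to slope `1/2` ones are isolated and a lower Christoffel word codes the word directly;
  -- beyond that the complement is coded, at the price of a sign.
  by_cases h2 : 2 * p ≤ q
  · refine ⟨lowerChristoffel p (q - p), 1, k, ⟨p, q - p, by omega, ?_, Or.inl rfl⟩, ?_, by omega,
      Or.inl rfl, fun n => ?_⟩
    · exact (Nat.coprime_sub_self_right hpq).2 hcop
    · rw [lowerChristoffel_eq, length_gam_mechLetter (by omega) (by omega) le_rfl (by omega)]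
      omega
    · rw [lowerChristoffel_eq, periodicWord_map_range (by omega) (mechLetter_add (by omega) _),
        gamSeq_mechLetter (by omega) le_rfl (by omega), show p + (q - p) = q by omega, hshift]
      push_cast
      rw [one_mul, add_assoc]
  · have hp : 1 ≤ p := by omega
    -- `x - ⌊xp/q⌋ = ⌈x(q-p)/q⌉`. Writing it with `x + 1` makes the offset `p - 1`, the one
    -- belonging to the upper Christoffel word of slope `(q-p)/p`.
    have hcomp : ∀ x : ℤ, (x * p + 0) / q = x - ((x + 1) * ((q - p : ℕ) : ℤ) + (p - 1)) / q := by
      intro x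
      rw [Int.ediv_eq_iff_of_pos hq0]
      have h := (Int.ediv_eq_iff_of_pos hq0).1
        (rfl : ((x + 1) * ((q - p : ℕ) : ℤ) + (p - 1)) / q = _)
      obtain ⟨h3, h4⟩ := h
      generalize ((x + 1) * ((q - p : ℕ) : ℤ) + (p - 1)) / q = y at *
      push_cast [Nat.cast_sub hpq] at h3 h4
      constructor <;> nlinarith
    have hneg : ∀ x : ℤ, mechWord p q 0 x = -mechWord (q - p) q (p - 1) (x + 1) := fun x => by
      rw [mechWord, hcomp, hcomp, hcomp, mechWord, sub_add_cancel, add_sub_cancel_right]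
      ring
    obtain ⟨k', c, hk', hkc⟩ : ∃ (k' : ℕ) (c : ℤ), k' < q ∧ (k' : ℤ) = k + 1 + c * q := by
      rcases Nat.lt_or_ge (k + 1) q with h | h
      · exact ⟨k + 1, 0, h, by push_cast; ring⟩
      · exact ⟨0, -1, by omega, by push_cast; omega⟩
    refine ⟨upperChristoffel (q - p) p, -1, k', ⟨q - p, p, by omega, ?_, Or.inr rfl⟩, ?_, hk',
      Or.inr rfl, fun n => ?_⟩
    · exact (Nat.coprime_sub_self_left hpq).2 hcop.symm
    · rw [upperChristoffel_eq hp, length_gam_mechLetter hp (by omega) (by omega) (by omega)]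
      omega
    · rw [upperChristoffel_eq hp, periodicWord_map_range hp (mechLetter_add hp _),
        gamSeq_mechLetter (by omega) (by omega) (by omega), show q - p + p = q by omega, hshift,
        hneg, neg_one_mul, Nat.cast_add, hkc,
        ← mechWord_add_period (p := q - p) hq _ ((k : ℤ) + (n + 1) + 1) c]
      congr 2; ring

/-! ### Reduction of `limsupDist` to the Green function sums -/

lemma limsup_le_limsup_of_tendsto_sub {f g : ℕ → ℝ} (hf : ∀ n, 0 ≤ f n)
    (hg : IsBoundedUnder (· ≤ ·) atTop g) (h : Tendsto (fun n => f n - g n) atTop (𝓝 0)) :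
    limsup f atTop ≤ limsup g atTop := by
  refine le_of_forall_pos_le_add fun ε hε => ?_
  refine limsup_le_of_le (isCoboundedUnder_le_of_le atTop hf) ?_
  filter_upwards [eventually_lt_of_limsup_lt (lt_add_of_pos_right _ (half_pos hε)) hg,
    h.eventually (eventually_lt_nhds (half_pos hε))] with n h1 h2
  linarith

lemma limsup_eq_limsup_of_tendsto_sub {f g : ℕ → ℝ} (hf : ∀ n, 0 ≤ f n) (hg : ∀ n, 0 ≤ g n)
    (hf' : IsBoundedUnder (· ≤ ·) atTop f) (hg' : IsBoundedUnder (· ≤ ·) atTop g)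
    (h : Tendsto (fun n => f n - g n) atTop (𝓝 0)) : limsup f atTop = limsup g atTop := by
  refine le_antisymm (limsup_le_limsup_of_tendsto_sub hf hg' h)
    (limsup_le_limsup_of_tendsto_sub hg hf' ?_)
  simpa using h.neg

lemma nint_nonneg (x : ℝ) : 0 ≤ nint x := abs_nonneg _

lemma nint_le_half (x : ℝ) : nint x ≤ 1 / 2 := abs_sub_round x

lemma nint_eq_abs_sub {x : ℝ} {u : ℤ} (h : |x - u| < 1 / 2) : nint x = |x - u| := by
  rw [abs_lt] at h
  rw [nint, (round_eq_iff (n := u)).2 ⟨by linarith, by linarith⟩]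

lemma isBoundedUnder_nint (α ξ : ℝ) :
    IsBoundedUnder (· ≤ ·) atTop fun n : ℕ => nint (ξ * α ^ n) :=
  isBoundedUnder_of ⟨1 / 2, fun _ => nint_le_half _⟩

lemma limsupDist_nonneg (α ξ : ℝ) : 0 ≤ limsupDist α ξ :=
  le_limsup_of_frequently_le (Frequently.of_forall fun _ => nint_nonneg _) (isBoundedUnder_nint α ξ)

lemma exists_recurrence (b : ℤ) (s : ℕ → ℤ) (u₀ u₁ : ℤ) :
    ∃ u : ℕ → ℤ, u 0 = u₀ ∧ u 1 = u₁ ∧ ∀ n, s n = u (n + 2) - b * u (n + 1) + u n := by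
  let f : ℕ → ℤ × ℤ := fun n =>
    Nat.rec (u₀, u₁) (fun n p => (p.2, b * p.2 - p.1 + s n)) n
  refine ⟨fun n => (f n).1, rfl, rfl, fun n => ?_⟩
  change s n = (b * (f n).2 - (f n).1 + s n) - b * (f n).2 + (f n).1
  ring

lemma tsum_padZero (s : ℕ → ℤ) (f : ℤ → ℝ) :
    ∑' i : ℤ, (padZero s i : ℝ) * f i = ∑' j : ℕ, (s j : ℝ) * f (j + 1) := by
  have hinj : Function.Injective fun j : ℕ => (j : ℤ) + 1 := fun a b h => by simpa using h
  rw [← hinj.tsum_eq]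
  · exact tsum_congr fun j => by rw [padZero_succ]
  · intro i hi
    rcases le_or_gt i 0 with h | h
    · simp [padZero, h] at hi
    · exact ⟨(i - 1).toNat, by simp; omega⟩

lemma realize_padZero_smul (α β : ℝ) (s : ℕ → ℤ) (σ : ℤ) :
    realize α β (padZero fun n => σ * s n) = σ * realize α β (padZero s) := by
  rw [realize, realize, tsum_padZero, tsum_padZero, ← tsum_mul_left]
  exact tsum_congr fun j => by push_cast; ring

section

variable {α β : ℝ} (hα : 3 < α) (hprod : α * β = 1)
include hα hprod

lemma conj_pos : 0 < β := by
  have : 0 < α := by linarith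
  exact pos_of_mul_pos_right (hprod ▸ one_pos) this.le

lemma conj_lt : β < 1 / 3 := by
  have := conj_pos hα hprod
  nlinarith

lemma conj_div_eq : (1 - β) / (α - β) = 1 / (1 + α) := by
  have h0 := conj_pos hα hprod
  have h1 := conj_lt hα hprod
  rw [div_eq_div_iff (by linarith) (by linarith)]
  linarith

omit hα in
lemma realize_padZero (s : ℕ → ℤ) :
    realize α β (padZero s) = β * rightSum β (padZero s) 1 / (α - β) := by
  have hβ : β = α⁻¹ := (inv_eq_of_mul_eq_one_right hprod).symm
  rw [realize, tsum_padZero, rightSum, ← tsum_mul_left, ← tsum_div_const]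
  refine tsum_congr fun j => ?_
  rw [add_comm 1 (j : ℤ), padZero_succ, tau, if_neg (by omega), hβ, zpow_neg,
    ← Nat.cast_succ, zpow_natCast, ← inv_pow, Nat.succ_eq_add_one, pow_succ]
  ring

/-- The error terms of a solution of an inhomogeneous recurrence. -/
lemma mul_sub_eq_Phi {b : ℕ} (hsum : α + β = b) {s u : ℕ → ℤ}
    (hs : ∀ n, s n = u (n + 2) - b * u (n + 1) + u n) (hb : BddWord (padZero s)) (n : ℕ) :
    (α - β) * ((realize α β (padZero s) + (u 1 - β * u 0) / (α - β)) * α ^ n - u n) =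
      Phi β (padZero s) n + (u 1 - α * u 0) * β ^ n := by
  have h0 := conj_pos hα hprod
  have h1 := conj_lt hα hprod
  have h1' : β < 1 := by linarith
  have hne : α - β ≠ 0 := by linarith
  have hs' : ∀ n, (s n : ℝ) = u (n + 2) - (α + β) * u (n + 1) + u n := fun n => by
    rw [hs, hsum]; push_cast; ring
  -- Diagonalise the recurrence: `u (n+1) - β u n` is governed by the letters to come, and `u (n+1)
  -- - α u n` by those already read. The two identities together give both halves of `Phi`.
  have hR : ∀ n : ℕ, (α - β) * (realize α β (padZero s) + (u 1 - β * u 0) / (α - β)) * α ^ n =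
      u (n + 1) - β * u n + β * rightSum β (padZero s) (n + 1) := by
    intro n
    induction n with
    | zero =>
      rw [realize_padZero hprod]
      simp only [Nat.cast_zero, zero_add, pow_zero, mul_one]
      field_simp
      ring
    | succ n ih =>
      rw [pow_succ, ← mul_assoc, ih, rightSum_eq h0 h1' hb, padZero_succ, hs']
      push_cast
      linear_combination (rightSum β (padZero s) (n + 1 + 1) * β + u (n + 2) -
        (α + β) * u (n + 1) + u n - u n) * hprod
  have hL : ∀ n : ℕ, (u (n + 1) : ℝ) - α * u n =
      (u 1 - α * u 0) * β ^ n + leftSum β (padZero s) n := by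
    intro n
    induction n with
    | zero =>
      have : leftSum β (padZero s) (0 : ℕ) = 0 := by
        simp [leftSum, padZero]
      rw [this]; simp
    | succ n ih =>
      rw [leftSum_eq h0 h1' hb]
      push_cast
      rw [padZero_succ, hs', add_sub_cancel_right]
      linear_combination β * ih + (u n : ℝ) * hprod
  rw [Phi_eq_right_add_left h0 h1' hb, rightSum_eq h0 h1' hb]
  linear_combination hR n + hL n

lemma limsupDist_eq_of_eventually {b : ℕ} (hsum : α + β = b) {s u : ℕ → ℤ}
    (hs : ∀ n, s n = u (n + 2) - b * u (n + 1) + u n) (hb : BddWord (padZero s)) {ξ : ℝ}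
    (hξ : ξ = realize α β (padZero s) + (u 1 - β * u 0) / (α - β))
    (hev : ∀ᶠ n : ℕ in atTop, nint (ξ * α ^ n) = |ξ * α ^ n - u n|) :
    limsupDist α ξ = limsupPhi β (padZero s) / (α - β) := by
  have h0 := conj_pos hα hprod
  have h1 := conj_lt hα hprod
  have h1' : β < 1 := by linarith
  have hpos : 0 < α - β := by linarith
  have hbdd := isBounded_abs_Phi h0 h1' hb
  have hmono : Monotone fun x : ℝ => x / (α - β) := fun x y h => by
    dsimp only; gcongr
  have hscale : limsupPhi β (padZero s) / (α - β) =
      limsup (fun n : ℕ => |Phi β (padZero s) n| / (α - β)) atTop :=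
    hmono.map_limsup_of_continuousAt (F := atTop) (fun n : ℕ => |Phi β (padZero s) n|)
      (by fun_prop) hbdd isCobounded_abs_Phi
  rw [hscale, limsupDist]
  refine limsup_eq_limsup_of_tendsto_sub (fun _ => nint_nonneg _)
    (fun _ => div_nonneg (abs_nonneg _) hpos.le) (isBoundedUnder_nint α ξ) ?_ ?_
  · obtain ⟨M, hM⟩ := BddWord.exists_abs_Phi_le h0 h1' hb
    exact isBoundedUnder_of ⟨M / (α - β), fun n => hmono (hM n)⟩
  · have hlim : Tendsto (fun n : ℕ => |(u 1 - α * u 0 : ℝ)| / (α - β) * β ^ n) atTop (𝓝 0) := by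
      simpa using (tendsto_pow_atTop_nhds_zero_of_lt_one h0.le h1').const_mul
        (|(u 1 - α * u 0 : ℝ)| / (α - β))
    refine squeeze_zero_norm' ?_ hlim
    filter_upwards [hev] with n hn
    have hG := mul_sub_eq_Phi hα hprod hsum hs hb n
    rw [← hξ] at hG
    rw [hn, show ξ * α ^ n - u n = (Phi β (padZero s) n + (u 1 - α * u 0) * β ^ n) / (α - β) by
        rw [← hG]; field_simp, abs_div, abs_of_pos hpos, ← sub_div, Real.norm_eq_abs, abs_div,
      abs_of_pos hpos, div_mul_eq_mul_div, ← abs_of_pos (pow_pos h0 n), ← abs_mul,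
      abs_of_pos (pow_pos h0 n)]
    refine hmono ((abs_abs_sub_abs_le _ _).trans_eq ?_)
    rw [add_sub_cancel_left]

-- The summand from `M` is the contribution of the initial values `u 0`, `u 1` of the recurrence.
omit hα in
lemma mem_baseSet_iff {b : ℕ} (hsum : α + β = b) {x : ℝ} :
    x ∈ baseSet α β ↔ ∃ u₀ u₁ : ℤ, x = (u₁ - β * u₀) / (α - β) := by
  constructor
  · rintro ⟨z, hz, rfl⟩
    have : ∃ c d : ℤ, z = c + d * α := by
      induction hz using Algebra.adjoin_induction with
      | mem x hx => exact ⟨0, 1, by rw [Set.mem_singleton_iff.1 hx]; simp⟩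
      | algebraMap r => exact ⟨r, 0, by simp⟩
      | add x y _ _ hx hy =>
        obtain ⟨c, d, rfl⟩ := hx
        obtain ⟨c', d', rfl⟩ := hy
        exact ⟨c + c', d + d', by push_cast; ring⟩
      | mul x y _ _ hx hy =>
        obtain ⟨c, d, rfl⟩ := hx
        obtain ⟨c', d', rfl⟩ := hy
        refine ⟨c * c' - d * d', c * d' + d * c' + d * d' * b, ?_⟩
        push_cast
        rw [← hsum]
        linear_combination (-(d : ℝ) * d') * hprod
    obtain ⟨c, d, rfl⟩ := this
    refine ⟨d, c + b * d, ?_⟩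
    push_cast
    rw [← hsum]
    ring
  · rintro ⟨u₀, u₁, rfl⟩
    refine ⟨((u₁ - b * u₀ : ℤ) : ℝ) + (u₀ : ℝ) * α, ?_, ?_⟩
    · have hmem := Algebra.self_mem_adjoin_singleton ℤ α
      refine add_mem (intCast_mem _ _) (mul_mem (intCast_mem _ _) hmem)
    · push_cast
      rw [← hsum]
      ring

theorem limsupDist_realize_add {b : ℕ} (hsum : α + β = b) {s : ℕ → ℤ}
    (hb : BddWord (padZero s)) (h : limsupPhi β (padZero s) ≤ 1 - β) {x : ℝ}
    (hx : x ∈ baseSet α β) :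
    limsupDist α (realize α β (padZero s) + x) = limsupPhi β (padZero s) / (α - β) := by
  have h0 := conj_pos hα hprod
  have h1 := conj_lt hα hprod
  have h1' : β < 1 := by linarith
  have hpos : 0 < α - β := by linarith
  obtain ⟨u₀, u₁, rfl⟩ := (mem_baseSet_iff hprod hsum).1 hx
  obtain ⟨u, rfl, rfl, hs⟩ := exists_recurrence b s u₀ u₁
  refine limsupDist_eq_of_eventually hα hprod hsum hs hb rfl ?_
  have hlim : Tendsto (fun n : ℕ => |(u 1 - α * u 0 : ℝ) * β ^ n|) atTop (𝓝 0) := by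
    simpa using ((tendsto_pow_atTop_nhds_zero_of_lt_one h0.le h1').const_mul
      (u 1 - α * u 0 : ℝ)).abs
  -- Eventually `|Phi| < 1` and the transient is below `1/3`, while `α - β > 8/3`; so the error is
  -- below `1/2` and `u n` is the nearest integer.
  filter_upwards [hlim.eventually (eventually_lt_nhds (show (0 : ℝ) < 1 / 3 by norm_num)),
    eventually_lt_of_limsup_lt (show limsupPhi β (padZero s) < 1 by linarith)
      (isBounded_abs_Phi h0 h1' hb)] with n hn1 hn2
  refine nint_eq_abs_sub ?_
  have hG := mul_sub_eq_Phi hα hprod hsum hs hb n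
  have := abs_add_le (Phi β (padZero s) n) ((u 1 - α * u 0) * β ^ n)
  rw [← hG, abs_mul, abs_of_pos hpos] at this
  nlinarith

theorem exists_eq_realize_add {b : ℕ} (hsum : α + β = b) (ξ : ℝ) :
    ∃ s : ℕ → ℤ, ∃ x ∈ baseSet α β, BddWord (padZero s) ∧ ξ = realize α β (padZero s) + x ∧
      limsupDist α ξ = limsupPhi β (padZero s) / (α - β) ∧
      (limsupDist α ξ ≤ 1 / (1 + α) → ∀ᶠ n in atTop, |s n| ≤ 1) := by
  have h0 := conj_pos hα hprod
  have h1 := conj_lt hα hprod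
  have h1' : β < 1 := by linarith
  have hpos : 0 < α - β := by linarith
  have hb0 : (0 : ℝ) < b + 2 := by positivity
  set u : ℕ → ℤ := fun n => round (ξ * α ^ n) with hu
  set s : ℕ → ℤ := fun n => u (n + 2) - b * u (n + 1) + u n with hs
  have hnint : ∀ n, nint (ξ * α ^ n) = |ξ * α ^ n - u n| := fun n => rfl
  have hsn : ∀ n, (s n : ℝ) = -((ξ * α ^ (n + 2) - u (n + 2)) -
      b * (ξ * α ^ (n + 1) - u (n + 1)) + (ξ * α ^ n - u n)) := fun n => by
    rw [hs]
    push_cast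
    rw [← hsum, pow_succ, pow_succ]
    linear_combination -ξ * α ^ n * hprod
  have habs : ∀ n (c : ℝ), (∀ m, n ≤ m → nint (ξ * α ^ m) ≤ c) → |(s n : ℝ)| ≤ (b + 2) * c := by
    intro n c h
    have e0 := abs_le.1 (hnint n ▸ h n le_rfl)
    have e1 := abs_le.1 (hnint (n + 1) ▸ h (n + 1) (by omega))
    have e2 := abs_le.1 (hnint (n + 2) ▸ h (n + 2) (by omega))
    have hbn : (0 : ℝ) ≤ b := Nat.cast_nonneg b
    rw [hsn, abs_neg, abs_le]
    constructor <;> nlinarith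
  have hbdd : BddWord (padZero s) := by
    refine bddWord_padZero (B := ⌈((b : ℝ) + 2) * (1 / 2)⌉) (Eventually.of_forall fun n => ?_)
    have := (habs n (1 / 2) fun m _ => nint_le_half _).trans (Int.le_ceil _)
    exact_mod_cast this
  have hξ : ξ = realize α β (padZero s) + (u 1 - β * u 0) / (α - β) := by
    set η := realize α β (padZero s) + (u 1 - β * u 0) / (α - β) with hη
    obtain ⟨M, hM⟩ := BddWord.exists_abs_Phi_le h0 h1' hbdd
    -- Both `ξ α ^ n` and `η α ^ n` stay within bounded distance of `u n`; as `α ^ n` is unbounded,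
    -- `ξ = η`.
    have hbound : ∀ n : ℕ, |ξ - η| * (α - β) * α ^ n ≤
        M + |(u 1 - α * u 0 : ℝ)| + (α - β) * (1 / 2) := by
      intro n
      have hG := mul_sub_eq_Phi hα hprod hsum (s := s) (u := u) (fun _ => rfl) hbdd n
      rw [← hη] at hG
      have hn := (hnint n) ▸ nint_le_half (ξ * α ^ n)
      have hpw : β ^ n ≤ 1 := pow_le_one₀ h0.le h1'.le
      have e1 : |(u 1 - α * u 0 : ℝ) * β ^ n| ≤ |(u 1 - α * u 0 : ℝ)| := by
        rw [abs_mul, abs_of_pos (pow_pos h0 n)]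
        exact mul_le_of_le_one_right (abs_nonneg _) hpw
      have e2 : |(ξ - η) * (α - β) * α ^ n| = |ξ - η| * (α - β) * α ^ n := by
        rw [abs_mul, abs_mul, abs_of_pos hpos, abs_of_pos (pow_pos (show 0 < α by linarith) n)]
      rw [← e2, show (ξ - η) * (α - β) * α ^ n = (α - β) * (ξ * α ^ n - u n) -
        (Phi β (padZero s) n + (u 1 - α * u 0) * β ^ n) by rw [← hG]; ring]
      refine (abs_sub _ _).trans ?_
      have e3 := abs_add_le (Phi β (padZero s) n) ((u 1 - α * u 0) * β ^ n)
      rw [abs_mul, abs_of_pos hpos]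
      nlinarith [hM n]
    by_contra hne
    have hc : 0 < |ξ - η| * (α - β) := mul_pos (abs_pos.2 (sub_ne_zero.2 hne)) hpos
    have := (tendsto_pow_atTop_atTop_of_one_lt (show 1 < α by linarith)).const_mul_atTop hc
    obtain ⟨n, hn⟩ := (this.eventually (eventually_gt_atTop _)).exists
    exact absurd (hbound n) (not_le.2 hn)
  refine ⟨s, (u 1 - β * u 0) / (α - β), (mem_baseSet_iff hprod hsum).2 ⟨u 0, u 1, rfl⟩,
    hbdd, hξ, limsupDist_eq_of_eventually hα hprod hsum (fun _ => rfl) hbdd hξ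
      (Eventually.of_forall hnint), fun hle => ?_⟩
  -- This holds because `b = α + β < 2α`. It makes `|s n|` eventually less than `2`.
  have hlt : limsupDist α ξ < 2 / (b + 2) := by
    refine hle.trans_lt ?_
    rw [div_lt_div_iff₀ (by linarith) hb0, ← hsum]
    linarith
  obtain ⟨c, hc1, hc2⟩ := exists_between hlt
  obtain ⟨N, hN⟩ := eventually_atTop.1 (eventually_lt_of_limsup_lt hc1 (isBoundedUnder_nint α ξ))
  filter_upwards [eventually_ge_atTop N] with n hn
  have h2 := habs n c fun m hm => (hN m (hn.trans hm)).le
  have h3 : (b + 2) * c < 2 := by rwa [lt_div_iff₀' hb0] at hc2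
  have : (|s n| : ℤ) < 2 := by
    have := h2.trans_lt h3
    exact_mod_cast this
  omega

end

/-! ### The sequences `p` and `q` -/

lemma recSeq_one_eq (b : ℤ) (n : ℕ) :
    recSeq b 1 (1 + b) n = recSeq b 0 1 (n + 1) + recSeq b 0 1 n := by
  induction n using Nat.twoStepInduction with
  | zero => simp [recSeq]
  | one => simp [recSeq]; ring
  | more n h1 h2 =>
    rw [recSeq, h1, h2, recSeq, recSeq, recSeq]
    ring

lemma recSeq_nonneg_lt {b : ℤ} (hb : 2 ≤ b) (n : ℕ) :
    0 ≤ recSeq b 0 1 n ∧ recSeq b 0 1 n < recSeq b 0 1 (n + 1) := by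
  induction n with
  | zero => simp [recSeq]
  | succ n ih =>
    refine ⟨by linarith [ih.1, ih.2], ?_⟩
    rw [show recSeq b 0 1 (n + 1 + 1) = b * recSeq b 0 1 (n + 1) - recSeq b 0 1 n from rfl]
    nlinarith [ih.1, ih.2]

lemma recSeq_isCoprime (b : ℤ) (n : ℕ) : IsCoprime (recSeq b 0 1 n) (recSeq b 0 1 (n + 1)) := by
  induction n with
  | zero => exact isCoprime_one_right
  | succ n ih =>
    obtain ⟨x, y, h⟩ := ih
    refine ⟨b * x + y, -x, ?_⟩
    rw [show recSeq b 0 1 (n + 1 + 1) = b * recSeq b 0 1 (n + 1) - recSeq b 0 1 n from rfl]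
    linear_combination h

lemma pSeq_two_mul (b n : ℕ) : pSeq b (2 * n) = recSeq b 0 1 n := by
  simp [pSeq, interleave]

lemma qSeq_two_mul (b n : ℕ) : qSeq b (2 * n) = recSeq b 0 1 (n + 1) + recSeq b 0 1 n := by
  simp [qSeq, interleave, recSeq_one_eq]

lemma pSeq_two_mul_add_one (b n : ℕ) :
    pSeq b (2 * n + 1) = recSeq b 0 1 n + recSeq b 0 1 (n + 1) := by
  have h : (2 * n + 1) / 2 = n := by omega
  simp [pSeq, interleave, h]

lemma qSeq_two_mul_add_one (b n : ℕ) :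
    qSeq b (2 * n + 1) = (recSeq b 0 1 (n + 1) + recSeq b 0 1 n) +
      (recSeq b 0 1 (n + 2) + recSeq b 0 1 (n + 1)) := by
  have h : (2 * n + 1) / 2 = n := by omega
  simp [qSeq, interleave, h, recSeq_one_eq]

section

variable {b : ℕ} (hb : 2 ≤ b)
include hb

lemma negCF_replicate (n : ℕ) :
    negCF (List.replicate n (b : ℚ)) = (recSeq b 0 1 n : ℚ) / recSeq b 0 1 (n + 1) := by
  induction n with
  | zero => simp [negCF, recSeq]
  | succ n ih =>
    have h := recSeq_nonneg_lt (b := b) (by exact_mod_cast hb) n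
    have h' := recSeq_nonneg_lt (b := b) (by exact_mod_cast hb) (n + 1)
    have e1 : (recSeq b 0 1 (n + 1) : ℚ) ≠ 0 := by exact_mod_cast (by omega)
    have e2 : (recSeq b 0 1 (n + 1 + 1) : ℚ) ≠ 0 := by exact_mod_cast (by omega)
    have e3 : (recSeq b 0 1 (n + 1 + 1) : ℚ) =
        b * recSeq b 0 1 (n + 1) - recSeq b 0 1 n := by simp [recSeq]
    rw [e3] at e2
    rw [List.replicate_succ, negCF, ih, e3, show (b : ℚ) - recSeq b 0 1 n / recSeq b 0 1 (n + 1) =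
      (b * recSeq b 0 1 (n + 1) - recSeq b 0 1 n) / recSeq b 0 1 (n + 1) by field_simp,
      one_div_div]

lemma negConv_eq (n : ℕ) : negConv b n =
    (recSeq b 0 1 n : ℚ) / ((recSeq b 0 1 (n + 1) + recSeq b 0 1 n : ℤ) : ℚ) := by
  cases n with
  | zero => simp [negConv, negCF, recSeq]
  | succ n =>
    have h := recSeq_nonneg_lt (b := b) (by exact_mod_cast hb) n
    have e1 : (recSeq b 0 1 (n + 1) : ℚ) ≠ 0 := by exact_mod_cast (by omega)
    have e3 : (recSeq b 0 1 (n + 1 + 1) : ℚ) =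
        b * recSeq b 0 1 (n + 1) - recSeq b 0 1 n := by simp [recSeq]
    rw [negConv, negCF, negCF_replicate hb, Int.cast_add, e3,
      show (1 + b : ℚ) - recSeq b 0 1 n / recSeq b 0 1 (n + 1) =
      (b * recSeq b 0 1 (n + 1) - recSeq b 0 1 n + recSeq b 0 1 (n + 1)) / recSeq b 0 1 (n + 1) by
        field_simp; ring,
      one_div_div]

lemma negConv_num_den (n : ℕ) : (negConv b n).num = recSeq b 0 1 n ∧
    ((negConv b n).den : ℤ) = recSeq b 0 1 (n + 1) + recSeq b 0 1 n := by
  have h := recSeq_nonneg_lt (b := b) (by exact_mod_cast hb) n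
  have hpos : 0 < recSeq b 0 1 (n + 1) + recSeq b 0 1 n := by omega
  have hcop : (recSeq b 0 1 n).natAbs.Coprime (recSeq b 0 1 (n + 1) + recSeq b 0 1 n).natAbs := by
    refine Int.isCoprime_iff_gcd_eq_one.1 ?_
    simpa using (recSeq_isCoprime b n).add_mul_left_right 1
  rw [negConv_eq hb]
  exact ⟨Rat.num_div_eq_of_coprime hpos hcop, Rat.den_div_eq_of_coprime hpos hcop⟩

lemma pSeq_div_qSeq_even (n : ℕ) :
    (pSeq b (2 * n) : ℚ) / (qSeq b (2 * n) : ℚ) = negConv b n := by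
  rw [negConv_eq hb, pSeq_two_mul, qSeq_two_mul]

lemma pSeq_div_qSeq_odd (n : ℕ) : (pSeq b (2 * n + 1) : ℚ) / (qSeq b (2 * n + 1) : ℚ) =
    ((negConv b n).num + (negConv b (n + 1)).num : ℚ) /
      ((negConv b n).den + (negConv b (n + 1)).den : ℚ) := by
  obtain ⟨h1, h2⟩ := negConv_num_den hb n
  obtain ⟨h3, h4⟩ := negConv_num_den hb (n + 1)
  rw [pSeq_two_mul_add_one, qSeq_two_mul_add_one, h1, h3, ← h2, ← h4]
  push_cast
  rfl

end

section

variable {α β : ℝ} (hα : 3 < α) (hprod : α * β = 1) {b : ℕ} (hsum : α + β = b)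
include hα hprod hsum

omit hα in
lemma recSeq_eq_pow (n : ℕ) : (α - β) * recSeq b 0 1 n = α ^ n - β ^ n := by
  induction n using Nat.twoStepInduction with
  | zero => simp [recSeq]
  | one => simp [recSeq]
  | more n h1 h2 =>
    rw [recSeq]
    push_cast
    rw [← hsum]
    linear_combination (α + β) * h2 - h1 + (α ^ n - β ^ n) * hprod

lemma two_le_trace : 2 ≤ b := by
  have := conj_pos hα hprod
  have : (2 : ℝ) ≤ b := by linarith
  exact_mod_cast this

/-- By the Binet formula `recSeq_eq_pow`, one closed form covers both parities, although the
interleaved sequences are defined by cases. -/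
lemma pSeq_div_qSeq (n : ℕ) : (pSeq b n : ℝ) / (qSeq b n : ℝ) =
    (1 - β ^ n) / ((1 + α) * (1 - β ^ (n + 1))) := by
  have h0 := conj_pos hα hprod
  have h1 := conj_lt hα hprod
  have hb2 : (2 : ℤ) ≤ b := by exact_mod_cast two_le_trace hα hprod hsum
  have hpow : β ^ (n + 1) < 1 := pow_lt_one₀ h0.le (by linarith) (by omega)
  have hden : (1 + α) * (1 - β ^ (n + 1)) ≠ 0 := by
    have : 0 < (1 + α) * (1 - β ^ (n + 1)) := mul_pos (by linarith) (by linarith)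
    exact this.ne'
  have hne : α - β ≠ 0 := by linarith
  have hαβ : α = β⁻¹ := eq_inv_of_mul_eq_one_left hprod
  have hu := recSeq_eq_pow hprod hsum
  rcases Nat.even_or_odd' n with ⟨m, rfl | rfl⟩
  · have r := recSeq_nonneg_lt hb2 m
    have e1 := hu m
    have e2 := hu (m + 1)
    have hq : ((qSeq b (2 * m) : ℤ) : ℝ) ≠ 0 := by
      rw [qSeq_two_mul]; exact_mod_cast (by omega)
    rw [div_eq_div_iff hq hden, pSeq_two_mul, qSeq_two_mul]
    push_cast
    refine mul_left_cancel₀ hne ?_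
    have : (α - β) * (recSeq b 0 1 m * ((1 + α) * (1 - β ^ (2 * m + 1)))) -
      (α - β) * ((1 - β ^ (2 * m)) * (recSeq b 0 1 (m + 1) + recSeq b 0 1 m)) =
      (α ^ m - β ^ m) * ((1 + α) * (1 - β ^ (2 * m + 1))) -
      (1 - β ^ (2 * m)) * (α ^ (m + 1) - β ^ (m + 1) + (α ^ m - β ^ m)) := by
      linear_combination ((1 + α) * (1 - β ^ (2 * m + 1)) - (1 - β ^ (2 * m))) * e1 -
        (1 - β ^ (2 * m)) * e2
    rw [← sub_eq_zero, this, hαβ, inv_pow, inv_pow]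
    field_simp
    ring
  · have r := recSeq_nonneg_lt hb2 m
    have e1 := hu m
    have e2 := hu (m + 1)
    have e3 := hu (m + 2)
    have r' : _ ∧ _ < recSeq b 0 1 (m + 2) := recSeq_nonneg_lt hb2 (m + 1)
    have hq : ((qSeq b (2 * m + 1) : ℤ) : ℝ) ≠ 0 := by
      rw [qSeq_two_mul_add_one]; exact_mod_cast (by omega)
    rw [div_eq_div_iff hq hden, pSeq_two_mul_add_one, qSeq_two_mul_add_one]
    push_cast
    refine mul_left_cancel₀ hne ?_
    have : (α - β) * ((recSeq b 0 1 m + recSeq b 0 1 (m + 1)) *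
        ((1 + α) * (1 - β ^ (2 * m + 1 + 1)))) -
      (α - β) * ((1 - β ^ (2 * m + 1)) * (recSeq b 0 1 (m + 1) + recSeq b 0 1 m +
        (recSeq b 0 1 (m + 2) + recSeq b 0 1 (m + 1)))) =
      (α ^ m - β ^ m + (α ^ (m + 1) - β ^ (m + 1))) * ((1 + α) * (1 - β ^ (2 * m + 1 + 1))) -
      (1 - β ^ (2 * m + 1)) * (α ^ (m + 1) - β ^ (m + 1) + (α ^ m - β ^ m) +
        (α ^ (m + 2) - β ^ (m + 2) + (α ^ (m + 1) - β ^ (m + 1)))) := by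
      linear_combination ((1 + α) * (1 - β ^ (2 * m + 1 + 1)) - (1 - β ^ (2 * m + 1))) * e1 +
        ((1 + α) * (1 - β ^ (2 * m + 1 + 1)) - 2 * (1 - β ^ (2 * m + 1))) * e2 -
        (1 - β ^ (2 * m + 1)) * e3
    rw [← sub_eq_zero, this, hαβ, inv_pow, inv_pow, inv_pow]
    field_simp
    ring

lemma pSeq_div_qSeq_eq_gapVal (n : ℕ) :
    (pSeq b n : ℝ) / (qSeq b n : ℝ) = gapVal β (n + 1) / (α - β) := by
  have h0 := conj_pos hα hprod
  have h1 := conj_lt hα hprod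
  have hpow : β ^ (n + 1) < 1 := pow_lt_one₀ h0.le (by linarith) (by omega)
  have hne : 1 - β ^ (n + 1) ≠ 0 := by linarith
  rw [pSeq_div_qSeq hα hprod hsum, gapVal, Nat.add_sub_cancel, mul_div_right_comm,
    conj_div_eq hα hprod]
  field_simp
  ring

lemma strictMono_pSeq_div_qSeq : StrictMono fun n : ℕ => (pSeq b n : ℝ) / (qSeq b n : ℝ) := by
  have h0 := conj_pos hα hprod
  have h1 := conj_lt hα hprod
  refine strictMono_nat_of_lt_succ fun n => ?_
  have hpow : ∀ n : ℕ, 0 < 1 - β ^ (n + 1) := fun n =>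
    sub_pos.2 (pow_lt_one₀ h0.le (by linarith) (by omega))
  rw [pSeq_div_qSeq hα hprod hsum, pSeq_div_qSeq hα hprod hsum, div_lt_div_iff₀
    (mul_pos (by linarith) (hpow n)) (mul_pos (by linarith) (hpow (n + 1)))]
  have : 0 < (1 + α) * (β ^ n * (1 - β) ^ 2) :=
    mul_pos (by linarith) (mul_pos (pow_pos h0 n) (pow_pos (by linarith) 2))
  linear_combination this

lemma tendsto_pSeq_div_qSeq :
    Tendsto (fun n : ℕ => (pSeq b n : ℝ) / (qSeq b n : ℝ)) atTop (𝓝 (1 / (1 + α))) := by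
  have h0 := conj_pos hα hprod
  have h1 := conj_lt hα hprod
  have hlim := tendsto_pow_atTop_nhds_zero_of_lt_one h0.le (show β < 1 by linarith)
  have hlim' := hlim.comp (tendsto_add_atTop_nat 1)
  simp_rw [pSeq_div_qSeq hα hprod hsum]
  have := (hlim.const_sub 1).div ((hlim'.const_sub 1).const_mul (1 + α))
    (by simp; linarith)
  simpa [Pi.div_def] using this

lemma tendsto_negConv : Tendsto (fun n : ℕ => (negConv b n : ℝ)) atTop (𝓝 (1 / (1 + α))) := by
  have := (tendsto_pSeq_div_qSeq hα hprod hsum).comp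
    (tendsto_id.const_mul_atTop' (show 0 < 2 by norm_num))
  refine this.congr fun n => ?_
  rw [← pSeq_div_qSeq_even (two_le_trace hα hprod hsum)]
  simp

end

/-! ### Eventually periodic words -/

/-- A balanced primitive of a periodic word is a periodic word plus a linear function. -/
lemma BalancedSum.second_diff_eq_zero_of_periodic {S t : ℤ → ℤ} (hS : BalancedSum S)
    (htS : ∀ n, t n = S (n + 1) - 2 * S n + S (n - 1)) {T : ℕ} (hT : ∀ n, t (n + T) = t n)
    (n : ℤ) {i : ℕ} (hi : T ∣ i) : S (n + i) - 2 * S n + S (n - i) = 0 := by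
  have step : ∀ n : ℤ, (S (n + 1 + T) - S (n + 1)) - (S (n + T) - S n) =
      (S (n + T) - S n) - (S (n - 1 + T) - S (n - 1)) := fun n => by
    have := hT n
    rw [htS, htS, show n + T + 1 = n + 1 + T by ring,
      show n + (T : ℤ) - 1 = n - 1 + T by ring] at this
    linarith
  -- The window count `S (n+T) - S n` has second difference `t (n+T) - t n = 0`, so it is affine
  -- with slope `c`. By balance its values at `2` and `0` differ by at most one, so `c = 0`.
  obtain ⟨c, hc⟩ : ∃ c, ∀ n : ℤ, (S (n + 1 + T) - S (n + 1)) - (S (n + T) - S n) = c := by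
    refine ⟨S (0 + 1 + T) - S (0 + 1) - (S (0 + T) - S 0), fun n => ?_⟩
    induction n using Int.induction_on with
    | zero => rfl
    | succ k ih => rw [← ih, step (k + 1), add_sub_cancel_right]
    | pred k ih => rw [← ih, step (-k), sub_add_cancel]
  have hlin : ∀ (n : ℤ) (k : ℕ), S (n + k + T) - S (n + k) = S (n + T) - S n + k * c := by
    intro n k
    induction k with
    | zero => simp
    | succ k ih =>
      have := hc (n + k)
      push_cast
      rw [← add_assoc]
      linarith
  have hc0 : c = 0 := by
    have h1 := hS T 2 0 (by positivity)
    have h2 := hS T 0 2 (by positivity)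
    have h3 := hlin 0 2
    simp only [zero_add] at h1 h2 h3
    push_cast at h3
    omega
  have hper : ∀ n : ℤ, S (n + 1 + T) - S (n + 1) = S (n + T) - S n := fun n => by
    linarith [hc n]
  have hconst : ∀ n : ℤ, S (n + T) - S n = S (0 + T) - S 0 := fun n => by
    induction n using Int.induction_on with
    | zero => rfl
    | succ k ih => rw [hper, ih]
    | pred k ih => rw [← ih, ← hper (-k - 1), sub_add_cancel]
  obtain ⟨k, rfl⟩ := hi
  have hmul : ∀ n : ℤ, S (n + (T * k : ℕ)) = S n + k * (S (0 + T) - S 0) := fun n => by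
    induction k with
    | zero => simp
    | succ k ih =>
      have := hconst (n + (T * k : ℕ))
      push_cast at this ih ⊢
      rw [mul_add, mul_one, ← add_assoc]
      linarith
  have h1 := hmul n
  have h2 := hmul (n - (T * k : ℕ))
  rw [sub_add_cancel] at h2
  linarith

/-- Every limit word inherits the period `T`, so its second differences at multiples of `T` vanish
and `gapVal β T` bounds the sums. -/
lemma limsupPhi_lt_of_eventuallyPeriodic {β : ℝ} (h0 : 0 < β) (h1 : β < 1 / 3) {s : ℕ → ℤ}
    (hs : ∀ᶠ n in atTop, |s n| ≤ 1) (h : limsupPhi β (padZero s) ≤ 1 - β)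
    (hper : EventuallyPeriodic s) : limsupPhi β (padZero s) < 1 - β := by
  obtain ⟨N, T, hT, hper⟩ := hper
  have h1' : β < 1 := by linarith
  have hb := bddWord_padZero hs
  have hs' : ∀ᶠ n : ℤ in atTop, |padZero s n| ≤ 1 :=
    eventually_padZero_iff (Q := fun _ z => |z| ≤ 1).2 hs
  refine lt_of_le_of_lt ((limsupPhi_le_iff h0 h1' hb).2 fun t ht j => ?_) (gapVal_lt h0 h1' hT)
  obtain ⟨S, hS, -, htS⟩ := exists_balancedSum_of_isLimitWord h0 h1 hb hs' h ht
  refine hS.abs_Phi_le_gapVal h0 h1' htS hT j fun i hi =>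
    hS.second_diff_eq_zero_of_periodic htS (fun n => ?_) j hi
  obtain ⟨U, hU, hUt⟩ := ht
  have hperZ : ∀ᶠ m : ℤ in atTop, padZero s (m + n + T) = padZero s (m + n) := by
    have : ∀ᶠ m : ℤ in atTop, padZero s (m + T) = padZero s m := by
      rw [eventually_padZero_iff (Q := fun m z => padZero s (m + T) = z)]
      filter_upwards [eventually_ge_atTop N] with m hm
      rw [← hper m hm, ← padZero_succ s (m + T)]
      push_cast
      congr 1
      ring
    exact (tendsto_atTop_add_const_right atTop n tendsto_id).eventually this
  obtain ⟨m, e1, e2, e3⟩ := ((hUt n).and ((hUt (n + T)).and (hU hperZ))).exists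
  rw [← e1, ← e2, ← e3, add_assoc]

lemma eventuallyPeriodic_of_eventually_mechWord {p q : ℕ} (hq : 1 ≤ q) {a : ℤ} {s : ℕ → ℤ}
    (h : ∀ᶠ n in atTop, padZero s n = mechWord p q a n) : EventuallyPeriodic s := by
  rw [eventually_padZero_iff (Q := fun n z => z = mechWord p q a n)] at h
  obtain ⟨N, hN⟩ := eventually_atTop.1 h
  refine ⟨N, q, hq, fun n hn => ?_⟩
  rw [hN n hn, hN (n + q) (by omega), ← mechWord_add_period hq a (n + 1) 1]
  push_cast
  congr 1
  ring

lemma mechWord_add (p q : ℕ) (a k n : ℤ) :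
    mechWord p q a (k + n) = mechWord p q (a + k * p) n := by
  have h : ∀ m : ℤ, (k + m) * p + a = m * p + (a + k * p) := fun m => by ring
  rw [mechWord, mechWord, h, add_assoc, h, add_sub_assoc, h]

/-! ### Level sets -/

lemma nint_neg (x : ℝ) : nint (-x) = nint x := by
  have key : ∀ y : ℝ, nint (-y) ≤ nint y := fun y => by
    refine (round_le (-y) (-round y)).trans_eq ?_
    rw [nint, ← abs_neg]
    push_cast
    congr 1
    ring
  exact le_antisymm (key x) (by simpa using key (-x))

lemma limsupDist_neg (α ξ : ℝ) : limsupDist α (-ξ) = limsupDist α ξ := by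
  simp only [limsupDist, neg_mul, nint_neg]

section

variable {α β : ℝ} (hα : 3 < α) (hprod : α * β = 1) {b : ℕ} (hsum : α + β = b)
include hα hprod hsum

omit hα in
lemma neg_mem_baseSet {x : ℝ} (hx : x ∈ baseSet α β) : -x ∈ baseSet α β := by
  rw [mem_baseSet_iff hprod hsum] at hx ⊢
  obtain ⟨u₀, u₁, rfl⟩ := hx
  exact ⟨-u₀, -u₁, by push_cast; ring⟩

omit hα in
lemma add_mem_baseSet {x y : ℝ} (hx : x ∈ baseSet α β) (hy : y ∈ baseSet α β) :
    x + y ∈ baseSet α β := by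
  rw [mem_baseSet_iff hprod hsum] at hx hy ⊢
  obtain ⟨u₀, u₁, rfl⟩ := hx
  obtain ⟨v₀, v₁, rfl⟩ := hy
  exact ⟨u₀ + v₀, u₁ + v₁, by push_cast; ring⟩

omit hsum in
lemma realize_padZero_eq_sum_add {s : ℕ → ℤ} (hb : BddWord (padZero s)) (N : ℕ) :
    (α - β) * realize α β (padZero s) =
      ∑ i ∈ Finset.range N, (s i : ℝ) * β ^ (i + 1) + ∑' i, (s (i + N) : ℝ) * β ^ (i + N + 1) := by
  have h0 := conj_pos hα hprod
  have h1 := conj_lt hα hprod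
  have hne : α - β ≠ 0 := by linarith
  have hsm : Summable fun i : ℕ => (s i : ℝ) * β ^ (i + 1) := by
    refine ((hb.summable_comp h0 (by linarith) fun i => i + 1).mul_left β).congr fun i => ?_
    rw [padZero_succ]; ring
  rw [hsm.sum_add_tsum_nat_add N, realize_padZero hprod, rightSum, mul_div_cancel₀ _ hne,
    ← tsum_mul_left]
  refine tsum_congr fun i => ?_
  rw [add_comm 1 (i : ℤ), padZero_succ]; ring

/-- Altering finitely many letters adds an integer combination of powers of `β = b - α`, divided by
`α - β`. -/
lemma exists_realize_eq_add_of_eventuallyEq {s s' : ℕ → ℤ} (hb : BddWord (padZero s))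
    (hb' : BddWord (padZero s')) (h : ∀ᶠ n in atTop, s n = s' n) :
    ∃ x ∈ baseSet α β, realize α β (padZero s) = realize α β (padZero s') + x := by
  obtain ⟨N, hN⟩ := eventually_atTop.1 h
  have h1 := conj_lt hα hprod
  have hne : α - β ≠ 0 := by linarith
  have e := realize_padZero_eq_sum_add hα hprod hb N
  have e' := realize_padZero_eq_sum_add hα hprod hb' N
  have htail : ∑' i, (s (i + N) : ℝ) * β ^ (i + N + 1) =
      ∑' i, (s' (i + N) : ℝ) * β ^ (i + N + 1) :=
    tsum_congr fun i => by rw [hN _ (by omega)]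
  refine ⟨_, ⟨∑ i ∈ Finset.range N, ((s i - s' i : ℤ) : ℝ) * β ^ (i + 1), ?_, rfl⟩, ?_⟩
  · have hβ : β ∈ Algebra.adjoin ℤ {α} := by
      rw [show β = (b : ℝ) - α by linarith]
      exact sub_mem (natCast_mem _ _) (Algebra.self_mem_adjoin_singleton ℤ α)
    exact sum_mem fun i _ => mul_mem (intCast_mem _ _) (pow_mem hβ _)
  · rw [← sub_eq_iff_eq_add', eq_div_iff hne]
    push_cast
    simp only [sub_mul, Finset.sum_sub_distrib]
    linear_combination e - e' + htail

lemma limsupDist_of_eventually_mechWord {p q : ℕ} (hq : 1 ≤ q) (hpq : p.Coprime q) {a : ℤ}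
    {s : ℕ → ℤ} (h : ∀ᶠ n in atTop, padZero s n = mechWord p q a n) {x : ℝ}
    (hx : x ∈ baseSet α β) :
    limsupDist α (realize α β (padZero s) + x) = gapVal β q / (α - β) := by
  have h0 := conj_pos hα hprod
  have h1 := conj_lt hα hprod
  have h1' : β < 1 := by linarith
  have hm := bddWord_mechWord (p := p) hq a
  have hb : BddWord (padZero s) := by
    obtain ⟨B, hB⟩ := hm
    refine bddWord_padZero (B := B) ?_
    rw [← eventually_padZero_iff (Q := fun _ z => |z| ≤ B)]
    filter_upwards [h] with n hn
    rw [hn]; exact hB n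
  have hlim : limsupPhi β (padZero s) = gapVal β q := by
    rw [limsupPhi_congr h0 h1' hb hm h, limsupPhi_mechWord h0 h1' hq hpq]
  rw [limsupDist_realize_add hα hprod hsum hb (hlim.trans_le (gapVal_lt h0 h1' hq).le) hx, hlim]

lemma limsupDist_of_christoffel {ν : List Bool} (hν : IsChristoffel ν) {n : ℕ}
    (hn : (gam ν).length = n + 1) (k : ℕ) {x : ℝ} (hx : x ∈ baseSet α β) :
    limsupDist α (realize α β (padZero fun i => gamSeq (periodicWord ν) (k + i)) + x) =
      pSeq b n / qSeq b n := by
  obtain ⟨p, q, e, hq, hpq, hlen, h⟩ := hν.exists_mechWord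
  obtain rfl : q = n + 1 := by omega
  rw [pSeq_div_qSeq_eq_gapVal hα hprod hsum]
  refine limsupDist_of_eventually_mechWord hα hprod hsum hq hpq (a := e + k * p) ?_ hx
  rw [eventually_padZero_iff (Q := fun m z => z = mechWord p (n + 1) (e + k * p) m)]
  refine Eventually.of_forall fun m => ?_
  rw [h, ← mechWord_add]
  push_cast
  rw [add_assoc]

/-- The dichotomy for limits superior not exceeding the critical value. -/
lemma exists_word_of_limsupDist_le {ξ : ℝ} (h : limsupDist α ξ ≤ 1 / (1 + α)) :
    ∃ s : ℕ → ℤ, ∃ x ∈ baseSet α β, (∀ᶠ n in atTop, |s n| ≤ 1) ∧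
      ξ = realize α β (padZero s) + x ∧ limsupDist α ξ = limsupPhi β (padZero s) / (α - β) ∧
      limsupPhi β (padZero s) ≤ 1 - β := by
  have h1 := conj_lt hα hprod
  obtain ⟨s, x, hx, -, hξ, hlim, habs⟩ := exists_eq_realize_add hα hprod hsum ξ
  refine ⟨s, x, hx, habs h, hξ, hlim, ?_⟩
  rwa [hlim, ← conj_div_eq hα hprod, div_le_div_iff_of_pos_right (by linarith)] at h

/-- Below the critical value the coding word is eventually some `mechWord`, hence a signed shift of
a Christoffel coding up to finitely many letters, which the base set absorbs. -/
lemma mem_christoffelSet_or {ξ : ℝ} (h : limsupDist α ξ ≤ 1 / (1 + α)) :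
    limsupDist α ξ = 1 / (1 + α) ∨ ∃ n, limsupDist α ξ = pSeq b n / qSeq b n ∧
      ξ ∈ christoffelSet α β n := by
  have h0 := conj_pos hα hprod
  have h1 := conj_lt hα hprod
  obtain ⟨s, x, hx, habs, rfl, hlim, hle⟩ := exists_word_of_limsupDist_le hα hprod hsum h
  have hb := bddWord_padZero habs
  rcases hle.eq_or_lt with heq | hlt
  · left; rw [hlim, heq, conj_div_eq hα hprod]
  right
  obtain ⟨p, q, a, hq, hpq, hcop, hev⟩ := exists_mechWord_of_limsupPhi_lt h0 h1 hb
    (eventually_padZero_iff (Q := fun _ z => |z| ≤ 1).2 habs) hlt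
  have hval := limsupDist_of_eventually_mechWord hα hprod hsum hq hcop hev hx
  obtain ⟨n, rfl⟩ : ∃ n, q = n + 1 := ⟨q - 1, by omega⟩
  refine ⟨n, by rw [hval, pSeq_div_qSeq_eq_gapVal hα hprod hsum], ?_⟩
  obtain ⟨ν, σ, k, hν, hlen, hk, hσ, hmech⟩ := exists_christoffel_of_mechWord hq hpq hcop a
  rw [eventually_padZero_iff (Q := fun n z => z = mechWord p (_ + 1) a n)] at hev
  have hev' : ∀ᶠ m in atTop, s m = σ * gamSeq (periodicWord ν) (k + m) :=
    hev.mono fun m hm => by rw [hm, hmech]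
  obtain ⟨y, hy, he⟩ := exists_realize_eq_add_of_eventuallyEq hα hprod hsum hb
    (bddWord_padZero (B := 1) ((hev'.and habs).mono fun m hm => hm.1 ▸ hm.2)) hev'
  refine ⟨ν, hν, hlen, k, by omega, y + x, add_mem_baseSet hprod hsum hy hx, ?_⟩
  rw [he, realize_padZero_smul α β (fun i => gamSeq (periodicWord ν) (k + i)), add_assoc]
  rcases hσ with rfl | rfl
  · left; simp
  · right; simp

theorem levelSet_eq_christoffelSet (n : ℕ) :
    levelSet α ((pSeq b n : ℝ) / (qSeq b n : ℝ)) = christoffelSet α β n := by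
  have hmono := strictMono_pSeq_div_qSeq hα hprod hsum
  have hlt : ∀ m, (pSeq b m : ℝ) / (qSeq b m : ℝ) < 1 / (1 + α) := fun m =>
    (hmono m.lt_succ_self).trans_le
      (hmono.monotone.ge_of_tendsto (tendsto_pSeq_div_qSeq hα hprod hsum) _)
  ext ξ
  constructor
  · intro hξ
    have hξ' : limsupDist α ξ = (pSeq b n : ℝ) / (qSeq b n : ℝ) := hξ
    rcases mem_christoffelSet_or hα hprod hsum (hξ'.trans_le (hlt n).le) with h | ⟨m, h, hm⟩
    · exact absurd (hξ'.symm.trans h) (hlt n).ne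
    · obtain rfl : m = n := hmono.injective (h.symm.trans hξ')
      exact hm
  · rintro ⟨ν, hν, hlen, k, -, x, hx, rfl | rfl⟩
    · exact limsupDist_of_christoffel hα hprod hsum hν hlen k hx
    · have := limsupDist_of_christoffel hα hprod hsum hν hlen k (neg_mem_baseSet hprod hsum hx)
      rw [← limsupDist_neg, neg_add, neg_neg] at this
      exact this

/-- For a periodic word the realization is a finite sum over one period divided by `(α - β)(1 - β ^
q)`. -/
lemma christoffelSet_subset_adjoin (n : ℕ) :
    christoffelSet α β n ⊆ (IntermediateField.adjoin ℚ ({α} : Set ℝ) : Set ℝ) := by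
  have h0 := conj_pos hα hprod
  have h1 := conj_lt hα hprod
  have hne : α - β ≠ 0 := by linarith
  have hαmem : α ∈ IntermediateField.adjoin ℚ ({α} : Set ℝ) :=
    IntermediateField.mem_adjoin_simple_self ℚ α
  have hβmem : β ∈ IntermediateField.adjoin ℚ ({α} : Set ℝ) := by
    rw [show β = (b : ℝ) - α by linarith]
    exact sub_mem (natCast_mem _ _) hαmem
  have hbase : ∀ x ∈ baseSet α β, x ∈ IntermediateField.adjoin ℚ ({α} : Set ℝ) := by
    intro x hx
    obtain ⟨u₀, u₁, rfl⟩ := (mem_baseSet_iff hprod hsum).1 hx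
    exact div_mem (sub_mem (intCast_mem _ _) (mul_mem hβmem (intCast_mem _ _)))
      (sub_mem hαmem hβmem)
  have key : ∀ ν : List Bool, IsChristoffel ν → ∀ k : ℕ,
      realize α β (padZero fun i => gamSeq (periodicWord ν) (k + i)) ∈
        IntermediateField.adjoin ℚ ({α} : Set ℝ) := by
    intro ν hν k
    obtain ⟨p, q, e, hq, -, -, h⟩ := hν.exists_mechWord
    obtain ⟨B, hB⟩ := bddWord_mechWord (p := p) hq e
    set s : ℕ → ℤ := fun i => gamSeq (periodicWord ν) (k + i) with hs
    have hb : BddWord (padZero s) := bddWord_padZero (B := B)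
      (Eventually.of_forall fun m => by rw [hs]; beta_reduce; rw [h]; exact hB _)
    have hper : ∀ m, s (m + q) = s m := fun m => by
      rw [hs]; beta_reduce
      rw [h, h, ← mechWord_add_period hq e ((k + m : ℕ) + 1) 1]
      push_cast; congr 1; ring
    have e1 := realize_padZero_eq_sum_add hα hprod hb q
    have e2 := realize_padZero_eq_sum_add hα hprod hb 0
    have e3 : ∑' i, (s (i + q) : ℝ) * β ^ (i + q + 1) =
        β ^ q * ∑' i, (s (i + 0) : ℝ) * β ^ (i + 0 + 1) := by
      rw [← tsum_mul_left]
      refine tsum_congr fun i => ?_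
      rw [hper]; ring_nf
    rw [Finset.sum_range_zero, zero_add] at e2
    rw [e3, ← e2] at e1
    have hq1 : β ^ q < 1 := pow_lt_one₀ h0.le (by linarith) (by omega)
    have hne' : (α - β) * (1 - β ^ q) ≠ 0 := mul_ne_zero hne (by linarith)
    rw [show realize α β (padZero s) = (∑ i ∈ Finset.range q, (s i : ℝ) * β ^ (i + 1)) /
      ((α - β) * (1 - β ^ q)) by rw [eq_div_iff hne']; linear_combination e1]
    exact div_mem (sum_mem fun i _ => mul_mem (intCast_mem _ _) (pow_mem hβmem _))
      (mul_mem (sub_mem hαmem hβmem) (sub_mem (one_mem _) (pow_mem hβmem _)))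
  rintro ξ ⟨ν, hν, -, k, -, x, hx, rfl | rfl⟩
  · exact add_mem (key ν hν k) (hbase x hx)
  · exact add_mem (neg_mem (key ν hν k)) (hbase x hx)

/-- Local balance is equivalent to `limsup ≤ 1 - β` for words over `{-1,0,1}`, and strict inequality
is then equivalent to eventual periodicity. -/
theorem levelSet_eq_signedEventuallyBalancedSet :
    levelSet α (1 / (1 + α)) = signedEventuallyBalancedSet α β := by
  have h0 := conj_pos hα hprod
  have h1 := conj_lt hα hprod
  have hpos : 0 < α - β := by linarith
  ext ξ
  constructor
  · intro hξ
    have hξ' : limsupDist α ξ = 1 / (1 + α) := hξ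
    obtain ⟨s, x, hx, habs, rfl, hlim, hle⟩ := exists_word_of_limsupDist_le hα hprod hsum hξ'.le
    refine ⟨s, eventuallyLocally_of_limsupPhi_le h0 h1 habs hle, fun hper => ?_, x, hx, rfl⟩
    have := limsupPhi_lt_of_eventuallyPeriodic h0 h1 habs hle hper
    rw [hlim, ← conj_div_eq hα hprod, div_left_inj' hpos.ne'] at hξ'
    exact this.ne hξ'
  · rintro ⟨s, hloc, hper, x, hx, rfl⟩
    have habs := eventually_abs_le_of_eventuallyLocally hloc
    have hb := bddWord_padZero habs
    have hle := limsupPhi_le_of_eventuallyLocally h0 (by linarith) hb hloc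
    have heq : limsupPhi β (padZero s) = 1 - β := by
      refine hle.eq_of_not_lt fun hlt => hper ?_
      obtain ⟨p, q, a, hq, -, -, hev⟩ := exists_mechWord_of_limsupPhi_lt h0 h1 hb
        (eventually_padZero_iff (Q := fun _ z => |z| ≤ 1).2 habs) hlt
      exact eventuallyPeriodic_of_eventually_mechWord hq hev
    change limsupDist α _ = _
    rw [limsupDist_realize_add hα hprod hsum hb hle hx, heq, conj_div_eq hα hprod]

lemma eventuallyBalancedSet_subset :
    eventuallyBalancedSet α β ⊆ levelSet α (1 / (1 + α)) := by
  rw [levelSet_eq_signedEventuallyBalancedSet hα hprod hsum]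
  rintro ξ ⟨y, hy, hper, k, -, x, hx, h⟩
  obtain ⟨σ, hσ, rfl⟩ : ∃ σ : ℤ, (σ = 1 ∨ σ = -1) ∧
      ξ = σ * realize α β (padZero fun i => gamSeq y (k + i)) + x := by
    rcases h with rfl | rfl
    · exact ⟨1, Or.inl rfl, by simp⟩
    · exact ⟨-1, Or.inr rfl, by simp⟩
  exact ⟨_, eventuallyLocally_gamSeq hy k σ hσ, not_eventuallyPeriodic_gamSeq hper k σ hσ, x, hx,
    by rw [realize_padZero_smul α β (fun i => gamSeq y (k + i))]⟩

end

/-! ### Uncountability at the critical value -/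

/-- The second difference of `n ↦ ⌊nθ⌋`. -/
noncomputable def rotationWord (θ : ℝ) (n : ℤ) : ℤ :=
  ⌊((n + 1 : ℤ) : ℝ) * θ⌋ - 2 * ⌊(n : ℝ) * θ⌋ + ⌊((n - 1 : ℤ) : ℝ) * θ⌋

lemma balancedSum_floor (θ : ℝ) : BalancedSum fun n => ⌊(n : ℝ) * θ⌋ := by
  intro l i j _
  have h1 := Int.floor_le (((i + l : ℤ) : ℝ) * θ)
  have h2 := Int.lt_floor_add_one ((i : ℝ) * θ)
  have h3 := Int.lt_floor_add_one (((j + l : ℤ) : ℝ) * θ)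
  have h4 := Int.floor_le ((j : ℝ) * θ)
  push_cast at h1 h3
  beta_reduce
  push_cast
  have : ((⌊((i : ℝ) + l) * θ⌋ - ⌊(i : ℝ) * θ⌋ - (⌊((j : ℝ) + l) * θ⌋ - ⌊(j : ℝ) * θ⌋) : ℤ) : ℝ) <
      ((2 : ℤ) : ℝ) := by
    push_cast
    linarith
  have := Int.cast_lt.1 this
  omega

lemma summable_floor_mul_pow {β : ℝ} (h0 : 0 < β) (h1 : β < 1) {θ : ℝ}
    (hθ : θ ∈ Set.Ico (0 : ℝ) 1) : Summable fun n : ℕ => (⌊(n : ℝ) * θ⌋ : ℝ) * β ^ n := by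
  have hs := summable_pow_mul_geometric_of_norm_lt_one (R := ℝ) 1
    (by rwa [Real.norm_of_nonneg h0.le] : ‖β‖ < 1)
  refine Summable.of_nonneg_of_le (fun n => ?_) (fun n => ?_) hs
  · have : 0 ≤ ⌊(n : ℝ) * θ⌋ := Int.floor_nonneg.2 (mul_nonneg n.cast_nonneg hθ.1)
    have : (0 : ℝ) ≤ ⌊(n : ℝ) * θ⌋ := by exact_mod_cast this
    positivity
  · rw [pow_one]
    gcongr
    exact (Int.floor_le _).trans (mul_le_of_le_one_right n.cast_nonneg hθ.2.le)

/-- The floors increase weakly with the slope, and strictly at an index `N` with `N (θ' - θ) > 1`.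
-/
lemma tsum_floor_strictMonoOn {β : ℝ} (h0 : 0 < β) (h1 : β < 1) :
    StrictMonoOn (fun θ : ℝ => ∑' n : ℕ, (⌊(n : ℝ) * θ⌋ : ℝ) * β ^ n) (Set.Ico 0 1) := by
  intro θ hθ θ' hθ' hlt
  obtain ⟨N, hN⟩ := exists_nat_gt (1 / (θ' - θ))
  have hd : 0 < θ' - θ := sub_pos.2 hlt
  rw [div_lt_iff₀ hd] at hN
  refine Summable.tsum_lt_tsum (i := N) (fun n => ?_) ?_ (summable_floor_mul_pow h0 h1 hθ)
    (summable_floor_mul_pow h0 h1 hθ')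
  · dsimp only
    gcongr
  · gcongr
    have h2 := Int.floor_le ((N : ℝ) * θ)
    have h3 := Int.lt_floor_add_one ((N : ℝ) * θ')
    have : (⌊(N : ℝ) * θ⌋ : ℝ) < ⌊(N : ℝ) * θ'⌋ := by linarith
    exact_mod_cast this

section

variable {α β : ℝ} (hα : 3 < α) (hprod : α * β = 1)
include hα hprod

/-- Two summations by parts; the boundary terms vanish because `⌊0⌋ = ⌊θ⌋ = 0` on `[0,1)`. -/
lemma realize_rotationWord {θ : ℝ} (hθ : θ ∈ Set.Ico (0 : ℝ) 1) :
    realize α β (padZero fun n : ℕ => rotationWord θ (n + 1)) =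
      (1 - β) ^ 2 / (β * (α - β)) * ∑' n : ℕ, (⌊(n : ℝ) * θ⌋ : ℝ) * β ^ n := by
  have h0 := conj_pos hα hprod
  have h1 := conj_lt hα hprod
  have hne : α - β ≠ 0 := by linarith
  have hs := summable_floor_mul_pow h0 (by linarith) hθ
  have hs1 := (summable_nat_add_iff 1).2 hs
  have hs2 := (summable_nat_add_iff 2).2 hs
  have e1 := hs.sum_add_tsum_nat_add 1
  have e2 := hs.sum_add_tsum_nat_add 2
  have hfl : ⌊θ⌋ = 0 := Int.floor_eq_zero_iff.2 hθ
  simp only [Finset.sum_range_succ, Finset.sum_range_zero, Nat.cast_zero, zero_mul, Int.floor_zero,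
    Int.cast_zero, zero_add, Nat.cast_one, one_mul, hfl] at e1 e2
  have key : β * ((α - β) * realize α β (padZero fun n : ℕ => rotationWord θ (n + 1))) =
      (1 - β) ^ 2 * ∑' n : ℕ, (⌊(n : ℝ) * θ⌋ : ℝ) * β ^ n := by
    rw [realize_padZero hprod, mul_div_cancel₀ _ hne, rightSum, ← tsum_mul_left, ← tsum_mul_left]
    trans ∑' n : ℕ, ((⌊((n + 2 : ℕ) : ℝ) * θ⌋ : ℝ) * β ^ (n + 2) -
      2 * β * ((⌊((n + 1 : ℕ) : ℝ) * θ⌋ : ℝ) * β ^ (n + 1)) +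
      β ^ 2 * ((⌊(n : ℝ) * θ⌋ : ℝ) * β ^ n))
    · refine tsum_congr fun n => ?_
      rw [add_comm 1 (n : ℤ), padZero_succ, rotationWord]
      have a1 : (((n : ℤ) + 1 + 1 : ℤ) : ℝ) = ((n + 2 : ℕ) : ℝ) := by push_cast; ring
      have a2 : (((n : ℤ) + 1 : ℤ) : ℝ) = ((n + 1 : ℕ) : ℝ) := by push_cast; ring
      have a3 : (((n : ℤ) + 1 - 1 : ℤ) : ℝ) = (n : ℝ) := by push_cast; ring
      rw [a1, a2, a3]
      push_cast
      ring
    · rw [((hs2.sub (hs1.mul_left (2 * β)))).tsum_add (hs.mul_left (β ^ 2)),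
        hs2.tsum_sub (hs1.mul_left (2 * β)), tsum_mul_left, tsum_mul_left, e1, e2]
      ring
  field_simp
  linear_combination key

omit hα hprod in
lemma bddWord_padZero_rotationWord (θ : ℝ) :
    BddWord (padZero fun n : ℕ => rotationWord θ (n + 1)) := by
  obtain ⟨B, hB⟩ := (balancedSum_floor θ).bddWord (t := rotationWord θ) fun _ => rfl
  exact bddWord_padZero (B := B) (Eventually.of_forall fun n => hB _)

lemma limsupDist_realize_rotationWord_le {b : ℕ} (hsum : α + β = b) (θ : ℝ) :
    limsupDist α (realize α β (padZero fun n : ℕ => rotationWord θ (n + 1))) ≤ 1 / (1 + α) := by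
  have h0 := conj_pos hα hprod
  have h1 := conj_lt hα hprod
  have h1' : β < 1 := by linarith
  have hS := balancedSum_floor θ
  have hb := bddWord_padZero_rotationWord θ
  have hle : limsupPhi β (padZero fun n : ℕ => rotationWord θ (n + 1)) ≤ 1 - β := by
    rw [limsupPhi_congr h0 h1' hb (hS.bddWord (t := rotationWord θ) fun _ => rfl)
      ((eventually_padZero_iff (Q := fun n z => z = rotationWord θ n)).2
        (Eventually.of_forall fun n => rfl))]
    exact limsup_le_of_le isCobounded_abs_Phi
      (Eventually.of_forall fun n => hS.abs_Phi_le h0 h1' (fun _ => rfl) n)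
  have hz : (0 : ℝ) ∈ baseSet α β := (mem_baseSet_iff hprod hsum).2 ⟨0, 0, by simp⟩
  have := limsupDist_realize_add hα hprod hsum hb hle hz
  rw [add_zero] at this
  rw [this, ← conj_div_eq hα hprod]
  exact div_le_div_of_nonneg_right hle (by linarith)

/-- Uncountably many slopes give distinct points with value at most the critical one; each lies in
the level set or in the countable field `ℚ(α)`. -/
theorem not_countable_levelSet {b : ℕ} (hsum : α + β = b) :
    ¬ (levelSet α (1 / (1 + α))).Countable := by
  intro hc
  have h0 := conj_pos hα hprod
  have h1 := conj_lt hα hprod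
  have hα_integral : IsIntegral ℚ α := by
    refine ⟨.X ^ 2 - .C (b : ℚ) * .X + 1, ?_, ?_⟩
    · monicity!
    · simp only [Polynomial.eval₂_add, Polynomial.eval₂_sub, Polynomial.eval₂_pow,
        Polynomial.eval₂_mul, Polynomial.eval₂_X, Polynomial.eval₂_one,
        map_natCast, Polynomial.eval₂_natCast]
      rw [← hsum]
      linear_combination -hprod
  have hfield : (IntermediateField.adjoin ℚ ({α} : Set ℝ) : Set ℝ).Countable := by
    refine (Algebraic.countable ℚ ℝ).mono fun x hx => ?_
    have : Algebra.IsAlgebraic ℚ (IntermediateField.adjoin ℚ ({α} : Set ℝ)) :=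
      IntermediateField.isAlgebraic_adjoin_simple hα_integral
    exact (this.isAlgebraic ⟨x, hx⟩).algebraMap
  set g : ℝ → ℝ := fun θ => realize α β (padZero fun n : ℕ => rotationWord θ (n + 1)) with hg
  have hinj : Set.InjOn g (Set.Ico 0 1) := by
    intro θ hθ θ' hθ' he
    have hc : (1 - β) ^ 2 / (β * (α - β)) ≠ 0 := by
      have : 0 < (1 - β) ^ 2 / (β * (α - β)) :=
        div_pos (pow_pos (by linarith) 2) (mul_pos h0 (by linarith))
      exact this.ne'
    rw [hg] at he
    beta_reduce at he
    rw [realize_rotationWord hα hprod hθ, realize_rotationWord hα hprod hθ',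
      mul_right_inj' hc] at he
    exact (tsum_floor_strictMonoOn h0 (by linarith)).injOn hθ hθ' he
  have hmaps : Set.MapsTo g (Set.Ico 0 1)
      (levelSet α (1 / (1 + α)) ∪ (IntermediateField.adjoin ℚ ({α} : Set ℝ) : Set ℝ)) := by
    intro θ _
    rcases mem_christoffelSet_or hα hprod hsum
      (limsupDist_realize_rotationWord_le hα hprod hsum θ) with h | ⟨n, -, h⟩
    · exact Or.inl h
    · exact Or.inr (christoffelSet_subset_adjoin hα hprod hsum n h)
  have := hmaps.countable_of_injOn hinj (hc.union hfield)
  have hcard := Cardinal.mk_Ico_real (show (0 : ℝ) < 1 by norm_num)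
  exact absurd (this.le_aleph0) (by rw [hcard]; exact not_le.2 Cardinal.aleph0_lt_continuum)

/-! ### The spectrum -/

theorem lagrangeSpectrum_inter_Icc {b : ℕ} (hsum : α + β = b) :
    lagrangeSpectrum α ∩ Set.Icc 0 (1 / (1 + α)) =
      Set.range (fun n : ℕ => (pSeq b n : ℝ) / (qSeq b n : ℝ)) ∪ {1 / (1 + α)} := by
  have hmono := strictMono_pSeq_div_qSeq hα hprod hsum
  ext t
  constructor
  · rintro ⟨⟨ξ, rfl⟩, -, h⟩
    rcases mem_christoffelSet_or hα hprod hsum h with h | ⟨n, h, -⟩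
    · exact Or.inr h
    · exact Or.inl ⟨n, h.symm⟩
  · rintro (⟨n, rfl⟩ | rfl)
    · have hz : (0 : ℝ) ∈ baseSet α β := (mem_baseSet_iff hprod hsum).2 ⟨0, 0, by simp⟩
      -- Slope `1/(n+1)` is the simplest word of period `n + 1`; every numerator prime to `n + 1`
      -- gives the same value.
      have hval := limsupDist_of_eventually_mechWord hα hprod hsum (p := 1) (q := n + 1) (a := 0)
        (s := fun m : ℕ => mechWord 1 (n + 1) 0 (m + 1)) (by omega) (Nat.coprime_one_left _)
        ((eventually_padZero_iff (Q := fun m z => z = mechWord 1 (n + 1) 0 m)).2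
          (Eventually.of_forall fun m => rfl)) hz
      rw [← pSeq_div_qSeq_eq_gapVal hα hprod hsum] at hval
      beta_reduce
      exact ⟨⟨_, hval⟩, hval ▸ limsupDist_nonneg _ _,
        hmono.monotone.ge_of_tendsto (tendsto_pSeq_div_qSeq hα hprod hsum) n⟩
    · have hne : (levelSet α (1 / (1 + α))).Nonempty := by
        rw [Set.nonempty_iff_ne_empty]
        intro h
        exact not_countable_levelSet hα hprod hsum (h ▸ Set.countable_empty)
      obtain ⟨ξ, hξ⟩ := hne
      exact ⟨⟨ξ, hξ⟩, div_nonneg one_pos.le (by linarith), le_rfl⟩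

/-- The strictly increasing values `p_n/q_n` accumulate at their limit, and only finitely many
points of the spectrum lie below any smaller `c`. -/
theorem isLeast_accPt_lagrangeSpectrum {b : ℕ} (hsum : α + β = b) :
    IsLeast {t : ℝ | AccPt t (𝓟 (lagrangeSpectrum α))} (1 / (1 + α)) := by
  have hmono := strictMono_pSeq_div_qSeq hα hprod hsum
  have hlim := tendsto_pSeq_div_qSeq hα hprod hsum
  have hspec := lagrangeSpectrum_inter_Icc hα hprod hsum
  refine ⟨?_, fun t ht => ?_⟩
  · refine accPt_iff_frequently.2 (hlim.frequently (Frequently.of_forall fun n => ?_))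
    refine ⟨((hmono n.lt_succ_self).trans_le (hmono.monotone.ge_of_tendsto hlim _)).ne, ?_⟩
    exact (hspec.ge (Or.inl ⟨n, rfl⟩)).1
  · by_contra! hlt
    obtain ⟨c, htc, hc⟩ := exists_between hlt
    obtain ⟨N, hN⟩ := eventually_atTop.1 (hlim.eventually (eventually_gt_nhds hc))
    set F : Set ℝ := (fun n : ℕ => (pSeq b n : ℝ) / (qSeq b n : ℝ)) '' Set.Iio N with hF
    have hfin : (F \ {t}).Finite := ((Set.finite_Iio N).image _).subset Set.sdiff_subset
    have h1 : ∀ᶠ y in 𝓝 t, y ∉ F \ {t} :=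
      hfin.isClosed.isOpen_compl.eventually_mem fun h => h.2 rfl
    obtain ⟨y, ⟨hne, hy⟩, hyF, hyc⟩ := ((accPt_iff_frequently.1 ht).and_eventually
      (h1.and (eventually_lt_nhds htc))).exists
    refine hyF ⟨?_, hne⟩
    have hy0 : 0 ≤ y := by
      obtain ⟨ξ, rfl⟩ := hy
      exact limsupDist_nonneg α ξ
    rcases hspec.le ⟨hy, hy0, (hyc.trans hc).le⟩ with ⟨n, rfl⟩ | h
    · refine ⟨n, ?_, rfl⟩
      by_contra hn
      exact absurd (hN n (not_lt.1 hn)) (not_lt.2 hyc.le)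
    · exact absurd (hyc.trans hc) (by rw [Set.mem_singleton_iff.1 h]; exact lt_irrefl _)

end

theorem mainTheorem1 (b : ℕ) (α α₂ : ℝ) (hα : 3 < α)
    (hsum : α + α₂ = b) (hprod : α * α₂ = 1) :
    StrictMono (fun n : ℕ => (pSeq b n : ℝ) / (qSeq b n : ℝ)) ∧
    Tendsto (fun n : ℕ => (pSeq b n : ℝ) / (qSeq b n : ℝ)) atTop (𝓝 (1 / (1 + α))) ∧
    (Tendsto (fun n : ℕ => (negConv b n : ℝ)) atTop (𝓝 (1 / (1 + α))) ∧
      (∀ n : ℕ, (pSeq b (2 * n) : ℚ) / (qSeq b (2 * n) : ℚ) = negConv b n) ∧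
      (∀ n : ℕ, (pSeq b (2 * n + 1) : ℚ) / (qSeq b (2 * n + 1) : ℚ) =
        ((negConv b n).num + (negConv b (n + 1)).num : ℚ) /
          ((negConv b n).den + (negConv b (n + 1)).den : ℚ))) ∧
    lagrangeSpectrum α ∩ Set.Icc 0 (1 / (1 + α)) =
      Set.range (fun n : ℕ => (pSeq b n : ℝ) / (qSeq b n : ℝ)) ∪ {1 / (1 + α)} ∧
    IsLeast {t : ℝ | AccPt t (𝓟 (lagrangeSpectrum α))} (1 / (1 + α)) ∧
    (∀ n : ℕ,
      levelSet α ((pSeq b n : ℝ) / (qSeq b n : ℝ)) ⊆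
        (IntermediateField.adjoin ℚ ({α} : Set ℝ) : Set ℝ) ∧
      levelSet α ((pSeq b n : ℝ) / (qSeq b n : ℝ)) = christoffelSet α α₂ n) ∧
    ¬ (levelSet α (1 / (1 + α))).Countable ∧
    eventuallyBalancedSet α α₂ ⊆ levelSet α (1 / (1 + α)) ∧
    levelSet α (1 / (1 + α)) = signedEventuallyBalancedSet α α₂ := by
  refine ⟨strictMono_pSeq_div_qSeq hα hprod hsum, tendsto_pSeq_div_qSeq hα hprod hsum,
    ⟨tendsto_negConv hα hprod hsum, pSeq_div_qSeq_even (two_le_trace hα hprod hsum),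
      pSeq_div_qSeq_odd (two_le_trace hα hprod hsum)⟩,
    lagrangeSpectrum_inter_Icc hα hprod hsum, isLeast_accPt_lagrangeSpectrum hα hprod hsum,
    fun n => ⟨?_, levelSet_eq_christoffelSet hα hprod hsum n⟩,
    not_countable_levelSet hα hprod hsum, eventuallyBalancedSet_subset hα hprod hsum,
    levelSet_eq_signedEventuallyBalancedSet hα hprod hsum⟩
  rw [levelSet_eq_christoffelSet hα hprod hsum n]
  exact christoffelSet_subset_adjoin hα hprod hsum n
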